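/- **Setting.** Let $U\subset\mathbb{R}^d$ be open, let $e=(e^a_\mu)$ be a smooth moving frame on $U$ (a matrix of smooth functions, invertible at every point) with inverse matrix $f^\mu_a$, let $\omega^a_b=\omega^a_{b\mu}dx^\mu$ be its Levi-Civita connection (the $\mathfrak{so}(d)$-valued one-form with $de^a+\omega^a_b\wedge e^b=0$), $R_{ab}=\tfrac12R_{ab\mu\nu}dx^\mu\wedge dx^\nu$ its curvature $d\omega^a_b+\omega^a_c\wedge\omega^c_b$ (frame indices are moved with $\delta_{ab}$), and let $B=\tfrac12B_{\mu\nu}dx^\mu\wedge dx^\nu$ be a closed two-form on $U$. Let $\mathcal{O}(T^*U\times\mathbb{R}^{0|d})$ be the superalgebra of functions smooth in the even coordinates $x^\mu,p_a$ and polynomial in the odd coordinates $\theta^a$, and let $$\mathcal{O}(T^*U\times\mathbb{R}^{0|d}\times T^*W)=\mathcal{O}(T^*U\times\mathbb{R}^{0|d})[b,c,\beta,\gamma],$$ where $b,c$ are odd, $\beta,\gamma$ are even, $c,\gamma$ have degree $1$, $b,\beta$ have degree $-1$ and the other coordinates have degree $0$. Dropping $b,\beta$ gives $\mathcal{O}(T^*U\times\mathbb{R}^{0|d}\times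 W)$, the functions of $x,p,\theta,c,\gamma$; $\mathcal{O}(U\times W)=C^\infty(U)[c,\gamma]$. The Poisson bracket is determined by $$\{\theta^a,\theta^b\}=2\delta^{ab},\quad \{p_a,x^\mu\}=f^\mu_a,\quad \{p_a,\theta^b\}=-f^\mu_a\omega^b_{c\mu}\theta^c,\quad \{b,c\}=\{\beta,\gamma\}=1,$$ $$\{p_a,p_b\}=(f^\mu_a\omega^c_{b\mu}-f^\mu_b\omega^c_{a\mu})p_c+f^\mu_af^\nu_b\bigl(\tfrac14R_{cd\mu\nu}\theta^c\theta^d+B_{\mu\nu}\bigr),$$ all other brackets of coordinates being zero. Put $\pi=p_a\theta^a$, $S=\tfrac12c\{\pi,\pi\}+\gamma\pi-\gamma^2b$, $Q=\{S,-\}$, $\Theta=\theta^1\cdots\theta^d$, $\beta^{[k]}=\beta^k/k!$ (zero for $k<0$). For $k\ge0$ and $f\in\mathcal{O}(U\times W)$ define, after inverting $\gamma$, $$X_k(f)=Q\bigl(-\beta^{[k]}\gamma^{-1}cf\Theta\bigr),\qquad Y_k(f)=Q\bigl(\gamma^{-1}\beta^{[k-1]}f\Theta-\gamma^{-1}\beta^{[k]}c\{\{\pi,f\},\Theta\}\bigr).$$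 **Theorem.** $Q$ is a differential of degree $1$ on $\mathcal{O}(T^*U\times\mathbb{R}^{0|d}\times T^*W)$ which preserves $\mathcal{O}(T^*U\times\mathbb{R}^{0|d}\times W)$ and the ideal $(\pi,\{\pi,\pi\})$ of the latter. Moreover: 1. For all $k\ge0$ and $f\in\mathcal{O}(U\times W)$, $X_k(f)$ and $Y_k(f)$ contain no negative powers of $\gamma$ and are cocycles in $\mathcal{O}(T^*U\times\mathbb{R}^{0|d}\times T^*W)$. For $f\in C^\infty(U)$, $$X_k(f)=\gamma\beta^{[k]}f\Theta-2\beta^{[k-1]}bcf\Theta+\beta^{[k]}cf\{\pi,\Theta\},$$ $$Y_k(f)=2\beta^{[k-2]}bf\Theta+\beta^{[k-1]}f\{\pi,\Theta\}-\bigl(2\beta^{[k-1]}bc-\gamma\beta^{[k]}\bigr)\{\{\pi,f\},\Theta\}+\beta^{[k]}c\{\pi,\{\{\pi,f\},\Theta\}\}.$$ 2. In negative degrees the cohomology $H^*(\mathcal{O}(T^*U\times\mathbb{R}^{0|d}\times T^*W),Q)$ is spanned by the classes of these cocycles: for $n\ge1$ every class in $H^{-n}$ is of the form $[X_{n+1}(f)]+[Y_{n+1}(g)]$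 with $f,g\in C^\infty(U)$. 3. In positive degrees $n\ge1$ every class in $H^n$ is represented by a cocycle in $\mathcal{O}(T^*U\times\mathbb{R}^{0|d}\times W)$, and there is an isomorphism $$H^n\bigl(\mathcal{O}(T^*U\times\mathbb{R}^{0|d}\times T^*W),Q\bigr)\cong H^n\bigl(\mathcal{O}(T^*U\times\mathbb{R}^{0|d}\times W)/(\pi,\{\pi,\pi\}),Q\bigr)$$ which sends the class of each such cocycle to the class of its image in the quotient. 4. $H^n(\mathcal{O}(T^*U\times\mathbb{R}^{0|d}\times T^*W),Q)=0$ for $n\ge2$. -/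

import Mathlib

open TopologicalSpace TensorProduct
open scoped ContDiff

noncomputable section

namespace SpinningParticle

/-! ### Smooth functions on an open set -/

section Smooth

/-- Extension by zero of a function on an open set `W`. -/
def ext {E : Type*} [TopologicalSpace E] (W : Opens E) (f : W → ℝ) : E → ℝ := Function.extend Subtype.val f 0

theorem ext_apply {E : Type*} [TopologicalSpace E] (W : Opens E) (f : W → ℝ) (z : W) :
    ext W f z = f z :=
  Subtype.val_injective.extend_apply f 0 z

variable {E : Type*} [NormedAddCommGroup E] [NormedSpace ℝ E]

theorem contDiffOn_ext_iff (W : Opens E) (f : W → ℝ) (g : E → ℝ) (h : ∀ z : W, f z = g z) :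
    ContDiffOn ℝ ∞ (ext W f) W ↔ ContDiffOn ℝ ∞ g W :=
  contDiffOn_congr fun z hz => (ext_apply W f ⟨z, hz⟩).trans (h ⟨z, hz⟩)

/-- The smooth real functions on the open set `W`, as a subalgebra of all functions. -/
def smoothSubalgebra (W : Opens E) : Subalgebra ℝ (W → ℝ) where
  carrier := {f | ContDiffOn ℝ ∞ (ext W f) W}
  mul_mem' {f g} hf hg :=
    (contDiffOn_ext_iff W _ (fun z => ext W f z * ext W g z)
      fun z => by simp [ext_apply]).2 (ContDiffOn.mul hf hg)
  add_mem' {f g} hf hg :=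
    (contDiffOn_ext_iff W _ (fun z => ext W f z + ext W g z)
      fun z => by simp [ext_apply]).2 (ContDiffOn.add hf hg)
  algebraMap_mem' r :=
    (contDiffOn_ext_iff W _ (fun _ => r) fun _ => rfl).2 contDiffOn_const

/-- The algebra `C^∞(W)` of smooth real functions on the open set `W`. -/
def SmoothFn (W : Opens E) : Type _ := smoothSubalgebra W

instance (W : Opens E) : CommRing (SmoothFn W) :=
  inferInstanceAs (CommRing (smoothSubalgebra W))

instance (W : Opens E) : Algebra ℝ (SmoothFn W) :=
  inferInstanceAs (Algebra ℝ (smoothSubalgebra W))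

theorem SmoothFn.ext {W : Opens E} {f g : SmoothFn W} (h : ∀ z, f.1 z = g.1 z) : f = g :=
  Subtype.ext (funext h)

theorem differentiableAt_ext {W : Opens E} (f : SmoothFn W) (z : W) :
    DifferentiableAt ℝ (ext W f.1) z :=
  (ContDiffOn.differentiableOn f.2 (by simp)).differentiableAt (W.isOpen.mem_nhds z.2)

theorem fderiv_ext_eq {W : Opens E} {f : W → ℝ} {g : E → ℝ} (h : ∀ z : W, f z = g z) (z : W) :
    fderiv ℝ (ext W f) z = fderiv ℝ g z :=
  Filter.EventuallyEq.fderiv_eq <| by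
    filter_upwards [W.isOpen.mem_nhds z.2] with y hy
    exact (ext_apply W f ⟨y, hy⟩).trans (h ⟨y, hy⟩)

/-- The directional derivative `f ↦ ∂_v f`, a derivation of `C^∞(W)`. -/
def dirDeriv (W : Opens E) (v : E) : Derivation ℝ (SmoothFn W) (SmoothFn W) :=
  Derivation.mk'
    { toFun := fun f => ⟨fun z => fderiv ℝ (ext W f.1) z v,
        (contDiffOn_ext_iff W _ (fun z => fderiv ℝ (ext W f.1) z v) fun _ => rfl).2
          ((ContDiffOn.fderiv_of_isOpen f.2 W.isOpen (by simp)).clm_apply contDiffOn_const)⟩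
      map_add' := fun f g => by
        refine SmoothFn.ext fun z => ?_
        change fderiv ℝ (ext W (f.1 + g.1)) z v
          = fderiv ℝ (ext W f.1) z v + fderiv ℝ (ext W g.1) z v
        rw [fderiv_ext_eq (g := fun z => ext W f.1 z + ext W g.1 z)
          (fun z => by simp [ext_apply]),
          fderiv_fun_add (differentiableAt_ext f z) (differentiableAt_ext g z)]
        rfl
      map_smul' := fun r f => by
        refine SmoothFn.ext fun z => ?_
        change fderiv ℝ (ext W (r • f.1)) z v = r * fderiv ℝ (ext W f.1) z v
        rw [fderiv_ext_eq (g := fun z => r * ext W f.1 z) (fun z => by simp [ext_apply]),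
          fderiv_const_mul (differentiableAt_ext f z)]
        rfl }
    (fun f g => by
      refine SmoothFn.ext fun z => ?_
      change fderiv ℝ (ext W (f.1 * g.1)) z v
        = f.1 z * fderiv ℝ (ext W g.1) z v + g.1 z * fderiv ℝ (ext W f.1) z v
      rw [fderiv_ext_eq (g := fun z => ext W f.1 z * ext W g.1 z)
        (fun z => by simp [ext_apply]),
        fderiv_fun_mul (differentiableAt_ext f z) (differentiableAt_ext g z)]
      simp [ext_apply])

end Smooth

variable {d : ℕ} {U : Opens (Fin d → ℝ)}

/-- The open set `T^*U = U × ℝ^d`, with points `(x, p)`. -/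
def cotangent (U : Opens (Fin d → ℝ)) : Opens ((Fin d → ℝ) × (Fin d → ℝ)) :=
  ⟨{z | z.1 ∈ U}, U.isOpen.preimage continuous_fst⟩

/-- Pullback of functions along the projection `T^*U → U`. -/
def pull : SmoothFn U →ₐ[ℝ] SmoothFn (cotangent U) where
  toFun f := ⟨fun z => f.1 ⟨z.1.1, z.2⟩,
    (contDiffOn_ext_iff (cotangent U) _ (fun z => ext U f.1 z.1)
      fun z => (ext_apply U f.1 ⟨z.1.1, z.2⟩).symm).2
        (ContDiffOn.comp (t := (U : Set (Fin d → ℝ))) f.2 contDiff_fst.contDiffOn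
          fun _ hz => hz)⟩
  map_one' := rfl
  map_mul' _ _ := rfl
  map_zero' := rfl
  map_add' _ _ := rfl
  commutes' _ := rfl

/-- The fibre coordinate `p_a` on `T^*U`. -/
def momentum (U : Opens (Fin d → ℝ)) (a : Fin d) : SmoothFn (cotangent U) :=
  ⟨fun z => z.1.2 a,
    (contDiffOn_ext_iff (cotangent U) _ (fun z => z.2 a) fun _ => rfl).2
      (by fun_prop)⟩

/-- The partial derivative `∂/∂x^μ` on `C^∞(U)`. -/
def pd (μ : Fin d) : Derivation ℝ (SmoothFn U) (SmoothFn U) := dirDeriv U (Pi.single μ 1)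

/-! ### The geometric background: moving frame, Levi-Civita connection, curvature -/

section Geometry

/-- A moving frame: the matrix `e^a_μ` (row `a`, column `μ`) of smooth functions on `U`,
invertible over `C^∞(U)`. -/
abbrev Frame (U : Opens (Fin d → ℝ)) := (Matrix (Fin d) (Fin d) (SmoothFn U))ˣ

variable (e : Frame U)

/-- The inverse matrix `f^μ_a`. -/
def coframe (μ a : Fin d) : SmoothFn U := (↑(e⁻¹) : Matrix (Fin d) (Fin d) (SmoothFn U)) μ a

/-- Components `(de^a)_{μν} = ∂_μ e^a_ν - ∂_ν e^a_μ`. -/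
def dFrame (a μ ν : Fin d) : SmoothFn U := pd μ (e.1 a ν) - pd ν (e.1 a μ)

/-- Frame components `de^a(f_b, f_c)`. -/
def anholonomy (a b c : Fin d) : SmoothFn U :=
  ∑ μ, ∑ ν, coframe e μ b * coframe e ν c * dFrame e a μ ν

/-- The Levi-Civita connection `ω_{abμ}` (frame indices are raised and lowered with `δ`),
given by the Koszul formula; see `connection_antisymm` and `cartan_first`. -/
def connection (a b μ : Fin d) : SmoothFn U :=
  ∑ c, ((1 / 2 : ℝ) • (anholonomy e a b c - anholonomy e b a c - anholonomy e c a b)) * e.1 c μ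

/-- Components `R_{abμν}` of the curvature `R^a_b = dω^a_b + ω^a_c ∧ ω^c_b`. -/
def curvature (a b μ ν : Fin d) : SmoothFn U :=
  pd μ (connection e a b ν) - pd ν (connection e a b μ)
    + ∑ c, (connection e a c μ * connection e c b ν - connection e a c ν * connection e c b μ)

theorem anholonomy_antisymm (a b c : Fin d) : anholonomy e a b c = -anholonomy e a c b := by
  unfold anholonomy
  rw [Finset.sum_comm, ← Finset.sum_neg_distrib]
  refine Finset.sum_congr rfl fun μ _ => ?_
  rw [← Finset.sum_neg_distrib]
  refine Finset.sum_congr rfl fun ν _ => ?_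
  simp only [dFrame]
  ring

/-- The connection takes values in `so(d)`. -/
theorem connection_antisymm (a b μ : Fin d) : connection e a b μ = -connection e b a μ := by
  unfold connection
  rw [← Finset.sum_neg_distrib]
  refine Finset.sum_congr rfl fun c _ => ?_
  rw [anholonomy_antisymm e c a b, ← neg_mul, ← smul_neg]
  congr 2
  ring

theorem coframe_frame (μ ν : Fin d) :
    ∑ b, coframe e μ b * e.1 b ν = if μ = ν then 1 else 0 := by
  have h := congrFun (congrFun (Units.inv_mul e) μ) ν
  rw [Matrix.mul_apply, Matrix.one_apply] at h
  exact h

theorem dFrame_eq (a μ ν : Fin d) :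
    dFrame e a μ ν = ∑ b, ∑ c, anholonomy e a b c * e.1 b μ * e.1 c ν := by
  have h : ∀ b c, anholonomy e a b c * e.1 b μ * e.1 c ν
      = ∑ κ, ∑ ρ, (coframe e κ b * e.1 b μ) * (coframe e ρ c * e.1 c ν) * dFrame e a κ ρ := by
    intro b c
    simp only [anholonomy, Finset.sum_mul]
    exact Finset.sum_congr rfl fun κ _ => Finset.sum_congr rfl fun ρ _ => by ring
  simp only [h]
  calc dFrame e a μ ν
      = ∑ κ, ∑ ρ, (∑ b, coframe e κ b * e.1 b μ) * (∑ c, coframe e ρ c * e.1 c ν)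
          * dFrame e a κ ρ := by
        simp [coframe_frame]
    _ = ∑ κ, ∑ ρ, ∑ b, ∑ c,
          (coframe e κ b * e.1 b μ) * (coframe e ρ c * e.1 c ν) * dFrame e a κ ρ := by
        refine Finset.sum_congr rfl fun κ _ => Finset.sum_congr rfl fun ρ _ => ?_
        rw [Finset.sum_mul_sum, Finset.sum_mul]
        exact Finset.sum_congr rfl fun b _ => Finset.sum_mul _ _ _
    _ = ∑ κ, ∑ b, ∑ c, ∑ ρ,
          (coframe e κ b * e.1 b μ) * (coframe e ρ c * e.1 c ν) * dFrame e a κ ρ := by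
        refine Finset.sum_congr rfl fun κ _ => ?_
        rw [Finset.sum_comm]
        exact Finset.sum_congr rfl fun b _ => Finset.sum_comm
    _ = _ := by
        rw [Finset.sum_comm]
        exact Finset.sum_congr rfl fun b _ => Finset.sum_comm

/-- Cartan's first structure equation `de^a + ω^a_b ∧ e^b = 0`. -/
theorem cartan_first (a μ ν : Fin d) :
    dFrame e a μ ν
      + ∑ b, (connection e a b μ * e.1 b ν - connection e a b ν * e.1 b μ) = 0 := by
  rw [dFrame_eq, Finset.sum_sub_distrib]
  simp only [connection, Finset.sum_mul]
  conv_lhs => enter [2, 1]; rw [Finset.sum_comm]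
  rw [← Finset.sum_sub_distrib, ← Finset.sum_add_distrib]
  refine Finset.sum_eq_zero fun b _ => ?_
  rw [← Finset.sum_sub_distrib, ← Finset.sum_add_distrib]
  refine Finset.sum_eq_zero fun c _ => ?_
  rw [anholonomy_antisymm e a c b, anholonomy_antisymm e c a b]
  have h2 : ∀ z : SmoothFn U, z = (1 / 2 : ℝ) • z + (1 / 2 : ℝ) • z := fun z => by
    rw [← add_smul]; norm_num
  conv_lhs => enter [1, 1, 1]; rw [h2 (anholonomy e a b c)]
  simp only [smul_sub, smul_neg]
  ring

end Geometry

/-- A closed two-form `B = ½ B_{μν} dx^μ ∧ dx^ν` on `U`. -/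
structure IsClosedTwoForm (B : Matrix (Fin d) (Fin d) (SmoothFn U)) : Prop where
  antisymm : ∀ μ ν, B μ ν = -B ν μ
  closed : ∀ l μ ν, pd l (B μ ν) + pd μ (B ν l) + pd ν (B l μ) = 0

/-! ### Functions on `T^*U × ℝ^{0|d} × T^*W`, with `γ` inverted -/

/-- Labels of the odd coordinates: `inl a` is `θ^a`, `inr 0` is `b` and `inr 1` is `c`. -/
abbrev Odd (d : ℕ) := Fin d ⊕ Fin 2

/-- The superalgebra of functions of `x, p` (smooth) and `θ, b, c`. -/
abbrev Coef (U : Opens (Fin d → ℝ)) :=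
  SmoothFn (cotangent U) ⊗[ℝ] ExteriorAlgebra ℝ (Odd d → ℝ)

/-- The superalgebra `O(T^*U × ℝ^{0|d})[b, c, β, γ, γ⁻¹]`: finite sums `∑ F_{m,n} β^m γ^n` with
`m ∈ ℕ`, `n ∈ ℤ`, the variables `β`, `γ` being even (central). -/
abbrev Fun (U : Opens (Fin d → ℝ)) := AddMonoidAlgebra (Coef U) (ℕ × ℤ)

/-- A function on `T^*U` as a superfunction. -/
def fn (g : SmoothFn (cotangent U)) : Fun U := AddMonoidAlgebra.single 0 (g ⊗ₜ 1)

/-- A function on `U` as a superfunction. -/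
def base (g : SmoothFn U) : Fun U := fn (pull g)

def mom (a : Fin d) : Fun U := fn (momentum U a)

def odd (i : Odd d) : Fun U :=
  AddMonoidAlgebra.single 0 (1 ⊗ₜ ExteriorAlgebra.ι ℝ (Pi.single i 1))

def theta (a : Fin d) : Fun U := odd (Sum.inl a)

def gb : Fun U := odd (Sum.inr 0)

def gc : Fun U := odd (Sum.inr 1)

/-- The monomial `β^m γ^n`. -/
def mono (m : ℕ) (n : ℤ) : Fun U := AddMonoidAlgebra.single (m, n) 1

def gbeta : Fun U := mono 1 0

def ggamma : Fun U := mono 0 1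

/-- `γ⁻¹`. -/
def gammaInv : Fun U := mono 0 (-1)

/-- The divided power `β^{[k]} = β^k / k!`, which is `0` for `k < 0`. -/
def divBeta (k : ℤ) : Fun U :=
  if k < 0 then 0 else ((k.toNat.factorial : ℝ)⁻¹) • mono k.toNat 0

/-- The subalgebra `O(T^*U × ℝ^{0|d} × T^*W) = O(T^*U × ℝ^{0|d})[b, c, β, γ]`. -/
def funcs (U : Opens (Fin d → ℝ)) : Subalgebra ℝ (Fun U) :=
  Algebra.adjoin ℝ (Set.range fn ∪ Set.range theta ∪ {gb, gc, gbeta, ggamma})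

/-- The subalgebra `O(T^*U × ℝ^{0|d} × W)` of functions of `x, p, θ, c, γ`. -/
def funcsW (U : Opens (Fin d → ℝ)) : Subalgebra ℝ (Fun U) :=
  Algebra.adjoin ℝ (Set.range fn ∪ Set.range theta ∪ {gc, ggamma})

/-- The subalgebra `O(U × W)` of functions of `x, c, γ`. -/
def funcsUW (U : Opens (Fin d → ℝ)) : Subalgebra ℝ (Fun U) :=
  Algebra.adjoin ℝ (Set.range base ∪ {gc, ggamma})

/-! ### Derivatives -/

/-- Apply a linear map to the coefficients `F_{m,n}`. -/
def mapCoef (L : Coef U →ₗ[ℝ] Coef U) : Fun U →ₗ[ℝ] Fun U :=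
  (AddMonoidAlgebra.coeffLinearEquiv ℝ).symm.toLinearMap ∘ₗ Finsupp.mapRange.linearMap L ∘ₗ
    (AddMonoidAlgebra.coeffLinearEquiv ℝ).toLinearMap

/-- Derivative of a superfunction along a direction `v` of `T^*U = U × ℝ^d`. -/
def evenDeriv (v : (Fin d → ℝ) × (Fin d → ℝ)) : Fun U →ₗ[ℝ] Fun U :=
  mapCoef ((dirDeriv (cotangent U) v).toLinearMap.rTensor _)

/-- `∂/∂x^μ`. -/
def dX (μ : Fin d) : Fun U →ₗ[ℝ] Fun U := evenDeriv (Pi.single μ 1, 0)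

/-- `∂/∂p_a`. -/
def dP (a : Fin d) : Fun U →ₗ[ℝ] Fun U := evenDeriv (0, Pi.single a 1)

/-- The left derivative with respect to an odd coordinate. -/
def dL (i : Odd d) : Fun U →ₗ[ℝ] Fun U :=
  mapCoef (LinearMap.lTensor _
    (CliffordAlgebra.contractLeft (Q := (0 : QuadraticForm ℝ (Odd d → ℝ))) (LinearMap.proj i)))

/-- The right derivative with respect to an odd coordinate. -/
def dR (i : Odd d) : Fun U →ₗ[ℝ] Fun U :=
  mapCoef (LinearMap.lTensor _
    ((CliffordAlgebra.contractRight (Q := (0 : QuadraticForm ℝ (Odd d → ℝ)))).flip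
      (LinearMap.proj i)))

/-- `∂/∂β`. -/
def dBeta : Fun U →ₗ[ℝ] Fun U :=
  Finsupp.lsum ℝ (fun k : ℕ × ℤ => (k.1 : ℝ) • AddMonoidAlgebra.lsingle (k.1 - 1, k.2)) ∘ₗ
    (AddMonoidAlgebra.coeffLinearEquiv ℝ).toLinearMap

/-- `∂/∂γ`. -/
def dGamma : Fun U →ₗ[ℝ] Fun U :=
  Finsupp.lsum ℝ (fun k : ℕ × ℤ => (k.2 : ℝ) • AddMonoidAlgebra.lsingle (k.1, k.2 - 1)) ∘ₗ
    (AddMonoidAlgebra.coeffLinearEquiv ℝ).toLinearMap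

/-- The ghost number operator `c ∂_c + γ ∂_γ - b ∂_b - β ∂_β`. -/
def ghost : Module.End ℝ (Fun U) :=
  LinearMap.mulLeft ℝ gc ∘ₗ dL (Sum.inr 1) + LinearMap.mulLeft ℝ ggamma ∘ₗ dGamma
    - LinearMap.mulLeft ℝ gb ∘ₗ dL (Sum.inr 0) - LinearMap.mulLeft ℝ gbeta ∘ₗ dBeta

/-- Functions of degree (ghost number) `n`. -/
def deg (U : Opens (Fin d → ℝ)) (n : ℤ) : Submodule ℝ (Fun U) :=
  Module.End.eigenspace ghost (n : ℝ)

/-! ### The Poisson bracket and the differential -/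

section Bracket

variable (e : Frame U) (B : Matrix (Fin d) (Fin d) (SmoothFn U))

/-- `{p_a, θ^b} = -f^μ_a ω^b_{cμ} θ^c`. -/
def bracketPTheta (a b : Fin d) : Fun U :=
  -∑ μ, ∑ c, base (coframe e μ a * connection e b c μ) * theta c

/-- `{p_a, p_b} = (f^μ_a ω^c_{bμ} - f^μ_b ω^c_{aμ}) p_c
  + f^μ_a f^ν_b (¼ R_{cdμν} θ^c θ^d + B_{μν})`. -/
def bracketPP (a b : Fin d) : Fun U :=
  ∑ c, (∑ μ, base (coframe e μ a * connection e c b μ - coframe e μ b * connection e c a μ))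
      * mom c
    + ∑ μ, ∑ ν, base (coframe e μ a * coframe e ν b) *
      ((1 / 4 : ℝ) • (∑ i, ∑ j, base (curvature e i j μ ν) * theta i * theta j) + base (B μ ν))

/-- The Poisson bracket on `O(T^*U × ℝ^{0|d} × T^*W)`, that is
`∑ (F ∂_i) {z^i, z^j} (∂_j G)` over all pairs of coordinates, `F ∂_i` being the right derivative
and `∂_j G` the left derivative; the nonzero brackets of coordinates are
`{p_a, x^μ} = f^μ_a`, `{p_a, p_b}`, `{p_a, θ^b}` as above, `{θ^a, θ^b} = 2 δ^{ab}` and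
`{b, c} = {β, γ} = 1`. -/
def bracket (F G : Fun U) : Fun U :=
  (∑ a, ∑ μ, (dP a F * base (coframe e μ a) * dX μ G - dX μ F * base (coframe e μ a) * dP a G))
    + (∑ a, ∑ b, dP a F * bracketPP e B a b * dP b G)
    + (∑ a, ∑ b, (dP a F * bracketPTheta e a b * dL (Sum.inl b) G
        - dR (Sum.inl b) F * bracketPTheta e a b * dP a G))
    + (∑ a, (2 : ℝ) • (dR (Sum.inl a) F * dL (Sum.inl a) G))
    + (dR (Sum.inr 0) F * dL (Sum.inr 1) G + dR (Sum.inr 1) F * dL (Sum.inr 0) G)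
    + (dBeta F * dGamma G - dGamma F * dBeta G)

/-- `π = p_a θ^a`. -/
def piFn (U : Opens (Fin d → ℝ)) : Fun U := ∑ a, mom a * theta a

/-- `S = ½ c {π, π} + γ π - γ² b`. -/
def actionS : Fun U :=
  (1 / 2 : ℝ) • (gc * bracket e B (piFn U) (piFn U)) + ggamma * piFn U - ggamma ^ 2 * gb

/-- The BFV differential `Q = {S, -}`. -/
def Q : Module.End ℝ (Fun U) where
  toFun := bracket e B (actionS e B)
  map_add' F G := by
    simp only [bracket, map_add, mul_add, smul_add, Finset.sum_add_distrib,
      Finset.sum_sub_distrib]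
    abel
  map_smul' r F := by
    simp only [bracket, map_smul, mul_smul_comm, RingHom.id_apply, smul_add, smul_sub,
      Finset.smul_sum, smul_comm r (2 : ℝ)]

/-- `Θ = θ^1 ⋯ θ^d`. -/
def Theta (U : Opens (Fin d → ℝ)) : Fun U := (List.ofFn fun a : Fin d => (theta a : Fun U)).prod

/-- `ξ_k(f) = -β^{[k]} γ⁻¹ c f Θ`. -/
def xi (k : ℕ) (f : Fun U) : Fun U := -(divBeta k * gammaInv * gc * f * Theta U)

/-- `η_k(f) = γ⁻¹ β^{[k-1]} f Θ - γ⁻¹ β^{[k]} c {{π, f}, Θ}`. -/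
def eta (k : ℕ) (f : Fun U) : Fun U :=
  gammaInv * divBeta (k - 1) * f * Theta U
    - gammaInv * divBeta k * gc * bracket e B (bracket e B (piFn U) f) (Theta U)

/-- `X_k(f) = Q ξ_k(f)`. -/
def X (k : ℕ) (f : Fun U) : Fun U := Q e B (xi k f)

/-- `Y_k(f) = Q η_k(f)`. -/
def Y (k : ℕ) (f : Fun U) : Fun U := Q e B (eta e B k f)

/-- The ideal of `O(T^*U × ℝ^{0|d} × W)` generated by `π` and `{π, π}`. -/
def zeroLocus : Submodule ℝ (Fun U) :=
  (Subalgebra.toSubmodule (funcsW U)).map (LinearMap.mulLeft ℝ (piFn U))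
    ⊔ (Subalgebra.toSubmodule (funcsW U)).map
        (LinearMap.mulLeft ℝ (bracket e B (piFn U) (piFn U)))

end Bracket

/-! ### Cohomology of a graded subquotient complex `N / I` -/

section Cohomology

variable {V : Type*} [AddCommGroup V] [Module ℝ V]

/-- `N / I` is a complex for the operator `D` and the grading `V_n`: `D` has degree `1`, preserves
`N` and `I`, and `D² = 0` on `N / I`. -/
structure IsComplex (D : Module.End ℝ V) (Vn : ℤ → Submodule ℝ V) (N I : Submodule ℝ V) :
    Prop where
  le : I ≤ N
  map_deg : ∀ n, ∀ F ∈ N ⊓ Vn n, D F ∈ N ⊓ Vn (n + 1)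
  map_ideal : ∀ F ∈ I, D F ∈ I
  map_sub : ∀ F ∈ N, D F ∈ N
  sq_zero : ∀ F ∈ N, D (D F) ∈ I

/-- Elements of degree `n` of `N` whose class in `N / I` is a cocycle. -/
def cocycles (D : Module.End ℝ V) (Vn : ℤ → Submodule ℝ V) (N I : Submodule ℝ V) (n : ℤ) :
    Submodule ℝ V := Vn n ⊓ N ⊓ I.comap D

/-- Elements of degree `n` of `N` whose class in `N / I` is a coboundary. -/
def coboundaries (D : Module.End ℝ V) (Vn : ℤ → Submodule ℝ V) (N I : Submodule ℝ V) (n : ℤ) :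
    Submodule ℝ V := (Vn (n - 1) ⊓ N).map D ⊔ (Vn n ⊓ I)

/-- The cohomology `H^n(N / I, D)`. -/
abbrev Coh (D : Module.End ℝ V) (Vn : ℤ → Submodule ℝ V) (N I : Submodule ℝ V) (n : ℤ) :=
  cocycles D Vn N I n ⧸ (coboundaries D Vn N I n).comap (cocycles D Vn N I n).subtype

/-- The cohomology class of a cocycle. -/
def cls {D : Module.End ℝ V} {Vn : ℤ → Submodule ℝ V} {N I : Submodule ℝ V} {n : ℤ} {F : V}
    (hF : F ∈ cocycles D Vn N I n) : Coh D Vn N I n :=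
  Submodule.Quotient.mk ⟨F, hF⟩

end Cohomology

variable (e : Frame U) (B : Matrix (Fin d) (Fin d) (SmoothFn U))

/-- The complex `(O(T^*U × ℝ^{0|d} × T^*W), Q)`: its cocycles of degree `n`. -/
abbrev Z (n : ℤ) : Submodule ℝ (Fun U) :=
  cocycles (Q e B) (deg U) (Subalgebra.toSubmodule (funcs U)) ⊥ n

/-- `H^n(O(T^*U × ℝ^{0|d} × T^*W), Q)`. -/
abbrev H (n : ℤ) : Type :=
  Coh (Q e B) (deg U) (Subalgebra.toSubmodule (funcs U)) ⊥ n

/-- The subcomplex `(O(T^*U × ℝ^{0|d} × W), Q)`: its cocycles of degree `n`. -/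
abbrev ZW (n : ℤ) : Submodule ℝ (Fun U) :=
  cocycles (Q e B) (deg U) (Subalgebra.toSubmodule (funcsW U)) ⊥ n

/-- Cocycles of degree `n` of the quotient `O(T^*U × ℝ^{0|d} × W) / (π, {π, π})`. -/
abbrev Zred (n : ℤ) : Submodule ℝ (Fun U) :=
  cocycles (Q e B) (deg U) (Subalgebra.toSubmodule (funcsW U)) (zeroLocus e B) n

/-- `H^n(O(T^*U × ℝ^{0|d} × W) / (π, {π, π}), Q)`. -/
abbrev Hred (n : ℤ) : Type :=
  Coh (Q e B) (deg U) (Subalgebra.toSubmodule (funcsW U)) (zeroLocus e B) n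

end SpinningParticle

end

/-!
Throughout, `D = {π, -}` and `R = {π, π}`.

**The differential squares to zero.** On functions of `x, p, θ` one has `Q F = ½ c {R, F} + γ D F`, so
`Q² = 0` comes down to the Jacobi identity `D² F = ½ {R, F}` (`opD_opD`). The bracket becomes almost
constant in terms of the canonical momenta `P_μ = e^a_μ p_a - ¼ ω_{abμ} θ^a θ^b`: the torsion-free
condition and the formula for the curvature together say that `x, P` are conjugate up to the field
strength `B`, and that `P` commutes with `θ` (`bracket_canMom`). In the coordinates `x, P, θ` the
partial derivatives commute, and the Jacobi identity follows from `dB = 0` (`closed_contraction`).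

**Reduction modulo `γ²` and `c`.** Since `Q(-c w) = γ² w + c Q w`, any cocycle of the form
`γ² w + c v` is the coboundary of `-c w` (`exists_primitive_of_mem_higher`). Cohomology therefore only
sees functions modulo `γ²` and `c`. In ghost number `-k` these have the unique normal form
`β^k m₀ + β^{k-1} b m₁ + γ β^{k+1} n₀ + γ β^k b n₁` with coefficients depending on `x, p, θ`, and
`Q_normalForm` expresses the differential by these coefficients. In ghost number at least two
nothing is left, which is the vanishing theorem; the reduced complex vanishes for the same reason,
because `γ` is not a zero divisor modulo the ideal `(π, R)`.

**Negative degrees.** For a cocycle of ghost number `-k < 0` the first equation reads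
`½ R m₁ = k π m₀`. Multiplying by `π` gives `R π m₁ = 0`. Because `R` is the sum of `2 p²` and a
nilpotent function, it is not a zero divisor if `d ≥ 1` (`eq_zero_of_bigR_mul`), while
`π = 0` if `d = 0`; so `π m₁ = 0`. The Koszul
complex of `π` is exact up to top forms (`mem_topOrPi_of_pi_mul_eq_zero`): with the operator
`ι = ∂²/∂p_a∂θ^a` one has `ι π + π ι = d + p_a ∂/∂p_a - θ^a ∂/∂θ^a`, and the right-hand side is
inverted by weighted means along the rays in the fibres of `T^*U`, except on multiples of `Θ`, where
Hadamard's lemma applies. Hence `m₁ = g Θ + π y`. A multiple of `Y_{k+1}(g)` and a coboundary remove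
`m₁`. The third equation then determines `m₀` by `n₁`, and a coboundary removes both; the second
equation becomes `π n₀ = 0`, so that `n₀ = f Θ + π y'` comes from `X_{k+1}(f)` and a coboundary.

**Degree one.** Every cocycle of degree one is cohomologous to `ζ(f) = γ f + c D f` for some function
`f` of `x, p, θ`, both in the full complex and modulo the ideal `(π, R)`. In the full complex `ζ(f)`
is exact if and only if `f = D m + π n + R n'`, where the terms with `n` and `n'` are the coboundaries
of functions linear in `β` and `b`. In the reduced complex the exact cocycles belong to the same
functions `f`: the coboundaries are the `ζ(D m)`, the elements `ζ(π n + R n')` lie in the ideal, and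
conversely the coefficient of `γ` in an element of the ideal is of the form `π n + R n'`. This
identifies the two groups (`exists_equiv_reduced_one`).
-/

noncomputable section

namespace SpinningParticle

variable {d : ℕ} {U : Opens (Fin d → ℝ)}

/-! ### Calculus on the superalgebra -/

/-- The ring structure of `Fun U`, assembled from its semiring and group structures. Instance search
would find the negation of `Fun U` along a path on which the multiplication only agrees with that of
the semiring `Fun U` after unfolding the tensor product, and rewriting with signs would fail. -/
@[reducible] def funRing (U : Opens (Fin d → ℝ)) : Ring (Fun U) where
  __ := (inferInstance : Semiring (Fun U))
  __ := (inferInstance : AddCommGroup (Fun U))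
  intCast := Int.castDef
  intCast_ofNat := fun _ => rfl
  intCast_negSucc := fun _ => rfl

attribute [local instance] funRing

/-- The monomial `g w β^m γ^n`, where `k = (m, n)` and `w` is a function of the odd coordinates. -/
def elt (k : ℕ × ℤ) (g : SmoothFn (cotangent U)) (w : ExteriorAlgebra ℝ (Odd d → ℝ)) : Fun U :=
  AddMonoidAlgebra.single k (g ⊗ₜ w)

theorem elt_mul (k l : ℕ × ℤ) (g h : SmoothFn (cotangent U))
    (v w : ExteriorAlgebra ℝ (Odd d → ℝ)) : elt k g v * elt l h w = elt (k + l) (g * h) (v * w) := by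
  simp [elt, AddMonoidAlgebra.single_mul_single]

theorem fun_induction {P : Fun U → Prop} (h0 : P 0) (hadd : ∀ F G, P F → P G → P (F + G))
    (helt : ∀ k g w, P (elt k g w)) (F : Fun U) : P F := by
  refine AddMonoidAlgebra.induction_linear F h0 hadd fun k u => ?_
  induction u using TensorProduct.induction_on with
  | zero => simpa using h0
  | tmul g w => exact helt k g w
  | add u v hu hv => rw [AddMonoidAlgebra.single_add]; exact hadd _ _ hu hv

/-- The grade involution, `F ↦ (-1)^{|F|} F`. -/
def inv : Fun U →ₐ[ℝ] Fun U :=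
  AddMonoidAlgebra.mapAlgHom _
    (Algebra.TensorProduct.map (AlgHom.id ℝ _) CliffordAlgebra.involute)

theorem inv_elt (k : ℕ × ℤ) (g : SmoothFn (cotangent U)) (w : ExteriorAlgebra ℝ (Odd d → ℝ)) :
    inv (elt k g w) = elt k g (CliffordAlgebra.involute w) := by
  simp [inv, elt, AddMonoidAlgebra.mapAlgHom]

theorem inv_inv (F : Fun U) : inv (inv F) = F := by
  induction F using fun_induction with
  | h0 => simp
  | hadd F G hF hG => simp [hF, hG]
  | helt k g w => simp [inv_elt]

theorem mapCoef_single (L : Coef U →ₗ[ℝ] Coef U) (k : ℕ × ℤ) (u : Coef U) :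
    mapCoef L (AddMonoidAlgebra.single k u) = AddMonoidAlgebra.single k (L u) := by
  ext; simp [mapCoef, AddMonoidAlgebra.coeffLinearEquiv]

theorem evenDeriv_elt (v : (Fin d → ℝ) × (Fin d → ℝ)) (k : ℕ × ℤ) (g : SmoothFn (cotangent U))
    (w : ExteriorAlgebra ℝ (Odd d → ℝ)) :
    evenDeriv v (elt k g w) = elt k (dirDeriv _ v g) w := by
  simp [evenDeriv, elt, mapCoef_single]

theorem dL_elt (i : Odd d) (k : ℕ × ℤ) (g : SmoothFn (cotangent U))
    (w : ExteriorAlgebra ℝ (Odd d → ℝ)) :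
    dL i (elt k g w) = elt k g (CliffordAlgebra.contractLeft (LinearMap.proj i) w) := by
  simp [dL, elt, mapCoef_single]

theorem dR_elt (i : Odd d) (k : ℕ × ℤ) (g : SmoothFn (cotangent U))
    (w : ExteriorAlgebra ℝ (Odd d → ℝ)) :
    dR i (elt k g w) = elt k g (CliffordAlgebra.contractRight w (LinearMap.proj i)) := by
  simp [dR, elt, mapCoef_single]

theorem dBeta_elt (k : ℕ × ℤ) (g : SmoothFn (cotangent U)) (w : ExteriorAlgebra ℝ (Odd d → ℝ)) :
    dBeta (elt k g w) = (k.1 : ℝ) • elt (k.1 - 1, k.2) g w := by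
  simp [dBeta, elt, AddMonoidAlgebra.coeffLinearEquiv]

theorem dGamma_elt (k : ℕ × ℤ) (g : SmoothFn (cotangent U)) (w : ExteriorAlgebra ℝ (Odd d → ℝ)) :
    dGamma (elt k g w) = (k.2 : ℝ) • elt (k.1, k.2 - 1) g w := by
  simp [dGamma, elt, AddMonoidAlgebra.coeffLinearEquiv]

theorem contractLeft_mul {M : Type*} [AddCommGroup M] [Module ℝ M] {q : QuadraticForm ℝ M}
    (φ : Module.Dual ℝ M) (v w : CliffordAlgebra q) :
    CliffordAlgebra.contractLeft φ (v * w) = CliffordAlgebra.contractLeft φ v * w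
      + CliffordAlgebra.involute v * CliffordAlgebra.contractLeft φ w := by
  induction v using CliffordAlgebra.left_induction with
  | algebraMap r => simp [CliffordAlgebra.contractLeft_algebraMap_mul]
  | add v v' hv hv' => simp only [add_mul, map_add, hv, hv']; abel
  | ι_mul v m hv =>
    rw [mul_assoc, CliffordAlgebra.contractLeft_ι_mul, hv, CliffordAlgebra.contractLeft_ι_mul]
    simp only [map_mul, CliffordAlgebra.involute_ι, mul_add, sub_mul, smul_mul_assoc, neg_mul,
      mul_assoc]
    abel

theorem contractRight_eq_involute {M : Type*} [AddCommGroup M] [Module ℝ M]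
    {q : QuadraticForm ℝ M} (φ : Module.Dual ℝ M) (v : CliffordAlgebra q) :
    CliffordAlgebra.contractRight v φ
      = CliffordAlgebra.involute (CliffordAlgebra.contractLeft φ v) := by
  induction v using CliffordAlgebra.right_induction with
  | algebraMap r => simp
  | add v v' hv hv' => simp [hv, hv']
  | mul_ι m v hv =>
    rw [CliffordAlgebra.contractRight_mul_ι, hv, contractLeft_mul]
    simp [Algebra.smul_def, Algebra.commutes, sub_eq_neg_add]

theorem contractLeft_involute {M : Type*} [AddCommGroup M] [Module ℝ M]
    {q : QuadraticForm ℝ M} (φ : Module.Dual ℝ M) (v : CliffordAlgebra q) :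
    CliffordAlgebra.contractLeft φ (CliffordAlgebra.involute v)
      = -CliffordAlgebra.involute (CliffordAlgebra.contractLeft φ v) := by
  induction v using CliffordAlgebra.left_induction with
  | algebraMap r => simp
  | add v v' hv hv' => simp [hv, hv', add_comm]
  | ι_mul v m hv =>
    simp [CliffordAlgebra.contractLeft_ι_mul, hv]

theorem dR_eq (i : Odd d) (F : Fun U) : dR i F = inv (dL i F) := by
  induction F using fun_induction with
  | h0 => simp
  | hadd F G hF hG => simp [hF, hG]
  | helt k g w => rw [dR_elt, dL_elt, inv_elt, contractRight_eq_involute]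

theorem dL_inv (i : Odd d) (F : Fun U) : dL i (inv F) = -inv (dL i F) := by
  induction F using fun_induction with
  | h0 => simp
  | hadd F G hF hG => simp [hF, hG, add_comm]
  | helt k g w =>
    rw [inv_elt, dL_elt, dL_elt, inv_elt, contractLeft_involute]
    simp [elt, TensorProduct.tmul_neg]

theorem evenDeriv_inv (v : (Fin d → ℝ) × (Fin d → ℝ)) (F : Fun U) :
    evenDeriv v (inv F) = inv (evenDeriv v F) := by
  induction F using fun_induction with
  | h0 => simp
  | hadd F G hF hG => simp [hF, hG]
  | helt k g w => simp only [inv_elt, evenDeriv_elt]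

theorem dBeta_inv (F : Fun U) : dBeta (inv F) = inv (dBeta F) := by
  induction F using fun_induction with
  | h0 => simp
  | hadd F G hF hG => simp [hF, hG]
  | helt k g w => simp only [inv_elt, dBeta_elt, map_smul]

theorem dGamma_inv (F : Fun U) : dGamma (inv F) = inv (dGamma F) := by
  induction F using fun_induction with
  | h0 => simp
  | hadd F G hF hG => simp [hF, hG]
  | helt k g w => simp only [inv_elt, dGamma_elt, map_smul]

/-- An even derivation of the superalgebra which preserves parity. -/
structure IsEvenDer (D : Fun U →ₗ[ℝ] Fun U) : Prop where
  mul : ∀ F G, D (F * G) = D F * G + F * D G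
  inv_apply : ∀ F, D (inv F) = inv (D F)

/-- An odd derivation of the superalgebra which exchanges parities. -/
structure IsOddDer (D : Fun U →ₗ[ℝ] Fun U) : Prop where
  mul : ∀ F G, D (F * G) = D F * G + inv F * D G
  inv_apply : ∀ F, D (inv F) = -inv (D F)

theorem bilin_ext {L L' : Fun U →ₗ[ℝ] Fun U →ₗ[ℝ] Fun U}
    (h : ∀ k g v l f w, L (elt k g v) (elt l f w) = L' (elt k g v) (elt l f w)) (F G : Fun U) :
    L F G = L' F G := by
  induction F using fun_induction with
  | h0 => simp
  | hadd F F' hF hF' => simp [hF, hF']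
  | helt k g v =>
    induction G using fun_induction with
    | h0 => simp
    | hadd G G' hG hG' => simp [hG, hG']
    | helt l f w => exact h ..

theorem mul_rule_of_elt (D : Fun U →ₗ[ℝ] Fun U) (s : Fun U →ₗ[ℝ] Fun U)
    (h : ∀ k g v l f w, D (elt k g v * elt l f w)
      = D (elt k g v) * elt l f w + s (elt k g v) * D (elt l f w)) (F G : Fun U) :
    D (F * G) = D F * G + s F * D G :=
  bilin_ext (L := (LinearMap.mul ℝ (Fun U)).compr₂ D)
    (L' := (LinearMap.mul ℝ (Fun U)) ∘ₗ D + (LinearMap.mul ℝ (Fun U)).compl₁₂ s D)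
    (fun k g v l f w => by simpa using h k g v l f w) F G

theorem elt_add_left (k : ℕ × ℤ) (g h : SmoothFn (cotangent U))
    (w : ExteriorAlgebra ℝ (Odd d → ℝ)) : elt k (g + h) w = elt k g w + elt k h w := by
  simp [elt, TensorProduct.add_tmul]

theorem elt_add_right (k : ℕ × ℤ) (g : SmoothFn (cotangent U))
    (v w : ExteriorAlgebra ℝ (Odd d → ℝ)) : elt k g (v + w) = elt k g v + elt k g w := by
  simp [elt, TensorProduct.tmul_add]

theorem isEvenDer_evenDeriv (v : (Fin d → ℝ) × (Fin d → ℝ)) :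
    IsEvenDer (evenDeriv v : Fun U →ₗ[ℝ] Fun U) where
  mul := mul_rule_of_elt _ LinearMap.id fun k g v l f w => by
    simp only [elt_mul, evenDeriv_elt, LinearMap.id_apply, Derivation.leibniz, elt_add_left,
      smul_eq_mul, mul_comm f, add_comm (elt _ (g * _) _)]
  inv_apply := evenDeriv_inv v

theorem isOddDer_dL (i : Odd d) : IsOddDer (dL i : Fun U →ₗ[ℝ] Fun U) where
  mul := mul_rule_of_elt _ inv.toLinearMap fun k g v l f w => by
    simp only [elt_mul, dL_elt, AlgHom.toLinearMap_apply, inv_elt, contractLeft_mul, elt_add_right]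
  inv_apply := dL_inv i

theorem isEvenDer_dBeta : IsEvenDer (dBeta : Fun U →ₗ[ℝ] Fun U) where
  mul := mul_rule_of_elt _ LinearMap.id fun k g v l f w => by
    simp only [elt_mul, dBeta_elt, LinearMap.id_apply, smul_mul_assoc, mul_smul_comm]
    rcases k with ⟨m, k⟩
    rcases l with ⟨n, l⟩
    rcases m with _ | m <;> rcases n with _ | n
    · simp
    · simp [← add_assoc]
    · simp
    · simp only [Prod.mk_add_mk, Nat.add_sub_cancel, ← add_assoc, add_right_comm m 1 n,
        ← add_smul]
      push_cast
      congr 1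
      ring
  inv_apply := dBeta_inv

theorem isEvenDer_dGamma : IsEvenDer (dGamma : Fun U →ₗ[ℝ] Fun U) where
  mul := mul_rule_of_elt _ LinearMap.id fun k g v l f w => by
    simp only [elt_mul, dGamma_elt, LinearMap.id_apply, smul_mul_assoc, mul_smul_comm]
    rcases k with ⟨m, k⟩
    rcases l with ⟨n, l⟩
    simp only [Prod.mk_add_mk, Int.cast_add, add_smul, show k - 1 + l = k + l - 1 by ring,
      show k + (l - 1) = k + l - 1 by ring]
  inv_apply := dGamma_inv

/-! ### Coordinates: parity, commutation, and partial derivatives -/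

theorem fn_eq (g : SmoothFn (cotangent U)) : (fn g : Fun U) = elt 0 g 1 := rfl

theorem odd_eq (i : Odd d) :
    (odd i : Fun U) = elt 0 1 (ExteriorAlgebra.ι ℝ (Pi.single i 1)) := rfl

theorem mono_eq (m : ℕ) (n : ℤ) : (mono m n : Fun U) = elt (m, n) 1 1 := rfl

theorem one_eq : (1 : Fun U) = elt 0 1 1 := rfl

/-- `fn` as a homomorphism of algebras. -/
def fnHom (U : Opens (Fin d → ℝ)) : SmoothFn (cotangent U) →ₐ[ℝ] Fun U where
  toFun := fn
  map_one' := rfl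
  map_mul' g h := by simp [fn_eq, elt_mul]
  map_zero' := by simp [fn]
  map_add' g h := by simp [fn_eq, elt_add_left]
  commutes' r := by
    rw [fn, Algebra.algebraMap_eq_smul_one, ← TensorProduct.smul_tmul',
      ← AddMonoidAlgebra.smul_single, Algebra.algebraMap_eq_smul_one]
    rfl

/-- `base` as a homomorphism of algebras. -/
def baseHom (U : Opens (Fin d → ℝ)) : SmoothFn U →ₐ[ℝ] Fun U := (fnHom U).comp pull

theorem fn_mul (g h : SmoothFn (cotangent U)) : (fn (g * h) : Fun U) = fn g * fn h :=
  map_mul (fnHom U) g h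
theorem fn_add (g h : SmoothFn (cotangent U)) : (fn (g + h) : Fun U) = fn g + fn h :=
  map_add (fnHom U) g h
theorem fn_one : (fn 1 : Fun U) = 1 := rfl
theorem fn_zero : (fn 0 : Fun U) = 0 := map_zero (fnHom U)
theorem fn_sum {ι : Type*} (s : Finset ι) (g : ι → SmoothFn (cotangent U)) :
    (fn (∑ i ∈ s, g i) : Fun U) = ∑ i ∈ s, fn (g i) := map_sum (fnHom U) g s
theorem base_mul (g h : SmoothFn U) : (base (g * h) : Fun U) = base g * base h :=
  map_mul (baseHom U) g h
theorem base_add (g h : SmoothFn U) : (base (g + h) : Fun U) = base g + base h :=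
  map_add (baseHom U) g h
theorem base_sub (g h : SmoothFn U) : (base (g - h) : Fun U) = base g - base h :=
  map_sub (baseHom U) g h
theorem base_neg (g : SmoothFn U) : (base (-g) : Fun U) = -base g :=
  map_neg (baseHom U) g
theorem base_one : (base 1 : Fun U) = 1 := map_one (baseHom U)
theorem base_zero : (base 0 : Fun U) = 0 := map_zero (baseHom U)
theorem base_sum {ι : Type*} (s : Finset ι) (g : ι → SmoothFn U) :
    (base (∑ i ∈ s, g i) : Fun U) = ∑ i ∈ s, base (g i) := map_sum (baseHom U) g s
theorem base_smul (r : ℝ) (g : SmoothFn U) : (base (r • g) : Fun U) = r • base g :=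
  map_smul (baseHom U) r g

theorem ι_mul_eq {M : Type*} [AddCommGroup M] [Module ℝ M] (m : M) (v : ExteriorAlgebra ℝ M) :
    ExteriorAlgebra.ι ℝ m * v = CliffordAlgebra.involute v * ExteriorAlgebra.ι ℝ m := by
  induction v using CliffordAlgebra.left_induction with
  | algebraMap r => simp [Algebra.commutes]
  | add v v' hv hv' => simp only [mul_add, map_add, add_mul, hv, hv']
  | ι_mul v n hv =>
    have h : ExteriorAlgebra.ι ℝ m * ExteriorAlgebra.ι ℝ n
        = -(ExteriorAlgebra.ι ℝ n * ExteriorAlgebra.ι ℝ m) :=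
      eq_neg_of_add_eq_zero_left (ExteriorAlgebra.ι_add_mul_swap m n)
    change ExteriorAlgebra.ι ℝ m * (ExteriorAlgebra.ι ℝ n * v)
      = CliffordAlgebra.involute (CliffordAlgebra.ι _ n * v) * _
    rw [map_mul, CliffordAlgebra.involute_ι, ← mul_assoc, h, neg_mul, mul_assoc, hv, neg_mul,
      neg_mul, mul_assoc]

theorem involute_comm_add {M : Type*} [AddCommGroup M] [Module ℝ M] (v w : ExteriorAlgebra ℝ M) :
    (v + CliffordAlgebra.involute v) * w = w * (v + CliffordAlgebra.involute v) := by
  induction w using CliffordAlgebra.left_induction with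
  | algebraMap r => simp [Algebra.commutes]
  | add w w' hw hw' => simp only [mul_add, add_mul w w', hw, hw']
  | ι_mul w m hw =>
    have h1 := ι_mul_eq m v
    have h2 := ι_mul_eq m (CliffordAlgebra.involute v)
    rw [CliffordAlgebra.involute_involute] at h2
    change _ * (ExteriorAlgebra.ι ℝ m * w) = (ExteriorAlgebra.ι ℝ m * w) * _
    rw [← mul_assoc, mul_assoc (ExteriorAlgebra.ι ℝ m), ← hw, ← mul_assoc, mul_add, h1, h2, add_mul,
      add_comm (v * _)]

theorem involute_comm_sub {M : Type*} [AddCommGroup M] [Module ℝ M] (v w : ExteriorAlgebra ℝ M) :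
    (v - CliffordAlgebra.involute v) * w
      = CliffordAlgebra.involute w * (v - CliffordAlgebra.involute v) := by
  induction w using CliffordAlgebra.left_induction with
  | algebraMap r => simp [Algebra.commutes]
  | add w w' hw hw' => simp only [mul_add, map_add, add_mul (CliffordAlgebra.involute w), hw, hw']
  | ι_mul w m hw =>
    have h1 := ι_mul_eq m v
    have h2 := ι_mul_eq m (CliffordAlgebra.involute v)
    rw [CliffordAlgebra.involute_involute] at h2
    rw [map_mul, CliffordAlgebra.involute_ι]
    change _ * (ExteriorAlgebra.ι ℝ m * w) = (-ExteriorAlgebra.ι ℝ m * _) * _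
    rw [mul_assoc, ← hw, ← mul_assoc, ← mul_assoc, neg_mul, mul_sub, h1, h2, sub_mul, neg_sub]

theorem add_inv_comm (F G : Fun U) : (F + inv F) * G = G * (F + inv F) := by
  induction F using fun_induction with
  | h0 => simp
  | hadd F F' hF hF' =>
    rw [map_add, add_add_add_comm, add_mul, hF, hF', ← mul_add]
  | helt k g v =>
    induction G using fun_induction with
    | h0 => simp
    | hadd G G' hG hG' => rw [mul_add, hG, hG', add_mul]
    | helt l f w =>
      rw [inv_elt, ← elt_add_right, elt_mul, elt_mul, involute_comm_add, mul_comm g, add_comm k]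

theorem sub_inv_comm (F G : Fun U) : (F - inv F) * G = inv G * (F - inv F) := by
  induction F using fun_induction with
  | h0 => simp
  | hadd F F' hF hF' =>
    rw [map_add, add_sub_add_comm, add_mul, hF, hF', ← mul_add]
  | helt k g v =>
    induction G using fun_induction with
    | h0 => simp
    | hadd G G' hG hG' => rw [mul_add, hG, hG', map_add, add_mul]
    | helt l f w =>
      have h : ∀ v w : ExteriorAlgebra ℝ (Odd d → ℝ), elt k g (v - w) = elt k g v - elt k g w :=
        fun v w => by simp [elt, TensorProduct.tmul_sub]
      rw [inv_elt, inv_elt, ← h, elt_mul, elt_mul, involute_comm_sub, mul_comm g, add_comm k]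

/-- Even superfunctions are central. -/
theorem even_comm {F : Fun U} (hF : inv F = F) (G : Fun U) : F * G = G * F := by
  have h := add_inv_comm F G
  rw [hF, ← two_smul ℝ F, smul_mul_assoc, mul_smul_comm] at h
  exact smul_right_injective _ (two_ne_zero (α := ℝ)) h

theorem odd_comm {F : Fun U} (hF : inv F = -F) (G : Fun U) : F * G = inv G * F := by
  have h := sub_inv_comm F G
  rw [hF, sub_neg_eq_add, ← two_smul ℝ F, smul_mul_assoc, mul_smul_comm] at h
  exact smul_right_injective _ (two_ne_zero (α := ℝ)) h

theorem odd_anticomm {F G : Fun U} (hF : inv F = -F) (hG : inv G = -G) : F * G = -(G * F) := by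
  rw [odd_comm hF, hG, neg_mul]

theorem eq_zero_of_eq_neg {F : Fun U} (h : F = -F) : F = 0 := by
  have h2 : (2 : ℝ) • F = 0 := by rw [two_smul]; nth_rw 1 [h]; exact neg_add_cancel F
  exact (smul_eq_zero.1 h2).resolve_left two_ne_zero

theorem odd_mul_self {F : Fun U} (hF : inv F = -F) : F * F = 0 :=
  eq_zero_of_eq_neg (odd_anticomm hF hF)

/-! ### Parities of the coordinates -/

@[simp] theorem inv_fn (g : SmoothFn (cotangent U)) : inv (fn g : Fun U) = fn g := by
  simp [fn_eq, inv_elt]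
@[simp] theorem inv_base (g : SmoothFn U) : inv (base g : Fun U) = base g := inv_fn _
@[simp] theorem inv_mom (a : Fin d) : inv (mom a : Fun U) = mom a := inv_fn _
@[simp] theorem inv_odd (i : Odd d) : inv (odd i : Fun U) = -odd i := by
  rw [odd_eq, inv_elt]
  change elt _ _ (CliffordAlgebra.involute (CliffordAlgebra.ι _ _)) = _
  rw [CliffordAlgebra.involute_ι]
  simp only [elt, TensorProduct.tmul_neg, AddMonoidAlgebra.single_neg]
@[simp] theorem inv_theta (a : Fin d) : inv (theta a : Fun U) = -theta a := inv_odd _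
@[simp] theorem inv_gb : inv (gb : Fun U) = -gb := inv_odd _
@[simp] theorem inv_gc : inv (gc : Fun U) = -gc := inv_odd _
@[simp] theorem inv_mono (m : ℕ) (n : ℤ) : inv (mono m n : Fun U) = mono m n := by
  simp [mono_eq, inv_elt]
@[simp] theorem inv_gbeta : inv (gbeta : Fun U) = gbeta := inv_mono _ _
@[simp] theorem inv_ggamma : inv (ggamma : Fun U) = ggamma := inv_mono _ _
@[simp] theorem inv_gammaInv : inv (gammaInv : Fun U) = gammaInv := inv_mono _ _

theorem base_comm (g : SmoothFn U) (F : Fun U) : base g * F = F * base g :=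
  even_comm (inv_base g) F
theorem mom_comm (a : Fin d) (F : Fun U) : mom a * F = F * mom a :=
  even_comm (inv_mom a) F
theorem mono_comm (m : ℕ) (n : ℤ) (F : Fun U) : mono m n * F = F * mono m n :=
  even_comm (inv_mono m n) F
theorem theta_anticomm (a b : Fin d) : (theta a * theta b : Fun U) = -(theta b * theta a) :=
  odd_anticomm (inv_theta a) (inv_theta b)
theorem gb_sq : (gb * gb : Fun U) = 0 := odd_mul_self inv_gb
theorem gc_sq : (gc * gc : Fun U) = 0 := odd_mul_self inv_gc
theorem gb_mul_gc : (gb * gc : Fun U) = -(gc * gb) := odd_anticomm inv_gb inv_gc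

theorem mono_mul (m m' : ℕ) (n n' : ℤ) :
    (mono m n * mono m' n' : Fun U) = mono (m + m') (n + n') := by
  simp [mono_eq, elt_mul]
theorem mono_zero : (mono 0 0 : Fun U) = 1 := rfl

theorem gammaInv_mul_ggamma : (gammaInv * ggamma : Fun U) = 1 := by
  rw [gammaInv, ggamma, mono_mul]; exact mono_zero

/-! ### Partial derivatives of the coordinates -/

@[simp] theorem evenDeriv_fn (v : (Fin d → ℝ) × (Fin d → ℝ)) (g : SmoothFn (cotangent U)) :
    evenDeriv v (fn g : Fun U) = fn (dirDeriv _ v g) := by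
  simp only [fn_eq, evenDeriv_elt]
@[simp] theorem evenDeriv_odd (v : (Fin d → ℝ) × (Fin d → ℝ)) (i : Odd d) :
    evenDeriv v (odd i : Fun U) = 0 := by
  rw [odd_eq, evenDeriv_elt]; simp [elt]
@[simp] theorem evenDeriv_mono (v : (Fin d → ℝ) × (Fin d → ℝ)) (m : ℕ) (n : ℤ) :
    evenDeriv v (mono m n : Fun U) = 0 := by
  rw [mono_eq, evenDeriv_elt]; simp [elt]
@[simp] theorem dL_fn (i : Odd d) (g : SmoothFn (cotangent U)) : dL i (fn g : Fun U) = 0 := by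
  rw [fn_eq, dL_elt]; simp [elt]
@[simp] theorem dL_mono (i : Odd d) (m : ℕ) (n : ℤ) : dL i (mono m n : Fun U) = 0 := by
  rw [mono_eq, dL_elt]; simp [elt]
theorem dL_odd (i j : Odd d) : dL i (odd j : Fun U) = if i = j then 1 else 0 := by
  rw [odd_eq, dL_elt]
  change elt _ _ (CliffordAlgebra.contractLeft _ (CliffordAlgebra.ι _ _)) = _
  rw [CliffordAlgebra.contractLeft_ι]
  by_cases h : i = j
  · subst h; simp [one_eq]
  · simp [h, elt]
@[simp] theorem dBeta_fn (g : SmoothFn (cotangent U)) : dBeta (fn g : Fun U) = 0 := by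
  simp [fn_eq, dBeta_elt]
@[simp] theorem dBeta_odd (i : Odd d) : dBeta (odd i : Fun U) = 0 := by
  simp [odd_eq, dBeta_elt]
@[simp] theorem dBeta_mono (m : ℕ) (n : ℤ) :
    dBeta (mono m n : Fun U) = (m : ℝ) • mono (m - 1) n := by
  simp [mono_eq, dBeta_elt]
@[simp] theorem dGamma_fn (g : SmoothFn (cotangent U)) : dGamma (fn g : Fun U) = 0 := by
  simp [fn_eq, dGamma_elt]
@[simp] theorem dGamma_odd (i : Odd d) : dGamma (odd i : Fun U) = 0 := by
  simp [odd_eq, dGamma_elt]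
@[simp] theorem dGamma_mono (m : ℕ) (n : ℤ) :
    dGamma (mono m n : Fun U) = (n : ℝ) • mono m (n - 1) := by
  simp [mono_eq, dGamma_elt]

theorem dirDeriv_pull (v : (Fin d → ℝ) × (Fin d → ℝ)) (g : SmoothFn U) :
    dirDeriv (cotangent U) v (pull g) = pull (dirDeriv U v.1 g) := by
  refine SmoothFn.ext fun z => ?_
  have hz : z.1.1 ∈ U := z.2
  change fderiv ℝ (ext (cotangent U) (pull g).1) z v = fderiv ℝ (ext U g.1) z.1.1 v.1
  rw [fderiv_ext_eq (g := fun y => ext U g.1 y.1)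
    (fun y => (ext_apply U g.1 ⟨y.1.1, y.2⟩).symm)]
  have h1 : HasFDerivAt (ext U g.1) (fderiv ℝ (ext U g.1) z.1.1) (z : (Fin d → ℝ) × (Fin d → ℝ)).1 :=
    (differentiableAt_ext g ⟨z.1.1, hz⟩).hasFDerivAt
  have h2 := h1.comp (z : (Fin d → ℝ) × (Fin d → ℝ)) hasFDerivAt_fst
  change fderiv ℝ (ext U g.1 ∘ Prod.fst) _ v = _
  rw [h2.fderiv]
  rfl

theorem dirDeriv_momentum (v : (Fin d → ℝ) × (Fin d → ℝ)) (a : Fin d) :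
    dirDeriv (cotangent U) v (momentum U a) = algebraMap ℝ _ (v.2 a) := by
  refine SmoothFn.ext fun z => ?_
  have h1 := fderiv_ext_eq (W := cotangent U) (f := (momentum U a).1) (g := fun y => y.2 a)
    (fun _ => rfl) z
  change fderiv ℝ (ext (cotangent U) (momentum U a).1) z v = v.2 a
  rw [h1]
  have h2 : HasFDerivAt (fun y : (Fin d → ℝ) × (Fin d → ℝ) => y.2 a)
      ((ContinuousLinearMap.proj a).comp (ContinuousLinearMap.snd ℝ _ _))
      (z : (Fin d → ℝ) × (Fin d → ℝ)) :=
    ((ContinuousLinearMap.proj (R := ℝ) (φ := fun _ : Fin d => ℝ) a).comp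
      (ContinuousLinearMap.snd ℝ (Fin d → ℝ) (Fin d → ℝ))).hasFDerivAt
  rw [h2.fderiv]
  rfl

@[simp] theorem dX_base (μ : Fin d) (g : SmoothFn U) : dX μ (base g : Fun U) = base (pd μ g) := by
  rw [base, dX, evenDeriv_fn, dirDeriv_pull]; rfl
@[simp] theorem dP_base (a : Fin d) (g : SmoothFn U) : dP a (base g : Fun U) = 0 := by
  rw [base, dP, evenDeriv_fn, dirDeriv_pull]
  have : dirDeriv U (0 : Fin d → ℝ) g = 0 := SmoothFn.ext fun z =>
    (fderiv ℝ (ext U g.1) z).map_zero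
  rw [this, map_zero, fn_zero]
@[simp] theorem dX_mom (μ a : Fin d) : dX μ (mom a : Fun U) = 0 := by
  rw [mom, dX, evenDeriv_fn, dirDeriv_momentum]
  simp [fn_zero]
theorem dP_mom (a b : Fin d) : dP a (mom b : Fun U) = if a = b then 1 else 0 := by
  rw [mom, dP, evenDeriv_fn, dirDeriv_momentum]
  by_cases h : a = b
  · subst h; simp [fn_one]
  · simp [fn_zero, h, Ne.symm h]

@[simp] theorem dX_theta (μ a : Fin d) : dX μ (theta a : Fun U) = 0 := evenDeriv_odd _ _
@[simp] theorem dX_gb (μ : Fin d) : dX μ (gb : Fun U) = 0 := evenDeriv_odd _ _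
@[simp] theorem dX_gc (μ : Fin d) : dX μ (gc : Fun U) = 0 := evenDeriv_odd _ _
@[simp] theorem dX_mono (μ : Fin d) (m : ℕ) (n : ℤ) : dX μ (mono m n : Fun U) = 0 :=
  evenDeriv_mono _ _ _
@[simp] theorem dX_gbeta (μ : Fin d) : dX μ (gbeta : Fun U) = 0 := evenDeriv_mono _ _ _
@[simp] theorem dX_ggamma (μ : Fin d) : dX μ (ggamma : Fun U) = 0 := evenDeriv_mono _ _ _
@[simp] theorem dP_theta (μ a : Fin d) : dP μ (theta a : Fun U) = 0 := evenDeriv_odd _ _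
@[simp] theorem dP_gb (μ : Fin d) : dP μ (gb : Fun U) = 0 := evenDeriv_odd _ _
@[simp] theorem dP_gc (μ : Fin d) : dP μ (gc : Fun U) = 0 := evenDeriv_odd _ _
@[simp] theorem dP_mono (μ : Fin d) (m : ℕ) (n : ℤ) : dP μ (mono m n : Fun U) = 0 :=
  evenDeriv_mono _ _ _
@[simp] theorem dP_gbeta (μ : Fin d) : dP μ (gbeta : Fun U) = 0 := evenDeriv_mono _ _ _
@[simp] theorem dP_ggamma (μ : Fin d) : dP μ (ggamma : Fun U) = 0 := evenDeriv_mono _ _ _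
@[simp] theorem dL_base (i : Odd d) (g : SmoothFn U) : dL i (base g : Fun U) = 0 := dL_fn _ _
@[simp] theorem dL_mom (i : Odd d) (a : Fin d) : dL i (mom a : Fun U) = 0 := dL_fn _ _
@[simp] theorem dL_gbeta (i : Odd d) : dL i (gbeta : Fun U) = 0 := dL_mono _ _ _
@[simp] theorem dL_ggamma (i : Odd d) : dL i (ggamma : Fun U) = 0 := dL_mono _ _ _
theorem dL_theta (a b : Fin d) : dL (Sum.inl a) (theta b : Fun U) = if a = b then 1 else 0 := by
  simp [theta, dL_odd]
@[simp] theorem dL_inr_theta (i : Fin 2) (b : Fin d) : dL (Sum.inr i) (theta b : Fun U) = 0 := by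
  simp [theta, dL_odd]
@[simp] theorem dL_inl_gb (a : Fin d) : dL (Sum.inl a) (gb : Fun U) = 0 := by simp [gb, dL_odd]
@[simp] theorem dL_inl_gc (a : Fin d) : dL (Sum.inl a) (gc : Fun U) = 0 := by simp [gc, dL_odd]
@[simp] theorem dL_0_gb : dL (Sum.inr 0) (gb : Fun U) = 1 := by simp [gb, dL_odd]
@[simp] theorem dL_1_gb : dL (Sum.inr 1) (gb : Fun U) = 0 := by simp [gb, dL_odd]
@[simp] theorem dL_0_gc : dL (Sum.inr 0) (gc : Fun U) = 0 := by simp [gc, dL_odd]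
@[simp] theorem dL_1_gc : dL (Sum.inr 1) (gc : Fun U) = 1 := by simp [gc, dL_odd]
@[simp] theorem dBeta_base (g : SmoothFn U) : dBeta (base g : Fun U) = 0 := dBeta_fn _
@[simp] theorem dBeta_mom (a : Fin d) : dBeta (mom a : Fun U) = 0 := dBeta_fn _
@[simp] theorem dBeta_theta (a : Fin d) : dBeta (theta a : Fun U) = 0 := dBeta_odd _
@[simp] theorem dBeta_gb : dBeta (gb : Fun U) = 0 := dBeta_odd _
@[simp] theorem dBeta_gc : dBeta (gc : Fun U) = 0 := dBeta_odd _
@[simp] theorem dBeta_gbeta : dBeta (gbeta : Fun U) = 1 := by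
  rw [gbeta, dBeta_mono]; simp [mono_zero]
@[simp] theorem dBeta_ggamma : dBeta (ggamma : Fun U) = 0 := by
  rw [ggamma, dBeta_mono]; simp
@[simp] theorem dGamma_base (g : SmoothFn U) : dGamma (base g : Fun U) = 0 := dGamma_fn _
@[simp] theorem dGamma_mom (a : Fin d) : dGamma (mom a : Fun U) = 0 := dGamma_fn _
@[simp] theorem dGamma_theta (a : Fin d) : dGamma (theta a : Fun U) = 0 := dGamma_odd _
@[simp] theorem dGamma_gb : dGamma (gb : Fun U) = 0 := dGamma_odd _
@[simp] theorem dGamma_gc : dGamma (gc : Fun U) = 0 := dGamma_odd _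
@[simp] theorem dGamma_gbeta : dGamma (gbeta : Fun U) = 0 := by
  rw [gbeta, dGamma_mono]; simp
@[simp] theorem dGamma_ggamma : dGamma (ggamma : Fun U) = 1 := by
  rw [ggamma, dGamma_mono]; simp [mono_zero]

theorem isEvenDer_dX (μ : Fin d) : IsEvenDer (dX μ : Fun U →ₗ[ℝ] Fun U) := isEvenDer_evenDeriv _
theorem isEvenDer_dP (μ : Fin d) : IsEvenDer (dP μ : Fun U →ₗ[ℝ] Fun U) := isEvenDer_evenDeriv _

theorem IsEvenDer.one {D : Fun U →ₗ[ℝ] Fun U} (h : IsEvenDer D) : D 1 = 0 := by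
  simpa using h.mul 1 1
theorem IsOddDer.one {D : Fun U →ₗ[ℝ] Fun U} (h : IsOddDer D) : D 1 = 0 := by
  simpa using h.mul 1 1

theorem dirDeriv_comm {E : Type*} [NormedAddCommGroup E] [NormedSpace ℝ E] (W : Opens E) (v w : E)
    (g : SmoothFn W) : dirDeriv W v (dirDeriv W w g) = dirDeriv W w (dirDeriv W v g) := by
  refine SmoothFn.ext fun z => ?_
  have hsm : ContDiffAt ℝ ∞ (ext W g.1) z := ContDiffOn.contDiffAt g.2 (W.isOpen.mem_nhds z.2)
  have h2 : (2 : WithTop ℕ∞) ≤ ∞ := ENat.LEInfty.out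
  have hd : DifferentiableAt ℝ (fderiv ℝ (ext W g.1)) z :=
    (hsm.fderiv_right (m := 1) (by rw [one_add_one_eq_two]; exact h2)).differentiableAt one_ne_zero
  have hsymm : IsSymmSndFDerivAt ℝ (ext W g.1) (z : E) := hsm.isSymmSndFDerivAt (by simpa using h2)
  have key : ∀ v w : E, (dirDeriv W v (dirDeriv W w g)).1 z
      = fderiv ℝ (fderiv ℝ (ext W g.1)) z v w := by
    intro v w
    have h1 := fderiv_ext_eq (W := W) (f := (dirDeriv W w g).1)
      (g := fun y => fderiv ℝ (ext W g.1) y w) (fun _ => rfl) z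
    change fderiv ℝ (ext W (dirDeriv W w g).1) z v = _
    rw [h1, fderiv_clm_apply hd (differentiableAt_const w)]
    simp
  rw [key, key]
  exact hsymm v w

theorem pd_comm (μ ν : Fin d) (g : SmoothFn U) : pd μ (pd ν g) = pd ν (pd μ g) :=
  dirDeriv_comm U _ _ g

theorem dL_comm (i j : Odd d) (F : Fun U) : dL i (dL j F) = -dL j (dL i F) := by
  induction F using fun_induction with
  | h0 => simp
  | hadd F G hF hG => simp only [map_add, hF, hG, neg_add]
  | helt k g w =>
    rw [dL_elt, dL_elt, dL_elt, dL_elt, CliffordAlgebra.contractLeft_comm]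
    simp [elt, TensorProduct.tmul_neg]

/-! ### Derivations and generators -/

theorem IsEvenDer.ext_adjoin {D D' : Fun U →ₗ[ℝ] Fun U} (h : IsEvenDer D) (h' : IsEvenDer D')
    {s : Set (Fun U)} (hs : ∀ F ∈ s, D F = D' F) {F : Fun U} (hF : F ∈ Algebra.adjoin ℝ s) :
    D F = D' F := by
  induction hF using Algebra.adjoin_induction with
  | mem F hF => exact hs F hF
  | algebraMap r => rw [Algebra.algebraMap_eq_smul_one, map_smul, map_smul, h.one, h'.one]
  | add F G _ _ hF hG => rw [map_add, map_add, hF, hG]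
  | mul F G _ _ hF hG => rw [h.mul, h'.mul, hF, hG]

theorem IsOddDer.ext_adjoin {D D' : Fun U →ₗ[ℝ] Fun U} (h : IsOddDer D) (h' : IsOddDer D')
    {s : Set (Fun U)} (hs : ∀ F ∈ s, D F = D' F) {F : Fun U} (hF : F ∈ Algebra.adjoin ℝ s) :
    D F = D' F := by
  induction hF using Algebra.adjoin_induction with
  | mem F hF => exact hs F hF
  | algebraMap r => rw [Algebra.algebraMap_eq_smul_one, map_smul, map_smul, h.one, h'.one]
  | add F G _ _ hF hG => rw [map_add, map_add, hF, hG]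
  | mul F G _ _ hF hG => rw [h.mul, h'.mul, hF, hG]

/-- A subalgebra which is generated by eigenvectors of the grade involution is stable under it. -/
theorem inv_mem_adjoin {s : Set (Fun U)} (hs : ∀ F ∈ s, inv F = F ∨ inv F = -F) {F : Fun U}
    (hF : F ∈ Algebra.adjoin ℝ s) : inv F ∈ Algebra.adjoin ℝ s := by
  induction hF using Algebra.adjoin_induction with
  | mem F hF =>
    rcases hs F hF with h | h <;> rw [h]
    · exact Algebra.subset_adjoin hF
    · exact neg_mem (Algebra.subset_adjoin hF)
  | algebraMap r => rw [AlgHom.commutes]; exact Subalgebra.algebraMap_mem _ r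
  | add F G _ _ hF hG => rw [map_add]; exact add_mem hF hG
  | mul F G _ _ hF hG => rw [map_mul]; exact mul_mem hF hG

theorem IsOddDer.mem_adjoin {D : Fun U →ₗ[ℝ] Fun U} (h : IsOddDer D) {s : Set (Fun U)}
    (hs : ∀ F ∈ s, inv F = F ∨ inv F = -F) (hD : ∀ F ∈ s, D F ∈ Algebra.adjoin ℝ s) {F : Fun U}
    (hF : F ∈ Algebra.adjoin ℝ s) : D F ∈ Algebra.adjoin ℝ s := by
  induction hF using Algebra.adjoin_induction with
  | mem F hF => exact hD F hF
  | algebraMap r =>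
    rw [Algebra.algebraMap_eq_smul_one, map_smul, h.one, smul_zero]; exact zero_mem _
  | add F G _ _ hF hG => rw [map_add]; exact add_mem hF hG
  | mul F G hF' hG' hF hG =>
    rw [h.mul]
    exact add_mem (mul_mem hF hG') (mul_mem (inv_mem_adjoin hs hF') hG)

/-- The coordinates, as a set of generators of the superalgebra `Fun U`. -/
def coordinates (U : Opens (Fin d → ℝ)) : Set (Fun U) :=
  Set.range fn ∪ Set.range odd ∪ {gbeta, ggamma, gammaInv}

theorem mem_adjoin_coordinates (F : Fun U) : F ∈ Algebra.adjoin ℝ (coordinates U) := by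
  induction F using fun_induction with
  | h0 => exact zero_mem _
  | hadd F G hF hG => exact add_mem hF hG
  | helt k g w =>
    have hw : elt 0 1 w ∈ Algebra.adjoin ℝ (coordinates U) := by
      induction w using CliffordAlgebra.left_induction with
      | algebraMap r =>
        have : elt 0 1 (algebraMap ℝ (ExteriorAlgebra ℝ (Odd d → ℝ)) r)
            = algebraMap ℝ (Fun U) r := by
          rw [Algebra.algebraMap_eq_smul_one, Algebra.algebraMap_eq_smul_one, elt,
            TensorProduct.tmul_smul, ← AddMonoidAlgebra.smul_single]
          rfl
        exact this ▸ Subalgebra.algebraMap_mem _ r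
      | add v v' hv hv' => rw [elt_add_right]; exact add_mem hv hv'
      | ι_mul w m hw =>
        have h1 : elt 0 1 (CliffordAlgebra.ι _ m)
            = (∑ i, m i • odd i : Fun U) := by
          have : m = ∑ i, m i • (Pi.single i 1 : Odd d → ℝ) := by
            ext j; simp [Finset.sum_apply, Pi.single_apply]
          conv_lhs => rw [this]
          let L : ExteriorAlgebra ℝ (Odd d → ℝ) →ₗ[ℝ] Fun U :=
            AddMonoidAlgebra.lsingle 0 ∘ₗ TensorProduct.mk ℝ _ _ 1
          change L (CliffordAlgebra.ι _ (∑ i, m i • (Pi.single i 1 : Odd d → ℝ))) = _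
          simp only [map_sum, map_smul]
          rfl
        have h2 : elt 0 1 (CliffordAlgebra.ι _ m * w)
            = (elt 0 1 (CliffordAlgebra.ι _ m) * elt 0 1 w : Fun U) := by simp [elt_mul]
        rw [h2, h1]
        refine mul_mem (sum_mem fun i _ => Subalgebra.smul_mem _ (Algebra.subset_adjoin ?_) _) hw
        exact Or.inl (Or.inr ⟨i, rfl⟩)
    have hm : ∀ (m : ℕ) (n : ℤ), (mono m n : Fun U) ∈ Algebra.adjoin ℝ (coordinates U) := by
      intro m n
      have h1 : ∀ (k l : ℕ) (n : ℤ), (mono k n : Fun U) ^ l = mono (k * l) (n * l) := by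
        intro k l n
        induction l with
        | zero => simp [mono_zero]
        | succ l ih => rw [pow_succ, ih, mono_mul]; push_cast; congr 1; ring
      have hb : (gbeta : Fun U) ∈ Algebra.adjoin ℝ (coordinates U) :=
        Algebra.subset_adjoin (Or.inr (by simp))
      have hc : (ggamma : Fun U) ∈ Algebra.adjoin ℝ (coordinates U) :=
        Algebra.subset_adjoin (Or.inr (by simp))
      have hi : (gammaInv : Fun U) ∈ Algebra.adjoin ℝ (coordinates U) :=
        Algebra.subset_adjoin (Or.inr (by simp))
      obtain ⟨n, rfl | rfl⟩ := n.eq_nat_or_neg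
      · have : (mono m n : Fun U) = gbeta ^ m * ggamma ^ n := by
          rw [gbeta, ggamma, h1, h1, mono_mul]; simp
        exact this ▸ mul_mem (pow_mem hb m) (pow_mem hc n)
      · have : (mono m (-n) : Fun U) = gbeta ^ m * gammaInv ^ n := by
          rw [gbeta, gammaInv, h1, h1, mono_mul]; simp
        exact this ▸ mul_mem (pow_mem hb m) (pow_mem hi n)
    have : (elt k g w : Fun U) = fn g * elt 0 1 w * mono k.1 k.2 := by
      simp [fn_eq, mono_eq, elt_mul]
    rw [this]
    exact mul_mem (mul_mem (Algebra.subset_adjoin (Or.inl (Or.inl ⟨g, rfl⟩))) hw) (hm _ _)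

/-! ### Left multiples of derivations -/

theorem IsEvenDer.mulLeft {D : Fun U →ₗ[ℝ] Fun U} (h : IsEvenDer D) {v : Fun U} (hv : inv v = v) :
    IsEvenDer (LinearMap.mulLeft ℝ v ∘ₗ D) where
  mul F G := by
    simp only [LinearMap.comp_apply, LinearMap.mulLeft_apply, h.mul, mul_add, ← mul_assoc,
      even_comm hv F]
  inv_apply F := by simp [h.inv_apply, hv]

theorem IsEvenDer.mulLeft_odd {D : Fun U →ₗ[ℝ] Fun U} (h : IsEvenDer D) {v : Fun U}
    (hv : inv v = -v) : IsOddDer (LinearMap.mulLeft ℝ v ∘ₗ D) where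
  mul F G := by
    simp only [LinearMap.comp_apply, LinearMap.mulLeft_apply, h.mul, mul_add, ← mul_assoc,
      odd_comm hv F]
  inv_apply F := by simp [h.inv_apply, hv]

theorem IsOddDer.mulLeft {D : Fun U →ₗ[ℝ] Fun U} (h : IsOddDer D) {v : Fun U}
    (hv : inv v = v) : IsOddDer (LinearMap.mulLeft ℝ v ∘ₗ D) where
  mul F G := by
    simp only [LinearMap.comp_apply, LinearMap.mulLeft_apply, h.mul, mul_add, ← mul_assoc,
      even_comm hv (inv F)]
  inv_apply F := by simp [h.inv_apply, hv]

theorem IsOddDer.mulLeft_odd {D : Fun U →ₗ[ℝ] Fun U} (h : IsOddDer D) {v : Fun U}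
    (hv : inv v = -v) : IsEvenDer (LinearMap.mulLeft ℝ v ∘ₗ D) where
  mul F G := by
    simp only [LinearMap.comp_apply, LinearMap.mulLeft_apply, h.mul, mul_add, ← mul_assoc,
      odd_comm hv (inv F), inv_inv]
  inv_apply F := by simp [h.inv_apply, hv]

theorem IsEvenDer.add {D D' : Fun U →ₗ[ℝ] Fun U} (h : IsEvenDer D) (h' : IsEvenDer D') :
    IsEvenDer (D + D') where
  mul F G := by simp only [LinearMap.add_apply, h.mul, h'.mul, add_mul, mul_add]; abel
  inv_apply F := by simp [h.inv_apply, h'.inv_apply]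

theorem IsOddDer.add {D D' : Fun U →ₗ[ℝ] Fun U} (h : IsOddDer D) (h' : IsOddDer D') :
    IsOddDer (D + D') where
  mul F G := by simp only [LinearMap.add_apply, h.mul, h'.mul, add_mul, mul_add]; abel
  inv_apply F := by simp [h.inv_apply, h'.inv_apply, add_comm]

theorem IsEvenDer.sub {D D' : Fun U →ₗ[ℝ] Fun U} (h : IsEvenDer D) (h' : IsEvenDer D') :
    IsEvenDer (D - D') where
  mul F G := by simp only [LinearMap.sub_apply, h.mul, h'.mul, sub_mul, mul_sub]; abel
  inv_apply F := by simp [h.inv_apply, h'.inv_apply]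

theorem IsOddDer.sub {D D' : Fun U →ₗ[ℝ] Fun U} (h : IsOddDer D) (h' : IsOddDer D') :
    IsOddDer (D - D') where
  mul F G := by simp only [LinearMap.sub_apply, h.mul, h'.mul, sub_mul, mul_sub]; abel
  inv_apply F := by simp [h.inv_apply, h'.inv_apply]; abel

theorem IsEvenDer.zero : IsEvenDer (0 : Fun U →ₗ[ℝ] Fun U) := ⟨by simp, by simp⟩
theorem IsOddDer.zero : IsOddDer (0 : Fun U →ₗ[ℝ] Fun U) := ⟨by simp, by simp⟩

theorem IsEvenDer.sum {ι : Type*} (s : Finset ι) {D : ι → Fun U →ₗ[ℝ] Fun U}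
    (h : ∀ i, IsEvenDer (D i)) : IsEvenDer (∑ i ∈ s, D i) :=
  Finset.sum_induction _ _ (fun _ _ => IsEvenDer.add) IsEvenDer.zero fun i _ => h i

theorem IsOddDer.sum {ι : Type*} (s : Finset ι) {D : ι → Fun U →ₗ[ℝ] Fun U}
    (h : ∀ i, IsOddDer (D i)) : IsOddDer (∑ i ∈ s, D i) :=
  Finset.sum_induction _ _ (fun _ _ => IsOddDer.add) IsOddDer.zero fun i _ => h i

theorem IsEvenDer.smul {D : Fun U →ₗ[ℝ] Fun U} (h : IsEvenDer D) (r : ℝ) : IsEvenDer (r • D) where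
  mul F G := by simp only [LinearMap.smul_apply, h.mul, smul_add, smul_mul_assoc, mul_smul_comm]
  inv_apply F := by simp [h.inv_apply]

theorem IsOddDer.smul {D : Fun U →ₗ[ℝ] Fun U} (h : IsOddDer D) (r : ℝ) : IsOddDer (r • D) where
  mul F G := by simp only [LinearMap.smul_apply, h.mul, smul_add, smul_mul_assoc, mul_smul_comm]
  inv_apply F := by simp [h.inv_apply]

theorem IsOddDer.sq {D : Fun U →ₗ[ℝ] Fun U} (h : IsOddDer D) : IsEvenDer (D ∘ₗ D) where
  mul F G := by
    simp only [LinearMap.comp_apply, h.mul, map_add, h.inv_apply, inv_inv]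
    noncomm_ring
  inv_apply F := by simp [h.inv_apply]

theorem IsEvenDer.comm {D D' : Fun U →ₗ[ℝ] Fun U} (h : IsEvenDer D) (h' : IsEvenDer D') :
    IsEvenDer (D ∘ₗ D' - D' ∘ₗ D) where
  mul F G := by
    simp only [LinearMap.sub_apply, LinearMap.comp_apply, h.mul, h'.mul, map_add]
    noncomm_ring
  inv_apply F := by simp [h.inv_apply, h'.inv_apply]

theorem IsEvenDer.comm_odd {D D' : Fun U →ₗ[ℝ] Fun U} (h : IsEvenDer D) (h' : IsOddDer D') :
    IsOddDer (D ∘ₗ D' - D' ∘ₗ D) where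
  mul F G := by
    simp only [LinearMap.sub_apply, LinearMap.comp_apply, h.mul, h'.mul, map_add, h.inv_apply]
    noncomm_ring
  inv_apply F := by simp [h.inv_apply, h'.inv_apply]; abel

theorem IsOddDer.comm {D D' : Fun U →ₗ[ℝ] Fun U} (h : IsOddDer D) (h' : IsOddDer D') :
    IsEvenDer (D ∘ₗ D' + D' ∘ₗ D) where
  mul F G := by
    simp only [LinearMap.add_apply, LinearMap.comp_apply, h.mul, h'.mul, map_add, h.inv_apply,
      h'.inv_apply, inv_inv]
    noncomm_ring
  inv_apply F := by simp [h.inv_apply, h'.inv_apply]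

/-! ### Hamiltonian vector fields -/

section Hamiltonian

variable (e : Frame U) (B : Matrix (Fin d) (Fin d) (SmoothFn U))

theorem inv_bracketPTheta (a b : Fin d) :
    inv (bracketPTheta e a b) = -bracketPTheta e a b := by
  simp [bracketPTheta]

theorem inv_bracketPP (a b : Fin d) : inv (bracketPP e B a b) = bracketPP e B a b := by
  simp [bracketPP]

/-- The Hamiltonian vector field `{F, -}`. -/
def ham (F : Fun U) : Fun U →ₗ[ℝ] Fun U :=
  (∑ a, ∑ μ, (LinearMap.mulLeft ℝ (dP a F * base (coframe e μ a)) ∘ₗ dX μ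
      - LinearMap.mulLeft ℝ (dX μ F * base (coframe e μ a)) ∘ₗ dP a))
    + (∑ a, ∑ b, LinearMap.mulLeft ℝ (dP a F * bracketPP e B a b) ∘ₗ dP b)
    + (∑ a, ∑ b, (LinearMap.mulLeft ℝ (dP a F * bracketPTheta e a b) ∘ₗ dL (Sum.inl b)
        - LinearMap.mulLeft ℝ (dR (Sum.inl b) F * bracketPTheta e a b) ∘ₗ dP a))
    + (∑ a, (2 : ℝ) • (LinearMap.mulLeft ℝ (dR (Sum.inl a) F) ∘ₗ dL (Sum.inl a)))
    + (LinearMap.mulLeft ℝ (dR (Sum.inr 0) F) ∘ₗ dL (Sum.inr 1)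
      + LinearMap.mulLeft ℝ (dR (Sum.inr 1) F) ∘ₗ dL (Sum.inr 0))
    + (LinearMap.mulLeft ℝ (dBeta F) ∘ₗ dGamma - LinearMap.mulLeft ℝ (dGamma F) ∘ₗ dBeta)

theorem ham_apply (F G : Fun U) : ham e B F G = bracket e B F G := by
  simp [ham, bracket, LinearMap.sum_apply, mul_assoc]

theorem isOddDer_ham {F : Fun U} (hF : inv F = -F) : IsOddDer (ham e B F) := by
  have hP : ∀ a, inv (dP a F) = -dP a F := fun a => by
    rw [← (isEvenDer_dP a).inv_apply, hF, map_neg]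
  have hX : ∀ a, inv (dX a F) = -dX a F := fun a => by
    rw [← (isEvenDer_dX a).inv_apply, hF, map_neg]
  have hR : ∀ i, inv (dR i F) = dR i F := fun i => by
    rw [dR_eq, inv_inv, ← neg_inj, ← dL_inv, hF, map_neg]
  have hβ : inv (dBeta F) = -dBeta F := by rw [← dBeta_inv, hF, map_neg]
  have hγ : inv (dGamma F) = -dGamma F := by rw [← dGamma_inv, hF, map_neg]
  refine IsOddDer.add (IsOddDer.add (IsOddDer.add (IsOddDer.add (IsOddDer.add ?_ ?_) ?_) ?_) ?_) ?_
  · refine .sum _ fun a => .sum _ fun μ => .sub ?_ ?_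
    · exact (isEvenDer_dX μ).mulLeft_odd (by simp [hP])
    · exact (isEvenDer_dP a).mulLeft_odd (by simp [hX])
  · refine .sum _ fun a => .sum _ fun b => ?_
    exact (isEvenDer_dP b).mulLeft_odd (by simp [hP, inv_bracketPP])
  · refine .sum _ fun a => .sum _ fun b => .sub ?_ ?_
    · exact (isOddDer_dL _).mulLeft (by simp [hP, inv_bracketPTheta])
    · exact (isEvenDer_dP a).mulLeft_odd (by simp [hR, inv_bracketPTheta])
  · exact .sum _ fun a => ((isOddDer_dL _).mulLeft (hR _)).smul _
  · exact ((isOddDer_dL _).mulLeft (hR _)).add ((isOddDer_dL _).mulLeft (hR _))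
  · exact (isEvenDer_dGamma.mulLeft_odd hβ).sub (isEvenDer_dBeta.mulLeft_odd hγ)

theorem isEvenDer_ham {F : Fun U} (hF : inv F = F) : IsEvenDer (ham e B F) := by
  have hP : ∀ a, inv (dP a F) = dP a F := fun a => by
    rw [← (isEvenDer_dP a).inv_apply, hF]
  have hX : ∀ a, inv (dX a F) = dX a F := fun a => by
    rw [← (isEvenDer_dX a).inv_apply, hF]
  have hR : ∀ i, inv (dR i F) = -dR i F := fun i => by
    rw [dR_eq, inv_inv, ← dL_inv, hF]
  have hβ : inv (dBeta F) = dBeta F := by rw [← dBeta_inv, hF]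
  have hγ : inv (dGamma F) = dGamma F := by rw [← dGamma_inv, hF]
  refine IsEvenDer.add (IsEvenDer.add (IsEvenDer.add (IsEvenDer.add (IsEvenDer.add ?_ ?_) ?_) ?_)
    ?_) ?_
  · refine .sum _ fun a => .sum _ fun μ => .sub ?_ ?_
    · exact (isEvenDer_dX μ).mulLeft (by simp [hP])
    · exact (isEvenDer_dP a).mulLeft (by simp [hX])
  · refine .sum _ fun a => .sum _ fun b => ?_
    exact (isEvenDer_dP b).mulLeft (by simp [hP, inv_bracketPP])
  · refine .sum _ fun a => .sum _ fun b => .sub ?_ ?_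
    · exact (isOddDer_dL _).mulLeft_odd (by simp [hP, inv_bracketPTheta])
    · exact (isEvenDer_dP a).mulLeft (by simp [hR, inv_bracketPTheta])
  · exact .sum _ fun a => ((isOddDer_dL _).mulLeft_odd (hR _)).smul _
  · exact ((isOddDer_dL _).mulLeft_odd (hR _)).add ((isOddDer_dL _).mulLeft_odd (hR _))
  · exact (isEvenDer_dGamma.mulLeft hβ).sub (isEvenDer_dBeta.mulLeft hγ)

theorem bracket_add_left (F F' G : Fun U) :
    bracket e B (F + F') G = bracket e B F G + bracket e B F' G := by
  simp only [bracket, map_add, add_mul, smul_add, Finset.sum_add_distrib, Finset.sum_sub_distrib]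
  abel

theorem bracket_smul_left (r : ℝ) (F G : Fun U) :
    bracket e B (r • F) G = r • bracket e B F G := by
  simp only [bracket, map_smul, smul_mul_assoc, smul_add, smul_sub, Finset.smul_sum,
    smul_comm r (2 : ℝ)]

theorem bracket_neg_left (F G : Fun U) : bracket e B (-F) G = -bracket e B F G := by
  simpa using bracket_smul_left e B (-1) F G

theorem bracket_sub_left (F F' G : Fun U) :
    bracket e B (F - F') G = bracket e B F G - bracket e B F' G := by
  rw [sub_eq_add_neg, bracket_add_left, bracket_neg_left, sub_eq_add_neg]

/-! ### Functions of `x`, `p`, `θ` -/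

/-- The subalgebra `O(T^*U × ℝ^{0|d})` of functions of `x, p, θ`. -/
def funcsO (U : Opens (Fin d → ℝ)) : Subalgebra ℝ (Fun U) :=
  Algebra.adjoin ℝ (Set.range fn ∪ Set.range theta)

theorem fn_mem (g : SmoothFn (cotangent U)) : (fn g : Fun U) ∈ funcsO U :=
  Algebra.subset_adjoin (Or.inl ⟨g, rfl⟩)
theorem base_mem (g : SmoothFn U) : (base g : Fun U) ∈ funcsO U := fn_mem _
theorem mom_mem (a : Fin d) : (mom a : Fun U) ∈ funcsO U := fn_mem _
theorem theta_mem (a : Fin d) : (theta a : Fun U) ∈ funcsO U :=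
  Algebra.subset_adjoin (Or.inr ⟨a, rfl⟩)

theorem funcsO_gens {F : Fun U} (hF : F ∈ Set.range fn ∪ Set.range theta) :
    inv F = F ∨ inv F = -F := by
  rcases hF with ⟨g, rfl⟩ | ⟨a, rfl⟩
  · exact Or.inl (inv_fn g)
  · exact Or.inr (inv_theta a)

theorem inv_mem_funcsO {F : Fun U} (hF : F ∈ funcsO U) : inv F ∈ funcsO U :=
  inv_mem_adjoin (fun _ => funcsO_gens) hF

theorem IsEvenDer.mem_adjoin {D : Fun U →ₗ[ℝ] Fun U} (h : IsEvenDer D) {s : Set (Fun U)}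
    (hD : ∀ F ∈ s, D F ∈ Algebra.adjoin ℝ s) {F : Fun U}
    (hF : F ∈ Algebra.adjoin ℝ s) : D F ∈ Algebra.adjoin ℝ s := by
  induction hF using Algebra.adjoin_induction with
  | mem F hF => exact hD F hF
  | algebraMap r =>
    rw [Algebra.algebraMap_eq_smul_one, map_smul, h.one, smul_zero]; exact zero_mem _
  | add F G _ _ hF hG => rw [map_add]; exact add_mem hF hG
  | mul F G hF' hG' hF hG =>
    rw [h.mul]
    exact add_mem (mul_mem hF hG') (mul_mem hF' hG)

theorem evenDeriv_mem (v : (Fin d → ℝ) × (Fin d → ℝ)) {F : Fun U} (hF : F ∈ funcsO U) :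
    evenDeriv v F ∈ funcsO U := by
  refine (isEvenDer_evenDeriv v).mem_adjoin ?_ hF
  rintro _ (⟨g, rfl⟩ | ⟨a, rfl⟩)
  · rw [evenDeriv_fn]; exact fn_mem _
  · rw [theta, evenDeriv_odd]; exact zero_mem _

theorem dX_mem (μ : Fin d) {F : Fun U} (hF : F ∈ funcsO U) : dX μ F ∈ funcsO U :=
  evenDeriv_mem _ hF
theorem dP_mem (μ : Fin d) {F : Fun U} (hF : F ∈ funcsO U) : dP μ F ∈ funcsO U :=
  evenDeriv_mem _ hF

theorem dL_mem (i : Odd d) {F : Fun U} (hF : F ∈ funcsO U) : dL i F ∈ funcsO U := by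
  refine (isOddDer_dL i).mem_adjoin (fun _ => funcsO_gens) ?_ hF
  rintro _ (⟨g, rfl⟩ | ⟨a, rfl⟩)
  · rw [dL_fn]; exact zero_mem _
  · rw [theta, dL_odd]; split_ifs
    · exact one_mem _
    · exact zero_mem _

theorem dR_mem (i : Odd d) {F : Fun U} (hF : F ∈ funcsO U) : dR i F ∈ funcsO U := by
  rw [dR_eq]; exact inv_mem_funcsO (dL_mem i hF)

theorem dL_inr_funcsO (i : Fin 2) {F : Fun U} (hF : F ∈ funcsO U) : dL (Sum.inr i) F = 0 :=
  (isOddDer_dL _).ext_adjoin IsOddDer.zero (by rintro _ (⟨g, rfl⟩ | ⟨a, rfl⟩) <;> simp) hF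

theorem dR_inr_funcsO (i : Fin 2) {F : Fun U} (hF : F ∈ funcsO U) : dR (Sum.inr i) F = 0 := by
  rw [dR_eq, dL_inr_funcsO i hF, map_zero]

theorem dBeta_funcsO {F : Fun U} (hF : F ∈ funcsO U) : dBeta F = 0 :=
  isEvenDer_dBeta.ext_adjoin IsEvenDer.zero (by rintro _ (⟨g, rfl⟩ | ⟨a, rfl⟩) <;> simp) hF

theorem dGamma_funcsO {F : Fun U} (hF : F ∈ funcsO U) : dGamma F = 0 :=
  isEvenDer_dGamma.ext_adjoin IsEvenDer.zero (by rintro _ (⟨g, rfl⟩ | ⟨a, rfl⟩) <;> simp) hF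

theorem bracketPTheta_mem (a b : Fin d) : bracketPTheta e a b ∈ funcsO U :=
  neg_mem (sum_mem fun _ _ => sum_mem fun _ _ => mul_mem (base_mem _) (theta_mem _))

theorem bracketPP_mem (a b : Fin d) : bracketPP e B a b ∈ funcsO U :=
  add_mem (sum_mem fun _ _ => mul_mem (sum_mem fun _ _ => base_mem _) (mom_mem _))
    (sum_mem fun _ _ => sum_mem fun _ _ => mul_mem (base_mem _) (add_mem
      (Subalgebra.smul_mem _ (sum_mem fun _ _ => sum_mem fun _ _ =>
        mul_mem (mul_mem (base_mem _) (theta_mem _)) (theta_mem _)) _) (base_mem _)))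

theorem subalgebra_sub_mem {S : Subalgebra ℝ (Fun U)} {F G : Fun U} (hF : F ∈ S) (hG : G ∈ S) :
    F - G ∈ S := by
  rw [sub_eq_add_neg]; exact add_mem hF (neg_mem hG)

theorem bracket_mem {F G : Fun U} (hF : F ∈ funcsO U) (hG : G ∈ funcsO U) :
    bracket e B F G ∈ funcsO U := by
  simp only [bracket, dR_inr_funcsO _ hF, dBeta_funcsO hF, dGamma_funcsO hF, zero_mul, sub_zero,
    add_zero]
  refine add_mem (add_mem (add_mem ?_ ?_) ?_) ?_
  · exact sum_mem fun a _ => sum_mem fun μ _ => subalgebra_sub_mem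
      (mul_mem (mul_mem (dP_mem _ hF) (base_mem _)) (dX_mem _ hG))
      (mul_mem (mul_mem (dX_mem _ hF) (base_mem _)) (dP_mem _ hG))
  · exact sum_mem fun a _ => sum_mem fun μ _ =>
      mul_mem (mul_mem (dP_mem _ hF) (bracketPP_mem e B _ _)) (dP_mem _ hG)
  · exact sum_mem fun a _ => sum_mem fun μ _ => subalgebra_sub_mem
      (mul_mem (mul_mem (dP_mem _ hF) (bracketPTheta_mem e _ _)) (dL_mem _ hG))
      (mul_mem (mul_mem (dR_mem _ hF) (bracketPTheta_mem e _ _)) (dP_mem _ hG))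
  · exact sum_mem fun a _ => Subalgebra.smul_mem _ (mul_mem (dR_mem _ hF) (dL_mem _ hG)) _

theorem bracket_mul_left {w F G : Fun U} (hX : ∀ μ, dX μ w = 0) (hP : ∀ a, dP a w = 0)
    (hL : ∀ a, dL (Sum.inl a) w = 0) (hG : G ∈ funcsO U) :
    bracket e B (w * F) G = w * bracket e B F G := by
  simp only [bracket, dL_inr_funcsO _ hG, dBeta_funcsO hG, dGamma_funcsO hG, mul_zero, sub_zero,
    add_zero, dR_eq, (isEvenDer_dX _).mul, (isEvenDer_dP _).mul, (isOddDer_dL _).mul, hX, hP, hL,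
    zero_mul, zero_add, map_mul, inv_inv, mul_add, Finset.mul_sum, mul_sub, mul_assoc,
    mul_smul_comm]

/-! ### The derivations `D = {π, -}` and `H = ½ {{π, π}, -}` -/

theorem dP_pi (a : Fin d) : dP a (piFn U) = theta a := by
  simp [piFn, (isEvenDer_dP a).mul, dP_mom]

theorem dX_pi (μ : Fin d) : dX μ (piFn U) = 0 := by
  simp [piFn, (isEvenDer_dX μ).mul]

theorem dL_pi (a : Fin d) : dL (Sum.inl a) (piFn U) = mom a := by
  simp [piFn, (isOddDer_dL _).mul, dL_theta]

theorem dR_pi (a : Fin d) : dR (Sum.inl a) (piFn U) = mom a := by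
  rw [dR_eq, dL_pi, inv_mom]

theorem pi_mem : piFn U ∈ funcsO U := sum_mem fun _ _ => mul_mem (mom_mem _) (theta_mem _)

@[simp] theorem inv_pi : inv (piFn U) = -piFn U := by simp [piFn]

/-- `R = {π, π}`. -/
def bigR : Fun U := bracket e B (piFn U) (piFn U)

theorem bigR_mem : bigR e B ∈ funcsO U := bracket_mem e B pi_mem pi_mem

/-- The odd derivation `D = {π, -}`. -/
def opD : Fun U →ₗ[ℝ] Fun U := ham e B (piFn U)

theorem opD_eq (F : Fun U) : opD e B F = bracket e B (piFn U) F := ham_apply e B _ _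

theorem isOddDer_opD : IsOddDer (opD e B) := isOddDer_ham e B inv_pi

theorem opD_pi : opD e B (piFn U) = bigR e B := opD_eq e B _

@[simp] theorem inv_bigR : inv (bigR e B) = bigR e B := by
  rw [← opD_pi, ← neg_inj, ← (isOddDer_opD e B).inv_apply, inv_pi, map_neg]

/-- The even derivation `H = ½ {{π, π}, -}`. -/
def opH : Fun U →ₗ[ℝ] Fun U := (1 / 2 : ℝ) • ham e B (bigR e B)

theorem opH_eq (F : Fun U) : opH e B F = (1 / 2 : ℝ) • bracket e B (bigR e B) F := by
  rw [← ham_apply]; rfl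

theorem isEvenDer_opH : IsEvenDer (opH e B) := (isEvenDer_ham e B (inv_bigR e B)).smul _

theorem opD_mem {F : Fun U} (hF : F ∈ funcsO U) : opD e B F ∈ funcsO U := by
  rw [opD_eq]; exact bracket_mem e B pi_mem hF

theorem opH_mem {F : Fun U} (hF : F ∈ funcsO U) : opH e B F ∈ funcsO U := by
  rw [opH_eq]; exact Subalgebra.smul_mem _ (bracket_mem e B (bigR_mem e B) hF) _

/-! ### The differential on generators -/

theorem inv_actionS : inv (actionS e B) = -actionS e B := by
  have h := inv_bigR e B
  rw [bigR] at h
  simp only [actionS, map_add, map_sub, map_smul, map_mul, map_pow, inv_gc, inv_gb, inv_ggamma,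
    inv_pi, h, neg_mul, mul_neg, smul_neg]
  abel

theorem Q_eq_ham : Q e B = ham e B (actionS e B) := LinearMap.ext fun F => (ham_apply e B _ F).symm

theorem isOddDer_Q : IsOddDer (Q e B) := Q_eq_ham e B ▸ isOddDer_ham e B (inv_actionS e B)

theorem ggamma_comm (F : Fun U) : ggamma * F = F * ggamma := mono_comm 0 1 F
theorem gbeta_comm (F : Fun U) : gbeta * F = F * gbeta := mono_comm 1 0 F

/-- `Q F = γ {π, F} + ½ c {{π, π}, F}` for a function `F` of `x, p, θ`. -/
theorem Q_funcsO {F : Fun U} (hF : F ∈ funcsO U) :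
    Q e B F = ggamma * opD e B F + gc * opH e B F := by
  have h1 : bracket e B (ggamma ^ 2 * gb) F = 0 := by
    have h : bracket e B (1 : Fun U) F = 0 := by
      simp [bracket, dL_inr_funcsO _ hF, (isEvenDer_dX _).one, (isEvenDer_dP _).one, dR_eq,
        (isOddDer_dL _).one, isEvenDer_dBeta.one, isEvenDer_dGamma.one]
    rw [← mul_one (ggamma ^ 2 * gb), bracket_mul_left e B _ _ _ hF, h, mul_zero] <;>
      simp [pow_two, (isEvenDer_dX _).mul, (isEvenDer_dP _).mul, (isOddDer_dL _).mul]
  change bracket e B (actionS e B) F = _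
  rw [actionS, bracket_sub_left, h1, sub_zero, bracket_add_left, bracket_smul_left,
    bracket_mul_left e B (by simp) (by simp) (by simp) hF,
    bracket_mul_left e B (by simp) (by simp) (by simp) hF, opD_eq, opH_eq, mul_smul_comm, add_comm,
    bigR]

theorem Q_gc : Q e B gc = -(ggamma ^ 2) := by
  have h1 : dL (Sum.inr 0) (actionS e B) = -(ggamma ^ 2) := by
    have h := dL_inr_funcsO 0 (bigR_mem e B)
    rw [bigR] at h
    simp [actionS, (isOddDer_dL _).mul, h, dL_inr_funcsO _ pi_mem, pow_two]
  change bracket e B (actionS e B) gc = _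
  simp [bracket, dR_eq, h1]

theorem Q_gb : Q e B gb = (1 / 2 : ℝ) • bigR e B := by
  have h1 : dL (Sum.inr 1) (actionS e B) = (1 / 2 : ℝ) • bigR e B := by
    have h := dL_inr_funcsO 1 (bigR_mem e B)
    rw [bigR] at h
    simp [actionS, (isOddDer_dL _).mul, h, dL_inr_funcsO _ pi_mem, pow_two, bigR]
  change bracket e B (actionS e B) gb = _
  simp [bracket, dR_eq, h1]

theorem Q_mono_zero (n : ℤ) : Q e B (mono 0 n) = 0 := by
  have h1 : dBeta (actionS e B) = 0 := by
    have h := dBeta_funcsO (bigR_mem e B)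
    rw [bigR] at h
    simp [actionS, isEvenDer_dBeta.mul, h, dBeta_funcsO pi_mem, pow_two]
  change bracket e B (actionS e B) (mono 0 n) = _
  simp [bracket, h1]

theorem Q_ggamma : Q e B ggamma = 0 := Q_mono_zero e B 1
theorem Q_gammaInv : Q e B gammaInv = 0 := Q_mono_zero e B (-1)

theorem Q_gbeta : Q e B gbeta = -piFn U + (2 : ℝ) • (ggamma * gb) := by
  have h1 : dGamma (actionS e B) = piFn U - (2 : ℝ) • (ggamma * gb) := by
    have h := dGamma_funcsO (bigR_mem e B)
    rw [bigR] at h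
    simp [actionS, isEvenDer_dGamma.mul, h, dGamma_funcsO pi_mem, pow_two, add_mul, two_smul]
  change bracket e B (actionS e B) gbeta = _
  simp only [bracket, dX_gbeta, dP_gbeta, dL_gbeta, mul_zero, sub_zero, dGamma_gbeta, dBeta_gbeta,
    h1, Finset.sum_const_zero, smul_zero, add_zero, zero_add, mul_one, zero_sub, neg_sub]
  abel

end Hamiltonian

/-! ### Canonical momenta -/

/-- The quadratic form `M_{ij} θ^i θ^j`. -/
def thetaForm (M : Fin d → Fin d → SmoothFn U) : Fun U := ∑ i, ∑ j, base (M i j) * theta i * theta j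

/-- The linear form `v_i θ^i`. -/
def thetaLin (v : Fin d → SmoothFn U) : Fun U := ∑ i, base (v i) * theta i

/-- The linear form `v_i p_i`. -/
def momLin (v : Fin d → SmoothFn U) : Fun U := ∑ i, base (v i) * mom i

theorem thetaForm_add (M N : Fin d → Fin d → SmoothFn U) :
    thetaForm (fun i j => M i j + N i j) = thetaForm M + thetaForm N := by
  simp [thetaForm, base_add, add_mul, Finset.sum_add_distrib]

theorem thetaForm_sub (M N : Fin d → Fin d → SmoothFn U) :
    thetaForm (fun i j => M i j - N i j) = thetaForm M - thetaForm N := by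
  simp [thetaForm, base_sub, sub_mul, Finset.sum_sub_distrib]

theorem thetaForm_sum {ι : Type*} (s : Finset ι) (M : ι → Fin d → Fin d → SmoothFn U) :
    thetaForm (fun i j => ∑ k ∈ s, M k i j) = ∑ k ∈ s, thetaForm (M k) := by
  simp only [thetaForm, base_sum, Finset.sum_mul]
  rw [Finset.sum_comm]
  conv_rhs => rw [Finset.sum_comm]
  rw [Finset.sum_comm]
  exact Finset.sum_congr rfl fun i _ => Finset.sum_comm

theorem thetaForm_swap (M : Fin d → Fin d → SmoothFn U) :
    thetaForm (fun i j => M j i) = -thetaForm M := by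
  rw [thetaForm, Finset.sum_comm, thetaForm, ← Finset.sum_neg_distrib]
  refine Finset.sum_congr rfl fun i _ => ?_
  rw [← Finset.sum_neg_distrib]
  refine Finset.sum_congr rfl fun j _ => ?_
  rw [mul_assoc, mul_assoc, theta_anticomm, mul_neg]

theorem thetaLin_mul (v w : Fin d → SmoothFn U) :
    thetaLin v * thetaLin w = thetaForm fun i j => v i * w j := by
  rw [thetaLin, thetaLin, Finset.sum_mul_sum]
  refine Finset.sum_congr rfl fun i _ => Finset.sum_congr rfl fun j _ => ?_
  rw [base_mul, mul_assoc, ← mul_assoc (theta i), ← base_comm]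
  simp only [mul_assoc]

theorem thetaLin_neg (v : Fin d → SmoothFn U) : thetaLin (fun i => -v i) = -thetaLin v := by
  simp [thetaLin, base_neg]

theorem momLin_add (v w : Fin d → SmoothFn U) :
    momLin (fun i => v i + w i) = momLin v + momLin w := by
  simp [momLin, base_add, add_mul, Finset.sum_add_distrib]

theorem momLin_sub (v w : Fin d → SmoothFn U) :
    momLin (fun i => v i - w i) = momLin v - momLin w := by
  simp [momLin, base_sub, sub_mul, Finset.sum_sub_distrib]

theorem dX_thetaForm (μ : Fin d) (M : Fin d → Fin d → SmoothFn U) :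
    dX μ (thetaForm M) = thetaForm fun i j => pd μ (M i j) := by
  simp [thetaForm, (isEvenDer_dX μ).mul]

theorem dX_momLin (μ : Fin d) (v : Fin d → SmoothFn U) :
    dX μ (momLin v) = momLin fun i => pd μ (v i) := by
  simp [momLin, (isEvenDer_dX μ).mul]

theorem dP_thetaForm (a : Fin d) (M : Fin d → Fin d → SmoothFn U) :
    dP a (thetaForm M) = 0 := by
  simp [thetaForm, (isEvenDer_dP a).mul]

theorem dP_momLin (a : Fin d) (v : Fin d → SmoothFn U) : dP a (momLin v) = base (v a) := by
  simp [momLin, (isEvenDer_dP a).mul, dP_mom]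

theorem dL_momLin (i : Odd d) (v : Fin d → SmoothFn U) : dL i (momLin v) = 0 := by
  simp [momLin, (isOddDer_dL i).mul]

theorem dL_thetaForm (a : Fin d) (M : Fin d → Fin d → SmoothFn U) :
    dL (Sum.inl a) (thetaForm M) = thetaLin (M a) - thetaLin fun i => M i a := by
  simp [thetaForm, thetaLin, (isOddDer_dL _).mul, dL_theta, mul_ite, ite_mul,
    Finset.sum_add_distrib, sub_eq_add_neg]

section CanonicalMomenta

variable (e : Frame U)

/-- The momentum `P_μ = e^a_μ p_a - ¼ ω_{abμ} θ^a θ^b`, canonically conjugate to `x^μ`. -/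
def canMom (μ : Fin d) : Fun U :=
  momLin (fun a => e.1 a μ) - (1 / 4 : ℝ) • thetaForm fun a b => connection e a b μ

theorem inv_canMom (μ : Fin d) : inv (canMom e μ) = canMom e μ := by
  simp [canMom, momLin, thetaForm]

theorem coframe_frame_base (μ ν : Fin d) :
    ∑ a, base (coframe e μ a) * base (e.1 a ν) = (if μ = ν then 1 else 0 : Fun U) := by
  simp only [← base_mul]
  rw [← base_sum, coframe_frame]
  split_ifs
  · exact base_one
  · exact base_zero

theorem frame_coframe (a b : Fin d) :
    ∑ μ, e.1 a μ * coframe e μ b = if a = b then 1 else 0 := by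
  have h := congrFun (congrFun (Units.mul_inv e) a) b
  rw [Matrix.mul_apply, Matrix.one_apply] at h
  exact h

theorem frame_coframe_base (a b : Fin d) :
    ∑ μ, base (e.1 a μ) * base (coframe e μ b) = (if a = b then 1 else 0 : Fun U) := by
  simp only [← base_mul]
  rw [← base_sum, frame_coframe]
  split_ifs
  · exact base_one
  · exact base_zero

theorem dP_canMom (a μ : Fin d) : dP a (canMom e μ) = base (e.1 a μ) := by
  rw [canMom, map_sub, map_smul, dP_momLin, dP_thetaForm, smul_zero, sub_zero]

theorem dL_canMom (a μ : Fin d) :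
    dL (Sum.inl a) (canMom e μ) = -((1 / 2 : ℝ) • thetaLin fun b => connection e a b μ) := by
  have h : (fun i => connection e i a μ) = fun i => -connection e a i μ :=
    funext fun i => connection_antisymm e i a μ
  rw [canMom, map_sub, map_smul, dL_momLin, dL_thetaForm, h, thetaLin_neg]
  module

/-- `∂/∂P_μ` in the coordinates `x, P, θ`. -/
def derP (μ : Fin d) : Fun U →ₗ[ℝ] Fun U := ∑ a, LinearMap.mulLeft ℝ (base (coframe e μ a)) ∘ₗ dP a

/-- `∂/∂x^μ` in the coordinates `x, P, θ`. -/
def derX (μ : Fin d) : Fun U →ₗ[ℝ] Fun U :=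
  dX μ - ∑ ν, LinearMap.mulLeft ℝ (dX μ (canMom e ν)) ∘ₗ derP e ν

/-- `∂/∂θ^a` in the coordinates `x, P, θ`. -/
def derT (a : Fin d) : Fun U →ₗ[ℝ] Fun U :=
  dL (Sum.inl a) - ∑ ν, LinearMap.mulLeft ℝ (dL (Sum.inl a) (canMom e ν)) ∘ₗ derP e ν

theorem derP_apply (μ : Fin d) (F : Fun U) :
    derP e μ F = ∑ a, base (coframe e μ a) * dP a F := by
  simp [derP, LinearMap.sum_apply]

theorem derX_apply (μ : Fin d) (F : Fun U) :
    derX e μ F = dX μ F - ∑ ν, dX μ (canMom e ν) * derP e ν F := by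
  simp [derX, LinearMap.sum_apply]

theorem derT_apply (a : Fin d) (F : Fun U) :
    derT e a F = dL (Sum.inl a) F - ∑ ν, dL (Sum.inl a) (canMom e ν) * derP e ν F := by
  simp [derT, LinearMap.sum_apply]

theorem isEvenDer_derP (μ : Fin d) : IsEvenDer (derP e μ) :=
  .sum _ fun a => (isEvenDer_dP a).mulLeft (inv_base _)

theorem isEvenDer_derX (μ : Fin d) : IsEvenDer (derX e μ) :=
  (isEvenDer_dX μ).sub (.sum _ fun ν => (isEvenDer_derP e ν).mulLeft
    (by rw [← (isEvenDer_dX μ).inv_apply, inv_canMom]))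

theorem isOddDer_derT (a : Fin d) : IsOddDer (derT e a) :=
  (isOddDer_dL _).sub (.sum _ fun ν => (isEvenDer_derP e ν).mulLeft_odd
    (by rw [← neg_inj, neg_neg, ← dL_inv, inv_canMom]))

@[simp] theorem derP_base (μ : Fin d) (g : SmoothFn U) : derP e μ (base g) = 0 := by
  simp [derP_apply]
@[simp] theorem derP_theta (μ a : Fin d) : derP e μ (theta a) = 0 := by simp [derP_apply]
theorem derP_canMom (μ ν : Fin d) : derP e μ (canMom e ν) = if μ = ν then 1 else 0 := by
  simp only [derP_apply, dP_canMom, coframe_frame_base]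
@[simp] theorem derX_base (μ : Fin d) (g : SmoothFn U) : derX e μ (base g) = base (pd μ g) := by
  simp [derX_apply]
@[simp] theorem derX_theta (μ a : Fin d) : derX e μ (theta a) = 0 := by simp [derX_apply]
@[simp] theorem derX_canMom (μ ν : Fin d) : derX e μ (canMom e ν) = 0 := by
  simp [derX_apply, derP_canMom]
@[simp] theorem derT_base (a : Fin d) (g : SmoothFn U) : derT e a (base g) = 0 := by
  simp [derT_apply]
theorem derT_theta (a b : Fin d) : derT e a (theta b) = if a = b then 1 else 0 := by
  simp [derT_apply, dL_theta]
@[simp] theorem derT_canMom (a ν : Fin d) : derT e a (canMom e ν) = 0 := by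
  simp [derT_apply, derP_canMom]

/-- The generators `x, θ, P` of the functions polynomial in the momenta. -/
def canGens : Set (Fun U) := Set.range base ∪ Set.range theta ∪ Set.range (canMom e)

/-- The subalgebra of functions polynomial in the momenta. -/
def canAlg : Subalgebra ℝ (Fun U) := Algebra.adjoin ℝ (canGens e)

theorem base_mem_can (g : SmoothFn U) : base g ∈ canAlg e :=
  Algebra.subset_adjoin (Or.inl (Or.inl ⟨g, rfl⟩))
theorem theta_mem_can (a : Fin d) : theta a ∈ canAlg e :=
  Algebra.subset_adjoin (Or.inl (Or.inr ⟨a, rfl⟩))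
theorem canMom_mem_can (μ : Fin d) : canMom e μ ∈ canAlg e :=
  Algebra.subset_adjoin (Or.inr ⟨μ, rfl⟩)

theorem ite_mem_can (p : Prop) [Decidable p] : (if p then 1 else 0 : Fun U) ∈ canAlg e := by
  split_ifs
  · exact one_mem _
  · exact zero_mem _

theorem mom_mem_can (a : Fin d) : mom a ∈ canAlg e := by
  have h : (mom a : Fun U) = ∑ ν, base (coframe e ν a) *
      (canMom e ν + (1 / 4 : ℝ) • thetaForm fun a b => connection e a b ν) := by
    simp only [canMom, sub_add_cancel, momLin, Finset.mul_sum, ← mul_assoc]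
    rw [Finset.sum_comm]
    simp only [← Finset.sum_mul, base_comm (coframe e _ a), frame_coframe_base]
    simp
  rw [h]
  refine sum_mem fun ν _ => mul_mem (base_mem_can e _) (add_mem (canMom_mem_can e ν)
    (Subalgebra.smul_mem _ (sum_mem fun i _ => sum_mem fun j _ => ?_) _))
  exact mul_mem (mul_mem (base_mem_can e _) (theta_mem_can e i)) (theta_mem_can e j)

theorem pi_mem_can : piFn U ∈ canAlg e :=
  sum_mem fun a _ => mul_mem (mom_mem_can e a) (theta_mem_can e a)

theorem derP_mem_can (μ : Fin d) {F : Fun U} (hF : F ∈ canAlg e) : derP e μ F ∈ canAlg e := by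
  refine (isEvenDer_derP e μ).mem_adjoin ?_ hF
  rintro _ ((⟨g, rfl⟩ | ⟨a, rfl⟩) | ⟨ν, rfl⟩)
  · rw [derP_base]; exact zero_mem _
  · rw [derP_theta]; exact zero_mem _
  · rw [derP_canMom]; exact ite_mem_can e _

theorem derX_mem_can (μ : Fin d) {F : Fun U} (hF : F ∈ canAlg e) : derX e μ F ∈ canAlg e := by
  refine (isEvenDer_derX e μ).mem_adjoin ?_ hF
  rintro _ ((⟨g, rfl⟩ | ⟨a, rfl⟩) | ⟨ν, rfl⟩)
  · rw [derX_base]; exact base_mem_can e _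
  · rw [derX_theta]; exact zero_mem _
  · rw [derX_canMom]; exact zero_mem _

theorem canGens_parity {F : Fun U} (hF : F ∈ canGens e) : inv F = F ∨ inv F = -F := by
  rcases hF with ((⟨g, rfl⟩ | ⟨a, rfl⟩) | ⟨ν, rfl⟩)
  · exact Or.inl (inv_base g)
  · exact Or.inr (inv_theta a)
  · exact Or.inl (inv_canMom e ν)

theorem derT_mem_can (a : Fin d) {F : Fun U} (hF : F ∈ canAlg e) : derT e a F ∈ canAlg e := by
  refine (isOddDer_derT e a).mem_adjoin (fun _ => canGens_parity e) ?_ hF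
  rintro _ ((⟨g, rfl⟩ | ⟨a, rfl⟩) | ⟨ν, rfl⟩)
  · rw [derT_base]; exact zero_mem _
  · rw [derT_theta]; exact ite_mem_can e _
  · rw [derT_canMom]; exact zero_mem _

/-! ### Commuting partial derivatives in the coordinates `x, P, θ` -/

theorem apply_ite_one {D : Fun U →ₗ[ℝ] Fun U} (h : D 1 = 0) (p : Prop) [Decidable p] :
    D (if p then 1 else 0) = 0 := by
  split_ifs
  · exact h
  · exact map_zero D

theorem derX_derX (μ ν : Fin d) {F : Fun U} (hF : F ∈ canAlg e) :
    derX e μ (derX e ν F) = derX e ν (derX e μ F) := by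
  refine sub_eq_zero.1 (((isEvenDer_derX e μ).comm (isEvenDer_derX e ν)).ext_adjoin .zero ?_ hF)
  rintro _ ((⟨g, rfl⟩ | ⟨a, rfl⟩) | ⟨ν, rfl⟩) <;> simp [pd_comm μ ν]

theorem derX_derP (μ ν : Fin d) {F : Fun U} (hF : F ∈ canAlg e) :
    derX e μ (derP e ν F) = derP e ν (derX e μ F) := by
  refine sub_eq_zero.1 (((isEvenDer_derX e μ).comm (isEvenDer_derP e ν)).ext_adjoin .zero ?_ hF)
  rintro _ ((⟨g, rfl⟩ | ⟨a, rfl⟩) | ⟨ν, rfl⟩) <;>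
    simp [derP_canMom, apply_ite_one (isEvenDer_derX e _).one]

theorem derX_derT (μ a : Fin d) {F : Fun U} (hF : F ∈ canAlg e) :
    derX e μ (derT e a F) = derT e a (derX e μ F) := by
  refine sub_eq_zero.1 (((isEvenDer_derX e μ).comm_odd (isOddDer_derT e a)).ext_adjoin .zero ?_ hF)
  rintro _ ((⟨g, rfl⟩ | ⟨a, rfl⟩) | ⟨ν, rfl⟩) <;>
    simp [derT_theta, apply_ite_one (isEvenDer_derX e _).one]

theorem derP_derT (μ a : Fin d) {F : Fun U} (hF : F ∈ canAlg e) :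
    derP e μ (derT e a F) = derT e a (derP e μ F) := by
  refine sub_eq_zero.1 (((isEvenDer_derP e μ).comm_odd (isOddDer_derT e a)).ext_adjoin .zero ?_ hF)
  rintro _ ((⟨g, rfl⟩ | ⟨a, rfl⟩) | ⟨ν, rfl⟩) <;>
    simp [derT_theta, derP_canMom, apply_ite_one (isEvenDer_derP e _).one,
      apply_ite_one (isOddDer_derT e _).one]

theorem derT_derT (a b : Fin d) {F : Fun U} (hF : F ∈ canAlg e) :
    derT e a (derT e b F) = -derT e b (derT e a F) := by
  refine eq_neg_of_add_eq_zero_left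
    (((isOddDer_derT e a).comm (isOddDer_derT e b)).ext_adjoin .zero ?_ hF)
  rintro _ ((⟨g, rfl⟩ | ⟨a, rfl⟩) | ⟨ν, rfl⟩) <;>
    simp [derT_theta, apply_ite_one (isOddDer_derT e _).one]

/-! ### Brackets with the coordinates `x, P, θ` -/

variable (B : Matrix (Fin d) (Fin d) (SmoothFn U))

theorem bracket_base (F : Fun U) (g : SmoothFn U) :
    bracket e B F (base g) = ∑ μ, derP e μ F * base (pd μ g) := by
  simp only [bracket, dX_base, dP_base, dL_base, dGamma_base, dBeta_base, mul_zero, sub_zero,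
    add_zero, Finset.sum_const_zero, smul_zero, derP_apply, Finset.sum_mul, base_comm (coframe e _ _)]
  exact Finset.sum_comm

theorem bracketPTheta_eq (a b : Fin d) :
    bracketPTheta e a b = ∑ μ, base (coframe e μ a) * ((2 : ℝ) • dL (Sum.inl b) (canMom e μ)) := by
  simp only [bracketPTheta, dL_canMom, smul_neg, smul_smul, mul_neg, Finset.sum_neg_distrib]
  norm_num [thetaLin, Finset.mul_sum, base_mul, mul_assoc]

theorem bracket_theta (F : Fun U) (b : Fin d) :
    bracket e B F (theta b) = (2 : ℝ) • (dR (Sum.inl b) F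
      + ∑ μ, derP e μ F * dL (Sum.inl b) (canMom e μ)) := by
  have h : ∑ a, dP a F * bracketPTheta e a b
      = (2 : ℝ) • ∑ μ, derP e μ F * dL (Sum.inl b) (canMom e μ) := by
    simp only [bracketPTheta_eq, derP_apply, Finset.mul_sum, Finset.sum_mul, Finset.smul_sum,
      mul_smul_comm]
    rw [Finset.sum_comm]
    refine Finset.sum_congr rfl fun μ _ => Finset.sum_congr rfl fun a _ => ?_
    rw [← mul_assoc, base_comm]
  simp only [bracket, dX_theta, dP_theta, dL_inr_theta, dGamma_theta, dBeta_theta, mul_zero,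
    sub_zero, add_zero, zero_add, Finset.sum_const_zero, dL_theta, mul_ite, mul_one,
    Finset.sum_ite_eq', Finset.mem_univ, if_true, h, smul_add, ← Finset.smul_sum]
  rw [add_comm]

/-- Cartan's first structure equation and the formula for the curvature, as one identity between
the derivatives of the canonical momenta. It says that the brackets `{P_ν, P_μ}` contain neither
torsion nor curvature. -/
theorem curvature_identity (μ ν : Fin d) :
    dX ν (canMom e μ) - dX μ (canMom e ν)
      + momLin (fun c => ∑ b, (connection e c b ν * e.1 b μ - connection e c b μ * e.1 b ν))
      + (1 / 4 : ℝ) • thetaForm (fun i j => curvature e i j ν μ)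
      + (2 : ℝ) • ∑ b, dL (Sum.inl b) (canMom e ν) * dL (Sum.inl b) (canMom e μ) = 0 := by
  have hp : momLin (fun c => pd ν (e.1 c μ)) - momLin (fun c => pd μ (e.1 c ν))
      + momLin (fun c => ∑ b, (connection e c b ν * e.1 b μ - connection e c b μ * e.1 b ν)) = 0 := by
    rw [← momLin_sub, ← momLin_add]
    have h : ∀ c, pd ν (e.1 c μ) - pd μ (e.1 c ν)
        + ∑ b, (connection e c b ν * e.1 b μ - connection e c b μ * e.1 b ν) = 0 :=
      fun c => cartan_first e c ν μ
    simp only [h, momLin, base_zero, zero_mul, Finset.sum_const_zero]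
  have hsq : ∑ b, dL (Sum.inl b) (canMom e ν) * dL (Sum.inl b) (canMom e μ)
      = -((1 / 4 : ℝ) • thetaForm fun i j => ∑ c, connection e i c ν * connection e c j μ) := by
    rw [thetaForm_sum, Finset.smul_sum, ← Finset.sum_neg_distrib]
    refine Finset.sum_congr rfl fun b _ => ?_
    have h : (fun i => connection e b i ν) = fun i => -connection e i b ν :=
      funext fun i => connection_antisymm e b i ν
    rw [dL_canMom, dL_canMom, h, thetaLin_neg]
    simp only [smul_neg, neg_neg, mul_neg, smul_mul_assoc, mul_smul_comm, smul_smul, thetaLin_mul]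
    norm_num
  have hc : thetaForm (fun i j => curvature e i j ν μ)
      = thetaForm (fun i j => pd ν (connection e i j μ)) - thetaForm (fun i j => pd μ (connection e i j ν))
        + (2 : ℝ) • thetaForm (fun i j => ∑ c, connection e i c ν * connection e c j μ) := by
    have h : (fun i j => ∑ c, connection e i c μ * connection e c j ν)
        = fun i j => ∑ c, connection e j c ν * connection e c i μ := by
      funext i j
      refine Finset.sum_congr rfl fun c _ => ?_
      rw [connection_antisymm e i c μ, connection_antisymm e c j ν]
      ring
    simp only [curvature, Finset.sum_sub_distrib]
    rw [thetaForm_add, thetaForm_sub, thetaForm_sub, h,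
      thetaForm_swap fun i j => ∑ c, connection e i c ν * connection e c j μ]
    module
  rw [hsq, hc, canMom, canMom, map_sub, map_sub, map_smul, map_smul, dX_momLin, dX_momLin,
    dX_thetaForm, dX_thetaForm]
  rw [← hp]
  module

end CanonicalMomenta

section CanonicalBrackets

/-! ### The bracket with the canonical momenta -/

variable (e : Frame U) (B : Matrix (Fin d) (Fin d) (SmoothFn U))

theorem sum_connection_coframe (a c μ : Fin d) :
    ∑ b, ∑ ρ, (coframe e ρ a * connection e c b ρ - coframe e ρ b * connection e c a ρ) * e.1 b μ
      = ∑ ν, coframe e ν a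
        * ∑ b, (connection e c b ν * e.1 b μ - connection e c b μ * e.1 b ν) := by
  have h1 : ∑ b, ∑ ρ, coframe e ρ b * connection e c a ρ * e.1 b μ = connection e c a μ := by
    rw [Finset.sum_comm]
    have h : ∀ ρ, ∑ b, coframe e ρ b * connection e c a ρ * e.1 b μ
        = connection e c a ρ * ∑ b, coframe e ρ b * e.1 b μ := fun ρ => by
      rw [Finset.mul_sum]; exact Finset.sum_congr rfl fun b _ => by ring
    simp [h, coframe_frame]
  have h2 : ∑ ν, ∑ b, coframe e ν a * (connection e c b μ * e.1 b ν) = connection e c a μ := by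
    rw [Finset.sum_comm]
    have h : ∀ b, ∑ ν, coframe e ν a * (connection e c b μ * e.1 b ν)
        = connection e c b μ * ∑ ν, e.1 b ν * coframe e ν a := fun b => by
      rw [Finset.mul_sum]; exact Finset.sum_congr rfl fun ν _ => by ring
    simp [h, frame_coframe]
  simp only [sub_mul, Finset.sum_sub_distrib, mul_sub, Finset.mul_sum, h1, h2]
  rw [Finset.sum_comm]
  simp only [mul_assoc]

theorem base_mul_base_right (f h : SmoothFn U) (F : Fun U) :
    base f * F * base h = base f * base h * F := by
  rw [mul_assoc, ← base_comm h, mul_assoc]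

theorem base_mul_rearrange (f g h : SmoothFn U) (F : Fun U) :
    base (f * g) * F * base h = base g * base h * (base f * F) := by
  rw [base_mul_base_right, ← base_mul, ← base_mul, ← mul_assoc, ← base_mul]
  congr 2
  ring

/-- The brackets `{p_a, p_b}` contracted with the moving frame: the second index becomes a
coordinate index. -/
theorem sum_bracketPP (a μ : Fin d) :
    ∑ b, bracketPP e B a b * base (e.1 b μ) = ∑ ν, base (coframe e ν a) *
      (momLin (fun c => ∑ b, (connection e c b ν * e.1 b μ - connection e c b μ * e.1 b ν))
        + (1 / 4 : ℝ) • thetaForm (fun i j => curvature e i j ν μ) + base (B ν μ)) := by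
  have hR : ∀ F G G' G'' : Fun U, F * (G + G' + G'') = F * G + F * (G' + G'') := fun F G G' G'' => by
    rw [add_assoc, mul_add]
  simp only [bracketPP, add_mul, Finset.sum_add_distrib, hR]
  congr 1
  · have h : ∀ c, ∑ b, (∑ ρ, base (coframe e ρ a * connection e c b ρ
          - coframe e ρ b * connection e c a ρ)) * mom c * base (e.1 b μ)
        = ∑ ν, base (coframe e ν a) * (base (∑ b, (connection e c b ν * e.1 b μ
          - connection e c b μ * e.1 b ν)) * mom c) := by
      intro c
      simp only [← mul_assoc, ← base_mul]
      rw [← Finset.sum_mul, ← base_sum, ← sum_connection_coframe, base_sum, Finset.sum_mul]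
      refine Finset.sum_congr rfl fun b _ => ?_
      rw [mul_assoc, mom_comm, ← mul_assoc, ← base_sum, ← base_mul, Finset.sum_mul]
    simp only [Finset.sum_mul, momLin, Finset.mul_sum] at h ⊢
    rw [Finset.sum_comm]
    conv_rhs => rw [Finset.sum_comm]
    exact Finset.sum_congr rfl fun c _ => h c
  · have h : ∀ ρ σ, ∑ b, base (coframe e ρ a * coframe e σ b) * ((1 / 4 : ℝ) •
          (∑ i, ∑ j, base (curvature e i j ρ σ) * theta i * theta j) + base (B ρ σ))
            * base (e.1 b μ)
        = if σ = μ then base (coframe e ρ a) * ((1 / 4 : ℝ) •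
          thetaForm (fun i j => curvature e i j ρ σ) + base (B ρ σ)) else 0 := by
      intro ρ σ
      have h' : ∀ b, base (coframe e ρ a * coframe e σ b) * ((1 / 4 : ℝ) •
          (∑ i, ∑ j, base (curvature e i j ρ σ) * theta i * theta j) + base (B ρ σ))
            * base (e.1 b μ)
          = base (coframe e σ b) * base (e.1 b μ) * (base (coframe e ρ a) * ((1 / 4 : ℝ) •
          thetaForm (fun i j => curvature e i j ρ σ) + base (B ρ σ))) := by
        exact fun b => base_mul_rearrange _ _ _ _
      simp only [h']
      rw [← Finset.sum_mul, coframe_frame_base, ite_mul, one_mul, zero_mul]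
    simp only [Finset.sum_mul] at h ⊢
    rw [Finset.sum_comm]
    refine Finset.sum_congr rfl fun ρ _ => ?_
    rw [Finset.sum_comm]
    simp only [h, Finset.sum_ite_eq', Finset.mem_univ, if_true]

/-- Up to the field strength `B`, the coordinates `x`, `P` are canonically conjugate: the curvature
and torsion terms in `{p_a, p_b}` and `{p_a, θ^b}` are absorbed by the change of momenta. -/
theorem bracket_canMom (F : Fun U) (μ : Fin d) :
    bracket e B F (canMom e μ) = -derX e μ F + ∑ ν, derP e ν F * base (B ν μ) := by
  have hT : ∀ b, ∑ a, bracketPTheta e a b * base (e.1 a μ)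
      = (2 : ℝ) • dL (Sum.inl b) (canMom e μ) := by
    intro b
    simp only [bracketPTheta_eq, Finset.sum_mul]
    rw [Finset.sum_comm]
    have h : ∀ ν, ∑ a, base (coframe e ν a) * ((2 : ℝ) • dL (Sum.inl b) (canMom e ν))
          * base (e.1 a μ)
        = if ν = μ then (2 : ℝ) • dL (Sum.inl b) (canMom e ν) else 0 := by
      intro ν
      simp only [base_mul_base_right]
      rw [← Finset.sum_mul, coframe_frame_base, ite_mul, one_mul, zero_mul]
    simp only [h, Finset.sum_ite_eq', Finset.mem_univ, if_true]
  have hK : ∀ a, ∑ ν, base (coframe e ν a) * dX ν (canMom e μ)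
      + ∑ b, bracketPP e B a b * base (e.1 b μ)
      + ∑ b, bracketPTheta e a b * dL (Sum.inl b) (canMom e μ)
      = ∑ ν, base (coframe e ν a) * (dX μ (canMom e ν) + base (B ν μ)) := by
    intro a
    have h : ∑ b, bracketPTheta e a b * dL (Sum.inl b) (canMom e μ)
        = ∑ ν, base (coframe e ν a)
          * ((2 : ℝ) • ∑ b, dL (Sum.inl b) (canMom e ν) * dL (Sum.inl b) (canMom e μ)) := by
      simp only [bracketPTheta_eq, Finset.sum_mul, Finset.smul_sum, Finset.mul_sum, mul_assoc,
        smul_mul_assoc]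
      exact Finset.sum_comm
    rw [sum_bracketPP, h, ← Finset.sum_add_distrib, ← Finset.sum_add_distrib]
    refine Finset.sum_congr rfl fun ν _ => ?_
    rw [← mul_add, ← mul_add]
    congr 1
    rw [← sub_eq_zero, ← curvature_identity e μ ν]
    abel
  have hX : ∑ a, ∑ ν, dX ν F * base (coframe e ν a) * base (e.1 a μ) = dX μ F := by
    rw [Finset.sum_comm]
    simp only [mul_assoc, ← Finset.mul_sum, coframe_frame_base]
    simp
  have h1 : ∑ a, ∑ b, dR (Sum.inl b) F * bracketPTheta e a b * base (e.1 a μ)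
      = ∑ a, (2 : ℝ) • (dR (Sum.inl a) F * dL (Sum.inl a) (canMom e μ)) := by
    rw [Finset.sum_comm]
    simp only [mul_assoc, ← Finset.mul_sum, hT, mul_smul_comm]
  have h2 : ∑ a, dP a F * (∑ ν, base (coframe e ν a) * dX ν (canMom e μ)
        + ∑ b, bracketPP e B a b * base (e.1 b μ)
        + ∑ b, bracketPTheta e a b * dL (Sum.inl b) (canMom e μ))
      = ∑ ν, derP e ν F * (dX μ (canMom e ν) + base (B ν μ)) := by
    simp only [hK, derP_apply, Finset.mul_sum, Finset.sum_mul, base_comm (coframe e _ _) (dP _ F),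
      mul_assoc]
    exact Finset.sum_comm
  have h3 : ∑ ν, dX μ (canMom e ν) * derP e ν F = ∑ ν, derP e ν F * dX μ (canMom e ν) :=
    Finset.sum_congr rfl fun ν _ => even_comm
      (by rw [← (isEvenDer_dX μ).inv_apply, inv_canMom]) _
  have h4 : (canMom e μ) ∈ funcsO U :=
    subalgebra_sub_mem (sum_mem fun _ _ => mul_mem (base_mem _) (mom_mem _))
      (Subalgebra.smul_mem _ (sum_mem fun _ _ => sum_mem fun _ _ =>
        mul_mem (mul_mem (base_mem _) (theta_mem _)) (theta_mem _)) _)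
  simp only [bracket, dL_inr_funcsO _ h4, dBeta_funcsO h4, dGamma_funcsO h4, mul_zero, sub_zero,
    add_zero, dP_canMom, Finset.sum_sub_distrib, hX, h1]
  rw [derX_apply, h3]
  simp only [mul_add, Finset.sum_add_distrib, Finset.mul_sum, ← mul_assoc] at h2 ⊢
  have h5 : ∀ x y z w u v t : Fun U, x + y + z = w + v → x - t + y + (z - u) + u = -(t - w) + v := by
    intro x y z w u v t h
    rw [show x - t + y + (z - u) + u = x + y + z - t by abel, h]
    abel
  exact h5 _ _ _ _ _ _ _ h2

/-- The value of `{F, -}` on a function of `x` and `p`. -/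
theorem bracket_fn (F : Fun U) (g : SmoothFn (cotangent U)) :
    bracket e B F (fn g) = ∑ μ, derP e μ F * dX μ (fn g)
      + ∑ a, bracket e B F (mom a) * dP a (fn g) := by
  have h1 : ∀ a, bracket e B F (mom a) = -∑ μ, dX μ F * base (coframe e μ a)
      + ∑ b, dP b F * bracketPP e B b a - ∑ b, dR (Sum.inl b) F * bracketPTheta e a b := by
    intro a
    simp only [bracket, dX_mom, dP_mom, dL_mom, dGamma_mom, dBeta_mom, mul_zero, sub_zero, zero_sub,
      add_zero, Finset.sum_const_zero, smul_zero, mul_ite, mul_one, Finset.sum_neg_distrib]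
    rw [Finset.sum_comm]
    simp only [Finset.sum_ite_eq', Finset.mem_univ, if_true]
    rw [Finset.sum_comm (f := fun x x_1 => if x = a then dR (Sum.inl x_1) F * bracketPTheta e x x_1
      else 0)]
    simp only [Finset.sum_ite_eq', Finset.mem_univ, if_true, sub_eq_add_neg]
  have h2 : ∑ a, ∑ b, dP a F * bracketPP e B a b * dP b (fn g)
      = ∑ b, ∑ a, dP a F * bracketPP e B a b * dP b (fn g) := Finset.sum_comm
  have h3 : ∑ a, ∑ μ, dP a F * base (coframe e μ a) * dX μ (fn g)
      = ∑ μ, ∑ a, dP a F * base (coframe e μ a) * dX μ (fn g) := Finset.sum_comm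
  simp only [h1]
  rw [bracket]
  simp only [dL_fn, dGamma_fn, dBeta_fn, mul_zero, sub_zero, zero_sub,
    add_zero, Finset.sum_const_zero, smul_zero, Finset.sum_sub_distrib, add_mul, sub_mul, neg_mul,
    Finset.sum_add_distrib, Finset.sum_neg_distrib, derP_apply, Finset.sum_mul, h2, h3,
    base_comm (coframe e _ _) (dP _ F)]
  abel

end CanonicalBrackets

/-! ### The Jacobi identity `{π, {π, F}} = ½ {{π, π}, F}` -/

section Jacobi

variable (e : Frame U) (B : Matrix (Fin d) (Fin d) (SmoothFn U))

/-- `∂π/∂P_μ`. -/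
def piP (μ : Fin d) : Fun U := derP e μ (piFn U)
/-- `∂π/∂x^μ` in the coordinates `x, P, θ`. -/
def piX (μ : Fin d) : Fun U := derX e μ (piFn U)
/-- `∂π/∂θ^a` in the coordinates `x, P, θ`. -/
def piT (a : Fin d) : Fun U := derT e a (piFn U)
/-- `{π, P_μ}`. -/
def dotP (μ : Fin d) : Fun U := -piX e μ + ∑ ν, piP e ν * base (B ν μ)

theorem piP_eq (μ : Fin d) : piP e μ = ∑ a, base (coframe e μ a) * theta a := by
  simp only [piP, derP_apply, dP_pi]

theorem inv_piP (μ : Fin d) : inv (piP e μ) = -piP e μ := by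
  rw [piP, ← (isEvenDer_derP e μ).inv_apply, inv_pi, map_neg]
theorem inv_piX (μ : Fin d) : inv (piX e μ) = -piX e μ := by
  rw [piX, ← (isEvenDer_derX e μ).inv_apply, inv_pi, map_neg]
theorem inv_piT (a : Fin d) : inv (piT e a) = piT e a := by
  rw [piT, ← neg_inj, ← (isOddDer_derT e a).inv_apply, inv_pi, map_neg]
theorem inv_dotP (μ : Fin d) : inv (dotP e B μ) = -dotP e B μ := by
  simp only [dotP, map_add, map_neg, map_sum, map_mul, inv_piX, inv_piP, inv_base, neg_mul,
    Finset.sum_neg_distrib]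
  abel

theorem piP_mem_can (μ : Fin d) : piP e μ ∈ canAlg e := derP_mem_can e μ (pi_mem_can e)
theorem piX_mem_can (μ : Fin d) : piX e μ ∈ canAlg e := derX_mem_can e μ (pi_mem_can e)
theorem piT_mem_can (a : Fin d) : piT e a ∈ canAlg e := derT_mem_can e a (pi_mem_can e)

theorem opD_base (g : SmoothFn U) : opD e B (base g) = ∑ μ, piP e μ * base (pd μ g) := by
  rw [opD_eq, bracket_base]; rfl

theorem opD_theta (a : Fin d) : opD e B (theta a) = (2 : ℝ) • piT e a := by
  rw [opD_eq, bracket_theta, piT, derT_apply, dR_pi, dL_pi, sub_eq_add_neg,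
    ← Finset.sum_neg_distrib]
  congr 2
  refine Finset.sum_congr rfl fun μ _ => odd_anticomm (inv_piP e μ) ?_
  rw [← neg_inj, ← dL_inv, inv_canMom, neg_neg]

theorem opD_canMom (μ : Fin d) : opD e B (canMom e μ) = dotP e B μ := by
  rw [opD_eq, bracket_canMom]; rfl

/-- `D = {π, -}` in the coordinates `x, P, θ`. -/
theorem opD_can {F : Fun U} (hF : F ∈ canAlg e) :
    opD e B F = ∑ μ, piP e μ * derX e μ F + ∑ μ, dotP e B μ * derP e μ F
      + ∑ a, (2 : ℝ) • (piT e a * derT e a F) := by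
  let D' : Fun U →ₗ[ℝ] Fun U := ∑ μ, LinearMap.mulLeft ℝ (piP e μ) ∘ₗ derX e μ
    + ∑ μ, LinearMap.mulLeft ℝ (dotP e B μ) ∘ₗ derP e μ
    + ∑ a, (2 : ℝ) • (LinearMap.mulLeft ℝ (piT e a) ∘ₗ derT e a)
  have hD' : ∀ F, D' F = ∑ μ, piP e μ * derX e μ F + ∑ μ, dotP e B μ * derP e μ F
      + ∑ a, (2 : ℝ) • (piT e a * derT e a F) := fun F => by
    simp [D', LinearMap.sum_apply]
  have h : IsOddDer D' := ((IsOddDer.sum _ fun μ => (isEvenDer_derX e μ).mulLeft_odd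
    (inv_piP e μ)).add (.sum _ fun μ => (isEvenDer_derP e μ).mulLeft_odd (inv_dotP e B μ))).add
    (.sum _ fun a => ((isOddDer_derT e a).mulLeft (inv_piT e a)).smul 2)
  rw [← hD']
  refine (isOddDer_opD e B).ext_adjoin h ?_ hF
  rintro _ ((⟨g, rfl⟩ | ⟨a, rfl⟩) | ⟨ν, rfl⟩)
  · rw [hD', opD_base]; simp
  · rw [hD', opD_theta]; simp [derT_theta]
  · rw [hD', opD_canMom]; simp [derP_canMom]

theorem derP_piP (μ ν : Fin d) : derP e μ (piP e ν) = 0 := by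
  simp [piP_eq, (isEvenDer_derP e μ).mul]

theorem derP_piX (μ ν : Fin d) : derP e μ (piX e ν) = derX e ν (piP e μ) :=
  (derX_derP e ν μ (pi_mem_can e)).symm
theorem derX_piX (μ ν : Fin d) : derX e μ (piX e ν) = derX e ν (piX e μ) :=
  derX_derX e μ ν (pi_mem_can e)
theorem derT_piP (a μ : Fin d) : derT e a (piP e μ) = derP e μ (piT e a) :=
  (derP_derT e μ a (pi_mem_can e)).symm
theorem derT_piX (a μ : Fin d) : derT e a (piX e μ) = derX e μ (piT e a) :=
  (derX_derT e μ a (pi_mem_can e)).symm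
theorem derT_piT (a b : Fin d) : derT e a (piT e b) = -derT e b (piT e a) :=
  derT_derT e a b (pi_mem_can e)

theorem bigR_eq : bigR e B = (2 : ℝ) • ∑ μ, piP e μ * piX e μ
    + ∑ μ, (∑ ν, piP e ν * base (B ν μ)) * piP e μ + (2 : ℝ) • ∑ a, piT e a * piT e a := by
  rw [← opD_pi, opD_can e B (pi_mem_can e)]
  change ∑ μ, piP e μ * piX e μ + ∑ μ, dotP e B μ * piP e μ + ∑ a, (2 : ℝ) • (piT e a * piT e a) = _
  simp only [dotP, add_mul, Finset.sum_add_distrib, neg_mul, two_smul]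
  have h : ∑ μ, -(piX e μ * piP e μ) = ∑ μ, piP e μ * piX e μ :=
    Finset.sum_congr rfl fun μ _ => (odd_anticomm (inv_piP e μ) (inv_piX e μ)).symm
  rw [h]
  abel

theorem opD_piP (μ : Fin d) : opD e B (piP e μ) = (1 / 2 : ℝ) • derP e μ (bigR e B) := by
  have h1 : ∑ ν, piP e ν * derX e ν (piP e μ) = ∑ ν, piP e ν * derP e μ (piX e ν) := by
    simp only [derP_piX]
  have h2 : ∀ a, derP e μ (piT e a * piT e a) = (2 : ℝ) • (piT e a * derT e a (piP e μ)) := by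
    intro a
    rw [(isEvenDer_derP e μ).mul, derT_piP, ← even_comm (inv_piT e a), two_smul]
  rw [opD_can e B (piP_mem_can e μ), bigR_eq]
  simp only [map_add, map_smul, map_sum, h2, (isEvenDer_derP e μ).mul, derP_piP, derP_base,
    zero_mul, mul_zero, add_zero, Finset.sum_const_zero, zero_add, h1, smul_add]
  rw [smul_smul, ← Finset.smul_sum, smul_smul]
  norm_num

/-- Contractions of an antisymmetric matrix with two commuting families change sign when the
families are exchanged. -/
theorem sum_antisymm_swap (M : Fin d → Fin d → SmoothFn U) (hM : ∀ μ ν, M μ ν = -M ν μ)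
    (F G : Fin d → Fun U) (h : ∀ μ ν, F μ * G ν = G ν * F μ) :
    ∑ μ, ∑ ν, G ν * base (M ν μ) * F μ = -∑ μ, ∑ ν, F ν * base (M ν μ) * G μ := by
  rw [Finset.sum_comm, ← Finset.sum_neg_distrib]
  refine Finset.sum_congr rfl fun μ _ => ?_
  rw [← Finset.sum_neg_distrib]
  refine Finset.sum_congr rfl fun ν _ => ?_
  rw [← base_comm, ← base_comm, mul_assoc, mul_assoc, h, hM, base_neg, neg_mul]

theorem sum_antisymm_swap_odd (M : Fin d → Fin d → SmoothFn U) (hM : ∀ μ ν, M μ ν = -M ν μ)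
    (F G : Fin d → Fun U) (h : ∀ μ ν, F μ * G ν = -(G ν * F μ)) :
    ∑ μ, ∑ ν, G ν * base (M ν μ) * F μ = ∑ μ, ∑ ν, F ν * base (M ν μ) * G μ := by
  rw [Finset.sum_comm]
  refine Finset.sum_congr rfl fun μ _ => Finset.sum_congr rfl fun ν _ => ?_
  rw [← base_comm, ← base_comm, mul_assoc, mul_assoc, h, hM, base_neg, neg_mul, mul_neg]

/-- A symmetric matrix paired twice with the same odd elements gives zero. -/
theorem sum_symm_odd {F : Fin d → Fun U} (hF : ∀ μ, inv (F μ) = -F μ) {G : Fin d → Fin d → Fun U}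
    (hG : ∀ μ ν, G μ ν = G ν μ) : ∑ μ, ∑ ν, F μ * (F ν * G μ ν) = 0 := by
  refine eq_zero_of_eq_neg ?_
  conv_lhs => rw [Finset.sum_comm]
  rw [← Finset.sum_neg_distrib]
  refine Finset.sum_congr rfl fun μ _ => ?_
  rw [← Finset.sum_neg_distrib]
  refine Finset.sum_congr rfl fun ν _ => ?_
  rw [← mul_assoc, ← mul_assoc, odd_anticomm (hF ν) (hF μ), hG ν μ, neg_mul]

theorem opD_piT (hB : IsClosedTwoForm B) (b : Fin d) :
    opD e B (piT e b) = -((1 / 2 : ℝ) • derT e b (bigR e B)) := by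
  have hp : ∀ μ, inv (derT e b (piP e μ)) = derT e b (piP e μ) := fun μ => by
    rw [← neg_inj, ← (isOddDer_derT e b).inv_apply, inv_piP, map_neg]
  have h1 : ∀ μ, derX e μ (piT e b) = derT e b (piX e μ) := fun μ => (derT_piX e b μ).symm
  have h2 : ∀ μ, derP e μ (piT e b) = derT e b (piP e μ) := fun μ => (derT_piP e b μ).symm
  have h3 : ∀ a, derT e b (piT e a * piT e a) = (2 : ℝ) • (piT e a * derT e b (piT e a)) := by
    intro a
    rw [(isOddDer_derT e b).mul, inv_piT, ← even_comm (inv_piT e a), two_smul]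
  have h4 : ∑ μ, (∑ ν, piP e ν * base (B ν μ)) * derT e b (piP e μ)
      = -∑ μ, (∑ ν, derT e b (piP e ν) * base (B ν μ)) * piP e μ := by
    simp only [Finset.sum_mul]
    exact sum_antisymm_swap B hB.antisymm _ _ fun μ ν => even_comm (hp μ) _
  have h5 : ∑ μ, -(piX e μ) * derT e b (piP e μ) = -∑ μ, derT e b (piP e μ) * piX e μ := by
    rw [← Finset.sum_neg_distrib]
    exact Finset.sum_congr rfl fun μ _ => by rw [neg_mul, even_comm (hp μ)]
  rw [opD_can e B (piT_mem_can e b), bigR_eq]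
  simp only [map_add, map_smul, map_sum, h3, (isOddDer_derT e b).mul, derT_base, mul_zero, add_zero,
    map_mul, inv_piP, inv_base, h1, h2, dotP, add_mul, Finset.sum_add_distrib, h4, h5,
    derT_piT e _ b]
  simp only [neg_mul, Finset.sum_neg_distrib, mul_neg, smul_neg, h4, ← Finset.smul_sum]
  module

/-- The action of `{π, -}` on `∂π/∂x^μ`, where `x, P, θ` are the independent coordinates: the
defect from `½ ∂{π, π}/∂x^μ` is the derivative of the field strength `B`. -/
theorem opD_piX (hB : IsClosedTwoForm B) (μ : Fin d) :
    opD e B (piX e μ) = (1 / 2 : ℝ) • (derX e μ (bigR e B)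
      - ∑ ν, ∑ ρ, piP e ρ * base (pd μ (B ρ ν)) * piP e ν) := by
  have hp : ∀ ν, inv (derX e μ (piP e ν)) = -derX e μ (piP e ν) := fun ν => by
    rw [← (isEvenDer_derX e μ).inv_apply, inv_piP, map_neg]
  have h1 : ∀ ν, derX e ν (piX e μ) = derX e μ (piX e ν) := fun ν => derX_piX e ν μ
  have h2 : ∀ ν, derP e ν (piX e μ) = derX e μ (piP e ν) := fun ν => derP_piX e ν μ
  have h3 : ∀ a, derX e μ (piT e a * piT e a) = (2 : ℝ) • (piT e a * derX e μ (piT e a)) := by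
    intro a
    rw [(isEvenDer_derX e μ).mul, ← even_comm (inv_piT e a), two_smul]
  have h4 : ∑ ν, (∑ ρ, derX e μ (piP e ρ) * base (B ρ ν)) * piP e ν
      = ∑ ν, (∑ ρ, piP e ρ * base (B ρ ν)) * derX e μ (piP e ν) := by
    simp only [Finset.sum_mul]
    exact sum_antisymm_swap_odd B hB.antisymm _ _ fun ν ρ => odd_anticomm (inv_piP e ν) (hp ρ)
  have h5 : ∑ ν, -(piX e ν) * derX e μ (piP e ν) = ∑ ν, derX e μ (piP e ν) * piX e ν :=
    Finset.sum_congr rfl fun ν _ => by rw [neg_mul, ← odd_anticomm (hp ν) (inv_piX e ν)]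
  have h6 : ∀ a, derT e a (piX e μ) = derX e μ (piT e a) := fun a => derT_piX e a μ
  rw [opD_can e B (piX_mem_can e μ), bigR_eq]
  simp only [map_add, map_smul, map_sum, h3, (isEvenDer_derX e μ).mul, derX_base,
    h1, h2, h6, dotP, add_mul, Finset.sum_add_distrib, h4, h5, ← Finset.smul_sum]
  simp only [Finset.sum_mul, smul_add, smul_sub, smul_smul]
  module

theorem opH_base (g : SmoothFn U) :
    opH e B (base g) = (1 / 2 : ℝ) • ∑ μ, derP e μ (bigR e B) * base (pd μ g) := by
  rw [opH_eq, bracket_base]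

theorem opD_opD_base (g : SmoothFn U) : opD e B (opD e B (base g)) = opH e B (base g) := by
  have h : ∑ μ, ∑ ν, piP e μ * (piP e ν * base (pd ν (pd μ g))) = 0 :=
    sum_symm_odd (inv_piP e) fun μ ν => by rw [pd_comm]
  rw [opD_base, map_sum, opH_base]
  simp only [(isOddDer_opD e B).mul, inv_piP, opD_base, Finset.sum_add_distrib, neg_mul,
    Finset.mul_sum, Finset.sum_neg_distrib, h, opD_piP, smul_mul_assoc, ← Finset.smul_sum]
  simp

theorem opD_opD_theta (hB : IsClosedTwoForm B) (a : Fin d) :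
    opD e B (opD e B (theta a)) = opH e B (theta a) := by
  have h : dR (Sum.inl a) (bigR e B) = -dL (Sum.inl a) (bigR e B) := by
    rw [dR_eq, ← neg_inj, ← dL_inv, inv_bigR, neg_neg]
  have h2 : ∀ μ, inv (derP e μ (bigR e B)) = derP e μ (bigR e B) := fun μ => by
    rw [← (isEvenDer_derP e μ).inv_apply, inv_bigR]
  have h3 : derT e a (bigR e B) = dL (Sum.inl a) (bigR e B)
      - ∑ μ, derP e μ (bigR e B) * dL (Sum.inl a) (canMom e μ) := by
    rw [derT_apply]
    exact congrArg _ (Finset.sum_congr rfl fun μ _ => (even_comm (h2 μ) _).symm)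
  rw [opD_theta, map_smul, opD_piT e B hB, opH_eq, bracket_theta, h, h3]
  module

/-- The closedness of `B`, contracted with the odd functions `∂π/∂P_ν`. -/
theorem closed_contraction (hB : IsClosedTwoForm B) (μ : Fin d) :
    ∑ ν, ∑ ρ, piP e ν * (piP e ρ * base (pd ρ (B ν μ)))
      = (1 / 2 : ℝ) • ∑ ν, ∑ ρ, piP e ρ * base (pd μ (B ρ ν)) * piP e ν := by
  have h1 : ∑ ν, ∑ ρ, piP e ν * (piP e ρ * base (pd ρ (B ν μ)))
      = -∑ ν, ∑ ρ, piP e ν * (piP e ρ * base (pd ν (B ρ μ))) := by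
    conv_lhs => rw [Finset.sum_comm]
    rw [← Finset.sum_neg_distrib]
    refine Finset.sum_congr rfl fun ν _ => ?_
    rw [← Finset.sum_neg_distrib]
    refine Finset.sum_congr rfl fun ρ _ => ?_
    rw [← mul_assoc, ← mul_assoc, odd_anticomm (inv_piP e ρ) (inv_piP e ν), neg_mul]
  have h2 : ∑ ν, ∑ ρ, piP e ν * (piP e ρ * base (pd ρ (B ν μ)))
      - ∑ ν, ∑ ρ, piP e ν * (piP e ρ * base (pd ν (B ρ μ)))
      = ∑ ν, ∑ ρ, piP e ρ * base (pd μ (B ρ ν)) * piP e ν := by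
    rw [← Finset.sum_sub_distrib]
    refine Finset.sum_congr rfl fun ν _ => ?_
    rw [← Finset.sum_sub_distrib]
    refine Finset.sum_congr rfl fun ρ _ => ?_
    have hc := hB.closed ρ ν μ
    rw [hB.antisymm μ ρ, map_neg] at hc
    have : pd μ (B ρ ν) = -(pd ρ (B ν μ) - pd ν (B ρ μ)) := by
      rw [eq_neg_iff_add_eq_zero]
      linear_combination hc
    rw [this, base_neg, mul_neg, neg_mul, mul_assoc, base_comm,
      ← mul_assoc (piP e ρ), odd_anticomm (inv_piP e ρ) (inv_piP e ν), neg_mul,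
      neg_neg, base_sub, ← mul_sub, ← mul_sub,
      mul_assoc]
  rw [← h2, h1, ← sub_eq_zero]
  module

/-- The Jacobi identity on the canonical momenta. This is where `dB = 0` is used. -/
theorem opD_opD_canMom (hB : IsClosedTwoForm B) (μ : Fin d) :
    opD e B (opD e B (canMom e μ)) = opH e B (canMom e μ) := by
  have h := closed_contraction e B hB μ
  rw [opD_canMom, dotP, map_add, map_neg, map_sum, opD_piX e B hB, opH_eq, bracket_canMom]
  simp only [(isOddDer_opD e B).mul, opD_piP, opD_base, inv_piP, neg_mul, Finset.sum_add_distrib,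
    Finset.mul_sum, Finset.sum_neg_distrib, h, smul_mul_assoc, ← Finset.smul_sum]
  module

theorem opD_opD_can (hB : IsClosedTwoForm B) {F : Fun U} (hF : F ∈ canAlg e) :
    opD e B (opD e B F) = opH e B F := by
  rw [← LinearMap.comp_apply]
  refine (isOddDer_opD e B).sq.ext_adjoin (isEvenDer_opH e B) ?_ hF
  rintro _ ((⟨g, rfl⟩ | ⟨a, rfl⟩) | ⟨ν, rfl⟩)
  exacts [opD_opD_base e B g, opD_opD_theta e B hB a, opD_opD_canMom e B hB ν]

theorem inv_opD_mom (a : Fin d) : inv (opD e B (mom a)) = -opD e B (mom a) := by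
  rw [← neg_inj, neg_neg, ← (isOddDer_opD e B).inv_apply, inv_mom]

theorem opD_fn (g : SmoothFn (cotangent U)) :
    opD e B (fn g) = ∑ μ, piP e μ * dX μ (fn g) + ∑ a, opD e B (mom a) * dP a (fn g) := by
  rw [opD_eq, bracket_fn]
  simp only [opD_eq]
  rfl

/-- Functions which are not polynomial in `p` are not generated by the coordinates `x, P, θ`, so
the identity is extended to them by the chain rule in `x` and `p`. -/
theorem opD_opD_fn (hB : IsClosedTwoForm B) (g : SmoothFn (cotangent U)) :
    opD e B (opD e B (fn g)) = opH e B (fn g) := by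
  have hX : ∀ μ, (dX μ (fn g) : Fun U) = fn (dirDeriv _ (Pi.single μ 1, 0) g) := fun μ =>
    evenDeriv_fn _ _
  have hP : ∀ a, (dP a (fn g) : Fun U) = fn (dirDeriv _ (0, Pi.single a 1) g) := fun μ =>
    evenDeriv_fn _ _
  have hm : ∀ a, opD e B (opD e B (mom a)) = opH e B (mom a) := fun a =>
    opD_opD_can e B hB (mom_mem_can e a)
  have h1 : ∑ μ, ∑ ν, piP e μ * (piP e ν * dX ν (dX μ (fn g))) = 0 := by
    refine sum_symm_odd (inv_piP e) fun μ ν => ?_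
    simp only [dX, evenDeriv_fn]
    rw [dirDeriv_comm]
  have h2 : ∑ a, ∑ b, opD e B (mom a) * (opD e B (mom b) * dP b (dP a (fn g))) = 0 := by
    refine sum_symm_odd (inv_opD_mom e B) fun μ ν => ?_
    simp only [dP, evenDeriv_fn]
    rw [dirDeriv_comm]
  have h3 : ∑ μ, ∑ a, piP e μ * (opD e B (mom a) * dP a (dX μ (fn g)))
      = -∑ a, ∑ μ, opD e B (mom a) * (piP e μ * dX μ (dP a (fn g))) := by
    rw [Finset.sum_comm, ← Finset.sum_neg_distrib]
    refine Finset.sum_congr rfl fun a _ => ?_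
    rw [← Finset.sum_neg_distrib]
    refine Finset.sum_congr rfl fun μ _ => ?_
    simp only [dP, dX, evenDeriv_fn]
    rw [dirDeriv_comm, ← mul_assoc, odd_anticomm (inv_piP e μ) (inv_opD_mom e B a), neg_mul, mul_assoc]
  have hH : opH e B (fn g) = ∑ μ, opD e B (piP e μ) * dX μ (fn g)
      + ∑ a, opH e B (mom a) * dP a (fn g) := by
    rw [opH_eq, bracket_fn, smul_add, Finset.smul_sum, Finset.smul_sum]
    simp only [opH_eq, opD_piP, smul_mul_assoc]
  rw [opD_fn, map_add, map_sum, map_sum, hH]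
  simp only [(isOddDer_opD e B).mul, hm, inv_piP, inv_opD_mom, Finset.sum_add_distrib, neg_mul,
    Finset.sum_neg_distrib]
  have h4 : ∑ μ, piP e μ * opD e B (dX μ (fn g)) = -∑ a, ∑ μ, opD e B (mom a)
      * (piP e μ * dX μ (dP a (fn g))) := by
    rw [← h3, ← zero_add (∑ μ, ∑ a, _), ← h1, ← Finset.sum_add_distrib]
    refine Finset.sum_congr rfl fun μ _ => ?_
    rw [← Finset.mul_sum, ← Finset.mul_sum, ← mul_add, hX, opD_fn]
  have h5 : ∑ a, opD e B (mom a) * opD e B (dP a (fn g)) = ∑ a, ∑ μ, opD e B (mom a)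
      * (piP e μ * dX μ (dP a (fn g))) := by
    rw [← add_zero (∑ a, ∑ μ, _), ← h2, ← Finset.sum_add_distrib]
    refine Finset.sum_congr rfl fun a _ => ?_
    rw [← Finset.mul_sum, ← Finset.mul_sum, ← mul_add, hP, opD_fn]
  rw [h4, h5]
  abel

/-- The Jacobi identity `{π, {π, F}} = ½ {{π, π}, F}`. It reflects that the connection is
torsion-free and that `B` is closed. -/
theorem opD_opD (hB : IsClosedTwoForm B) {F : Fun U} (hF : F ∈ funcsO U) :
    opD e B (opD e B F) = opH e B F := by
  rw [← LinearMap.comp_apply]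
  refine (isOddDer_opD e B).sq.ext_adjoin (isEvenDer_opH e B) ?_ hF
  rintro _ (⟨g, rfl⟩ | ⟨a, rfl⟩)
  exacts [opD_opD_fn e B hB g, opD_opD_theta e B hB a]

end Jacobi

/-! ### The differential squares to zero -/

section SquareZero

variable (e : Frame U) (B : Matrix (Fin d) (Fin d) (SmoothFn U))

theorem curvature_antisymm (a b μ ν : Fin d) : curvature e a b μ ν = -curvature e a b ν μ := by
  simp only [curvature, neg_add, ← Finset.sum_neg_distrib]
  congr 1
  · ring
  · exact Finset.sum_congr rfl fun c _ => by ring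

theorem bracketPP_antisymm (hB : IsClosedTwoForm B) (a b : Fin d) :
    bracketPP e B a b = -bracketPP e B b a := by
  have h : ∀ μ ν, (1 / 4 : ℝ) • (∑ i, ∑ j, base (curvature e i j μ ν) * theta i * theta j)
      + base (B μ ν) = -((1 / 4 : ℝ) • (∑ i, ∑ j, base (curvature e i j ν μ) * theta i * theta j)
      + base (B ν μ)) := by
    intro μ ν
    rw [hB.antisymm, base_neg, neg_add, ← smul_neg]
    congr 2
    simp only [← Finset.sum_neg_distrib]
    refine Finset.sum_congr rfl fun i _ => Finset.sum_congr rfl fun j _ => ?_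
    rw [curvature_antisymm, base_neg, neg_mul, neg_mul]
  rw [bracketPP, bracketPP, neg_add]
  congr 1
  · rw [← Finset.sum_neg_distrib]
    refine Finset.sum_congr rfl fun c _ => ?_
    rw [← neg_mul, ← Finset.sum_neg_distrib]
    congr 1
    refine Finset.sum_congr rfl fun μ _ => ?_
    rw [← base_neg, neg_sub]
  · rw [Finset.sum_comm, ← Finset.sum_neg_distrib]
    refine Finset.sum_congr rfl fun ν _ => ?_
    rw [← Finset.sum_neg_distrib]
    refine Finset.sum_congr rfl fun μ _ => ?_
    rw [h, mul_neg, mul_comm]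

/-- Antisymmetry of the bracket of `π` with an even function. -/
theorem bracket_pi_right (hB : IsClosedTwoForm B) {F : Fun U} (hF : inv F = F)
    (hF' : F ∈ funcsO U) : bracket e B F (piFn U) = -bracket e B (piFn U) F := by
  have hX : ∀ μ, inv (dX μ F) = dX μ F := fun μ => by rw [← (isEvenDer_dX μ).inv_apply, hF]
  have hP : ∀ μ, inv (dP μ F) = dP μ F := fun μ => by rw [← (isEvenDer_dP μ).inv_apply, hF]
  have hR : ∀ i, dR i F = -dL i F := fun i => by
    rw [dR_eq, ← neg_inj, ← dL_inv, hF, neg_neg]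
  have hL : ∀ i, inv (dL i F) = -dL i F := fun i => by rw [← hR, dR_eq]
  have h1 : ∑ a, ∑ μ, dX μ F * base (coframe e μ a) * theta a
      = ∑ a, ∑ μ, theta a * base (coframe e μ a) * dX μ F :=
    Finset.sum_congr rfl fun a _ => Finset.sum_congr rfl fun μ _ => by
      rw [mul_assoc, even_comm (hX μ), base_comm]
  have h2 : ∑ a, ∑ b, dP a F * bracketPP e B a b * theta b
      = -∑ a, ∑ b, theta a * bracketPP e B a b * dP b F := by
    rw [Finset.sum_comm, ← Finset.sum_neg_distrib]
    refine Finset.sum_congr rfl fun b _ => ?_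
    rw [← Finset.sum_neg_distrib]
    refine Finset.sum_congr rfl fun a _ => ?_
    rw [bracketPP_antisymm e B hB, mul_neg, neg_mul, mul_assoc, even_comm (hP a),
      even_comm (inv_bracketPP e B b a)]
  have h3 : ∑ a, ∑ b, dP a F * bracketPTheta e a b * mom b
      = ∑ a, ∑ b, mom b * bracketPTheta e a b * dP a F :=
    Finset.sum_congr rfl fun a _ => Finset.sum_congr rfl fun b _ => by
      rw [mul_assoc, even_comm (hP a), mom_comm]
  have h4 : ∑ a, ∑ b, dL (Sum.inl b) F * bracketPTheta e a b * theta a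
      = -∑ a, ∑ b, theta a * bracketPTheta e a b * dL (Sum.inl b) F := by
    rw [← Finset.sum_neg_distrib]
    refine Finset.sum_congr rfl fun a _ => ?_
    rw [← Finset.sum_neg_distrib]
    refine Finset.sum_congr rfl fun b _ => ?_
    rw [mul_assoc, odd_comm (hL _), map_mul, inv_theta, inv_bracketPTheta, neg_mul_neg,
      odd_anticomm (inv_bracketPTheta e a b) (inv_theta a), neg_mul]
  have h5 : ∑ a, mom a * dL (Sum.inl a) F = ∑ a, dL (Sum.inl a) F * mom a :=
    Finset.sum_congr rfl fun a _ => mom_comm _ _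
  simp only [bracket, dX_pi, dP_pi, dL_pi, dR_pi, dL_inr_funcsO _ hF', dL_inr_funcsO _ pi_mem,
    dBeta_funcsO hF', dBeta_funcsO pi_mem, dGamma_funcsO hF', dGamma_funcsO pi_mem, hR, mul_zero,
    zero_mul, sub_zero, zero_sub, neg_mul, sub_neg_eq_add, Finset.sum_add_distrib,
    Finset.sum_sub_distrib, Finset.sum_neg_distrib, smul_neg, ← Finset.smul_sum, h1, h2, h3, h4, h5,
    dR_inr_funcsO _ pi_mem, add_zero]
  abel

theorem opD_bigR (hB : IsClosedTwoForm B) : opD e B (bigR e B) = 0 := by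
  have h : opD e B (bigR e B) = -((1 / 2 : ℝ) • opD e B (bigR e B)) := by
    conv_lhs => rw [← opD_pi, opD_opD e B hB pi_mem, opH_eq,
      bracket_pi_right e B hB (inv_bigR e B) (bigR_mem e B), ← opD_eq]
    rw [smul_neg]
  have h' : (3 / 2 : ℝ) • opD e B (bigR e B) = 0 := by
    rw [← sub_eq_zero] at h
    rw [← h]
    module
  exact (smul_eq_zero.1 h').resolve_left (by norm_num)

theorem opH_bigR (hB : IsClosedTwoForm B) : opH e B (bigR e B) = 0 := by
  rw [← opD_opD e B hB (bigR_mem e B), opD_bigR e B hB, map_zero]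

theorem opH_pi (hB : IsClosedTwoForm B) : opH e B (piFn U) = 0 := by
  rw [← opD_opD e B hB pi_mem, opD_pi, opD_bigR e B hB]

theorem opD_opH (hB : IsClosedTwoForm B) {F : Fun U} (hF : F ∈ funcsO U) :
    opD e B (opH e B F) = opH e B (opD e B F) := by
  rw [← opD_opD e B hB hF, ← opD_opD e B hB (opD_mem e B hF)]

theorem Q_pi (hB : IsClosedTwoForm B) : Q e B (piFn U) = ggamma * bigR e B := by
  rw [Q_funcsO e B pi_mem, opD_pi, opH_pi e B hB, mul_zero, add_zero]

theorem Q_bigR (hB : IsClosedTwoForm B) : Q e B (bigR e B) = 0 := by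
  rw [Q_funcsO e B (bigR_mem e B), opD_bigR e B hB, opH_bigR e B hB, mul_zero, mul_zero, add_zero]

theorem Q_ggamma_mul (F : Fun U) : Q e B (ggamma * F) = ggamma * Q e B F := by
  rw [(isOddDer_Q e B).mul, Q_ggamma, zero_mul, zero_add, inv_ggamma]

theorem Q_gc_mul (F : Fun U) : Q e B (gc * F) = -(ggamma ^ 2 * F) - gc * Q e B F := by
  rw [(isOddDer_Q e B).mul, Q_gc, inv_gc, neg_mul, neg_mul, sub_eq_add_neg]

theorem gc_mul_gc_mul (F : Fun U) : gc * (gc * F) = 0 := by rw [← mul_assoc, gc_sq, zero_mul]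

theorem Q_Q_funcsO (hB : IsClosedTwoForm B) {F : Fun U} (hF : F ∈ funcsO U) :
    Q e B (Q e B F) = 0 := by
  rw [Q_funcsO e B hF, map_add, Q_ggamma_mul, Q_gc_mul, Q_funcsO e B (opD_mem e B hF),
    Q_funcsO e B (opH_mem e B hF), opD_opD e B hB hF, opD_opH e B hB hF, mul_add, mul_add,
    gc_mul_gc_mul, ← mul_assoc gc, ← ggamma_comm, pow_two]
  noncomm_ring

theorem Q_Q (hB : IsClosedTwoForm B) (F : Fun U) : Q e B (Q e B F) = 0 := by
  have h : ∀ F ∈ coordinates U, Q e B (Q e B F) = 0 := by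
    rintro _ ((⟨g, rfl⟩ | ⟨i, rfl⟩) | h)
    · exact Q_Q_funcsO e B hB (fn_mem g)
    · rcases i with a | i
      · exact Q_Q_funcsO e B hB (theta_mem a)
      · fin_cases i
        · change Q e B (Q e B gb) = 0
          rw [Q_gb, map_smul, Q_bigR e B hB, smul_zero]
        · change Q e B (Q e B gc) = 0
          rw [Q_gc, map_neg, pow_two, Q_ggamma_mul, Q_ggamma, mul_zero, neg_zero]
    · rcases h with rfl | rfl | rfl
      · rw [Q_gbeta, map_add, map_neg, map_smul, Q_ggamma_mul, Q_pi e B hB, Q_gb, mul_smul_comm,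
          smul_smul]
        norm_num
      · rw [Q_ggamma, map_zero]
      · rw [Q_gammaInv, map_zero]
  have h' := (isOddDer_Q e B).sq.ext_adjoin IsEvenDer.zero (s := coordinates U) (F := F)
    (fun F hF => by rw [LinearMap.comp_apply, LinearMap.zero_apply, h F hF])
    (mem_adjoin_coordinates F)
  rwa [LinearMap.comp_apply, LinearMap.zero_apply] at h'

end SquareZero

/-! ### Ghost number -/

section Ghost

theorem isEvenDer_ghost : IsEvenDer (ghost : Fun U →ₗ[ℝ] Fun U) :=
  (((isOddDer_dL _).mulLeft_odd inv_gc).add (isEvenDer_dGamma.mulLeft inv_ggamma)).sub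
    ((isOddDer_dL _).mulLeft_odd inv_gb) |>.sub (isEvenDer_dBeta.mulLeft inv_gbeta)

theorem ghost_apply (F : Fun U) : ghost F = gc * dL (Sum.inr 1) F + ggamma * dGamma F
    - gb * dL (Sum.inr 0) F - gbeta * dBeta F := rfl

theorem mem_deg {n : ℤ} {F : Fun U} : F ∈ deg U n ↔ ghost F = (n : ℝ) • F :=
  Module.End.mem_eigenspace_iff

theorem mul_mem_deg {m n k : ℤ} {F G : Fun U} (hF : F ∈ deg U m) (hG : G ∈ deg U n)
    (h : m + n = k := by norm_num) : F * G ∈ deg U k := by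
  subst h
  rw [mem_deg] at hF hG ⊢
  rw [isEvenDer_ghost.mul, hF, hG, smul_mul_assoc, mul_smul_comm, ← add_smul, Int.cast_add]

theorem funcsO_deg {F : Fun U} (hF : F ∈ funcsO U) : F ∈ deg U 0 := by
  simp [mem_deg, ghost_apply, dL_inr_funcsO _ hF, dBeta_funcsO hF, dGamma_funcsO hF]

theorem one_mem_deg : (1 : Fun U) ∈ deg U 0 := funcsO_deg (one_mem _)

theorem gc_mem_deg : (gc : Fun U) ∈ deg U 1 := by simp [mem_deg, ghost_apply]
theorem gb_mem_deg : (gb : Fun U) ∈ deg U (-1) := by simp [mem_deg, ghost_apply]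

theorem mono_mem_deg (m : ℕ) (n : ℤ) {k : ℤ} (hk : n - m = k) : (mono m n : Fun U) ∈ deg U k := by
  subst hk
  simp only [mem_deg, ghost_apply, dL_mono, mul_zero, dGamma_mono, dBeta_mono, mul_smul_comm,
    zero_add, sub_zero, ggamma, gbeta, mono_mul]
  rcases m with _ | m
  · simp
  · simp only [Nat.add_sub_cancel, add_sub_cancel, ← sub_smul, add_comm 1 m]
    push_cast
    rfl

theorem ggamma_mem_deg : (ggamma : Fun U) ∈ deg U 1 := mono_mem_deg 0 1 (by simp)
theorem gammaInv_mem_deg : (gammaInv : Fun U) ∈ deg U (-1) := mono_mem_deg 0 (-1) (by simp)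
theorem gbeta_mem_deg : (gbeta : Fun U) ∈ deg U (-1) := mono_mem_deg 1 0 (by simp)

theorem pow_mem_deg {F : Fun U} {n : ℤ} (hF : F ∈ deg U n) (j : ℕ) : F ^ j ∈ deg U (j * n) := by
  induction j with
  | zero => simpa using one_mem_deg
  | succ j ih =>
    rw [pow_succ]
    refine mul_mem_deg ih hF ?_
    push_cast
    ring

variable (e : Frame U) (B : Matrix (Fin d) (Fin d) (SmoothFn U))

/-- The values of the differential on the coordinates have the expected ghost numbers. -/
theorem ghost_Q_coordinates {F : Fun U} (hF : F ∈ coordinates U) :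
    ghost (Q e B F) - Q e B (ghost F) = Q e B F := by
  have key : ∀ {n : ℤ} {F : Fun U}, F ∈ deg U n → Q e B F ∈ deg U (n + 1) →
      ghost (Q e B F) - Q e B (ghost F) = Q e B F := by
    intro n F h1 h2
    rw [mem_deg] at h1 h2
    rw [h1, h2, map_smul, ← sub_smul]
    push_cast
    rw [add_sub_cancel_left, one_smul]
  have hO : ∀ {F : Fun U}, F ∈ funcsO U → Q e B F ∈ deg U (0 + 1) := by
    intro F hF
    rw [Q_funcsO e B hF]
    exact add_mem (mul_mem_deg ggamma_mem_deg (funcsO_deg (opD_mem e B hF)))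
      (mul_mem_deg gc_mem_deg (funcsO_deg (opH_mem e B hF)))
  rcases hF with (⟨g, rfl⟩ | ⟨i, rfl⟩) | h
  · exact key (funcsO_deg (fn_mem g)) (hO (fn_mem g))
  · rcases i with a | i
    · exact key (funcsO_deg (theta_mem a)) (hO (theta_mem a))
    · fin_cases i
      · refine key gb_mem_deg ?_
        change Q e B gb ∈ _
        rw [Q_gb]
        exact Submodule.smul_mem _ _ (funcsO_deg (bigR_mem e B))
      · refine key gc_mem_deg ?_
        change Q e B gc ∈ _
        rw [Q_gc]
        exact neg_mem (pow_mem_deg ggamma_mem_deg 2)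
  · rcases h with rfl | rfl | rfl
    · refine key gbeta_mem_deg ?_
      rw [Q_gbeta]
      exact add_mem (neg_mem (funcsO_deg pi_mem))
        (Submodule.smul_mem _ _ (mul_mem_deg ggamma_mem_deg gb_mem_deg))
    · refine key ggamma_mem_deg ?_
      rw [Q_ggamma]
      exact zero_mem _
    · refine key gammaInv_mem_deg ?_
      rw [Q_gammaInv]
      exact zero_mem _

/-- The differential has ghost number one, as an identity of operators. -/
theorem ghost_Q (F : Fun U) : ghost (Q e B F) = Q e B (ghost F) + Q e B F := by
  have h' := (isEvenDer_ghost.comm_odd (isOddDer_Q e B)).ext_adjoin (isOddDer_Q e B)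
    (s := coordinates U) (F := F)
    (fun F hF => by rw [LinearMap.sub_apply, LinearMap.comp_apply, LinearMap.comp_apply,
      ghost_Q_coordinates e B hF])
    (mem_adjoin_coordinates F)
  rw [LinearMap.sub_apply, LinearMap.comp_apply, LinearMap.comp_apply] at h'
  rwa [sub_eq_iff_eq_add'] at h'

theorem Q_mem_deg {n : ℤ} {F : Fun U} (hF : F ∈ deg U n) : Q e B F ∈ deg U (n + 1) := by
  rw [mem_deg] at hF ⊢
  rw [ghost_Q, hF, map_smul]
  push_cast
  rw [add_smul, one_smul]

end Ghost

/-! ### The three complexes -/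

section Complexes

theorem funcsO_le_funcsW : funcsO U ≤ funcsW U := Algebra.adjoin_mono Set.subset_union_left
theorem funcsW_le_funcs : funcsW U ≤ funcs U := by
  refine Algebra.adjoin_mono (Set.union_subset_union_right _ ?_)
  rintro _ (rfl | rfl) <;> simp
theorem funcsO_le_funcs : funcsO U ≤ funcs U := funcsO_le_funcsW.trans funcsW_le_funcs

theorem gc_mem_W : gc ∈ funcsW U := Algebra.subset_adjoin (by simp)
theorem ggamma_mem_W : ggamma ∈ funcsW U := Algebra.subset_adjoin (by simp)
theorem gc_mem : gc ∈ funcs U := funcsW_le_funcs gc_mem_W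
theorem ggamma_mem : ggamma ∈ funcs U := funcsW_le_funcs ggamma_mem_W
theorem gb_mem : gb ∈ funcs U := Algebra.subset_adjoin (by simp)
theorem gbeta_mem : gbeta ∈ funcs U := Algebra.subset_adjoin (by simp)

variable (e : Frame U) (B : Matrix (Fin d) (Fin d) (SmoothFn U))

theorem Q_funcsO_mem_W {F : Fun U} (hF : F ∈ funcsO U) : Q e B F ∈ funcsW U := by
  rw [Q_funcsO e B hF]
  exact add_mem (mul_mem ggamma_mem_W (funcsO_le_funcsW (opD_mem e B hF)))
    (mul_mem gc_mem_W (funcsO_le_funcsW (opH_mem e B hF)))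

theorem Q_mem_W {F : Fun U} (hF : F ∈ funcsW U) : Q e B F ∈ funcsW U := by
  refine (isOddDer_Q e B).mem_adjoin ?_ ?_ hF
  · rintro _ (h | (rfl | rfl))
    exacts [funcsO_gens h, Or.inr inv_gc, Or.inl inv_ggamma]
  · rintro _ (h | (rfl | rfl))
    · exact Q_funcsO_mem_W e B (Algebra.subset_adjoin h)
    · rw [Q_gc]; exact neg_mem (pow_mem ggamma_mem_W 2)
    · rw [Q_ggamma]; exact zero_mem _

theorem Q_mem {F : Fun U} (hF : F ∈ funcs U) : Q e B F ∈ funcs U := by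
  refine (isOddDer_Q e B).mem_adjoin ?_ ?_ hF
  · rintro _ (h | (rfl | rfl | rfl | rfl))
    exacts [funcsO_gens h, Or.inr inv_gb, Or.inr inv_gc, Or.inl inv_gbeta, Or.inl inv_ggamma]
  · rintro _ (h | (rfl | rfl | rfl | rfl))
    · exact funcsW_le_funcs (Q_funcsO_mem_W e B (Algebra.subset_adjoin h))
    · rw [Q_gb]; exact Subalgebra.smul_mem _ (funcsO_le_funcs (bigR_mem e B)) _
    · rw [Q_gc]; exact neg_mem (pow_mem ggamma_mem 2)
    · rw [Q_gbeta]
      exact add_mem (neg_mem (funcsO_le_funcs pi_mem))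
        (Subalgebra.smul_mem _ (mul_mem ggamma_mem gb_mem) _)
    · rw [Q_ggamma]; exact zero_mem _

theorem mem_zeroLocus {F : Fun U} : F ∈ zeroLocus e B ↔
    ∃ G ∈ funcsW U, ∃ G' ∈ funcsW U, F = piFn U * G + bigR e B * G' := by
  simp only [zeroLocus, Submodule.mem_sup, Submodule.mem_map, Subalgebra.mem_toSubmodule,
    LinearMap.mulLeft_apply, bigR]
  constructor
  · rintro ⟨_, ⟨G, hG, rfl⟩, _, ⟨G', hG', rfl⟩, rfl⟩
    exact ⟨G, hG, G', hG', rfl⟩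
  · rintro ⟨G, hG, G', hG', rfl⟩
    exact ⟨_, ⟨G, hG, rfl⟩, _, ⟨G', hG', rfl⟩, rfl⟩

theorem zeroLocus_le : zeroLocus e B ≤ Subalgebra.toSubmodule (funcsW U) := by
  intro F hF
  obtain ⟨G, hG, G', hG', rfl⟩ := (mem_zeroLocus e B).1 hF
  exact Subalgebra.add_mem _ (mul_mem (funcsO_le_funcsW pi_mem) hG)
    (mul_mem (funcsO_le_funcsW (bigR_mem e B)) hG')

theorem Q_mem_zeroLocus (hB : IsClosedTwoForm B) {F : Fun U} (hF : F ∈ zeroLocus e B) :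
    Q e B F ∈ zeroLocus e B := by
  obtain ⟨G, hG, G', hG', rfl⟩ := (mem_zeroLocus e B).1 hF
  refine (mem_zeroLocus e B).2 ⟨-Q e B G, neg_mem (Q_mem_W e B hG), ggamma * G + Q e B G',
    add_mem (mul_mem ggamma_mem_W hG) (Q_mem_W e B hG'), ?_⟩
  rw [map_add, (isOddDer_Q e B).mul, (isOddDer_Q e B).mul, Q_pi e B hB, Q_bigR e B hB, inv_pi,
    inv_bigR, ggamma_comm, mul_add, mul_assoc]
  noncomm_ring

theorem isComplex_funcs (hB : IsClosedTwoForm B) :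
    IsComplex (Q e B) (deg U) (Subalgebra.toSubmodule (funcs U)) ⊥ where
  le := bot_le
  map_deg _ _ hF := ⟨Q_mem e B hF.1, Q_mem_deg e B hF.2⟩
  map_ideal F hF := by rw [(Submodule.mem_bot ℝ).1 hF, map_zero]; exact zero_mem _
  map_sub _ hF := Q_mem e B hF
  sq_zero F _ := by rw [Q_Q e B hB]; exact zero_mem _

theorem isComplex_funcsW (hB : IsClosedTwoForm B) :
    IsComplex (Q e B) (deg U) (Subalgebra.toSubmodule (funcsW U)) ⊥ where
  le := bot_le
  map_deg _ _ hF := ⟨Q_mem_W e B hF.1, Q_mem_deg e B hF.2⟩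
  map_ideal F hF := by rw [(Submodule.mem_bot ℝ).1 hF, map_zero]; exact zero_mem _
  map_sub _ hF := Q_mem_W e B hF
  sq_zero F _ := by rw [Q_Q e B hB]; exact zero_mem _

theorem isComplex_reduced (hB : IsClosedTwoForm B) :
    IsComplex (Q e B) (deg U) (Subalgebra.toSubmodule (funcsW U)) (zeroLocus e B) where
  le := zeroLocus_le e B
  map_deg _ _ hF := ⟨Q_mem_W e B hF.1, Q_mem_deg e B hF.2⟩
  map_ideal _ hF := Q_mem_zeroLocus e B hB hF
  map_sub _ hF := Q_mem_W e B hF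
  sq_zero F _ := by rw [Q_Q e B hB]; exact zero_mem _

end Complexes

/-! ### Expansion in ghosts -/

section Expansion

/-- A submodule which contains `1` and is stable under left multiplication by generators contains
the algebra they generate. -/
theorem adjoin_le_of_mul_mem {s : Set (Fun U)} {T : Submodule ℝ (Fun U)} (h1 : (1 : Fun U) ∈ T)
    (hs : ∀ F ∈ s, ∀ G ∈ T, F * G ∈ T) : Subalgebra.toSubmodule (Algebra.adjoin ℝ s) ≤ T := by
  have h : ∀ F ∈ Algebra.adjoin ℝ s, ∀ G ∈ T, F * G ∈ T := by
    intro F hF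
    induction hF using Algebra.adjoin_induction with
    | mem F hF => exact hs F hF
    | algebraMap r =>
      intro G hG
      rw [Algebra.algebraMap_eq_smul_one, smul_mul_assoc, one_mul]
      exact Submodule.smul_mem _ _ hG
    | add F F' _ _ h h' => exact fun G hG => by rw [add_mul]; exact add_mem (h G hG) (h' G hG)
    | mul F F' _ _ h h' => exact fun G hG => by rw [mul_assoc]; exact h _ (h' G hG)
  exact fun F hF => by simpa using h F hF 1 h1

/-- Span of the monomials `β^m γ^l c^j b^i x` of ghost number `n`, where `x` depends on `x, p, θ`. -/
def ghostSpan (U : Opens (Fin d → ℝ)) (n : ℤ) : Submodule ℝ (Fun U) :=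
  Submodule.span ℝ {F | ∃ (m l j i : ℕ), ∃ x ∈ funcsO U, (l : ℤ) + j - m - i = n ∧
    F = mono m l * (gc ^ j * (gb ^ i * x))}

/-- Span of the monomials `γ^l c^j x` of ghost number `n`, where `x` depends on `x, p, θ`. -/
def ghostSpanW (U : Opens (Fin d → ℝ)) (n : ℤ) : Submodule ℝ (Fun U) :=
  Submodule.span ℝ {F | ∃ (l j : ℕ), ∃ x ∈ funcsO U, (l : ℤ) + j = n ∧
    F = mono 0 l * (gc ^ j * x)}

theorem mono_mem {m l : ℕ} : (mono m l : Fun U) ∈ funcs U := by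
  have h : (mono m l : Fun U) = gbeta ^ m * ggamma ^ l := by
    induction m with
    | zero =>
      induction l with
      | zero => simp [mono_zero]
      | succ l ih => rw [pow_succ, ← mul_assoc, ← ih, ggamma, mono_mul]; simp
    | succ m ih => rw [pow_succ', mul_assoc, ← ih, gbeta, mono_mul]; simp [add_comm]
  rw [h]
  exact mul_mem (pow_mem gbeta_mem _) (pow_mem ggamma_mem _)

theorem mono_mem_W {l : ℕ} : (mono 0 l : Fun U) ∈ funcsW U := by
  have h : (mono 0 l : Fun U) = ggamma ^ l := by
    induction l with
    | zero => simp [mono_zero]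
    | succ l ih => rw [pow_succ, ← ih, ggamma, mono_mul]; simp
  rw [h]
  exact pow_mem ggamma_mem_W _

theorem mul_mul_comm_of_even {F : Fun U} (hF : inv F = F) (G K : Fun U) :
    F * (G * K) = G * (F * K) := by
  rw [← mul_assoc, even_comm hF, mul_assoc]

theorem mul_pow_mul_of_odd {F G : Fun U} (hF : inv F = -F) (hG : inv G = -G) (j : ℕ) (K : Fun U) :
    F * (G ^ j * K) = (-1 : ℝ) ^ j • (G ^ j * (F * K)) := by
  rw [← mul_assoc, odd_comm hF, map_pow, hG, neg_pow, mul_assoc, mul_assoc]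
  rcases Nat.even_or_odd j with hj | hj <;> simp [hj.neg_one_pow]

theorem mul_mem_of_mem_span {T : Submodule ℝ (Fun U)} {s : Set (Fun U)} {G : Fun U}
    (h : ∀ K ∈ s, G * K ∈ T) : ∀ F ∈ Submodule.span ℝ s, G * F ∈ T := by
  intro F hF
  induction hF using Submodule.span_induction with
  | mem F hF => exact h F hF
  | zero => rw [mul_zero]; exact zero_mem _
  | add F F' _ _ h h' => rw [mul_add]; exact add_mem h h'
  | smul r F _ h => rw [mul_smul_comm]; exact Submodule.smul_mem _ _ h

/-- Left multiplication preserves `⨆ n, span (s n)` if it maps each generator into it. -/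
theorem mul_mem_iSup_span {ι : Type*} {s : ι → Set (Fun U)} {G : Fun U}
    (h : ∀ n, ∀ K ∈ s n, G * K ∈ ⨆ n, Submodule.span ℝ (s n)) :
    ∀ F ∈ ⨆ n, Submodule.span ℝ (s n), G * F ∈ ⨆ n, Submodule.span ℝ (s n) := by
  rw [← Submodule.span_iUnion] at h ⊢
  refine mul_mem_of_mem_span fun K hK => ?_
  obtain ⟨n, hn⟩ := Set.mem_iUnion.1 hK
  exact h n K hn

theorem mem_iSup_ghostSpan (m l j i : ℕ) {x : Fun U} (hx : x ∈ funcsO U) :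
    mono m l * (gc ^ j * (gb ^ i * x)) ∈ ⨆ n, ghostSpan U n :=
  Submodule.mem_iSup_of_mem _ (Submodule.subset_span ⟨m, l, j, i, x, hx, rfl, rfl⟩)

theorem mem_iSup_ghostSpanW (l j : ℕ) {x : Fun U} (hx : x ∈ funcsO U) :
    mono 0 l * (gc ^ j * x) ∈ ⨆ n, ghostSpanW U n :=
  Submodule.mem_iSup_of_mem _ (Submodule.subset_span ⟨l, j, x, hx, rfl, rfl⟩)

theorem funcs_le_iSup : Subalgebra.toSubmodule (funcs U) ≤ ⨆ n, ghostSpan U n := by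
  refine adjoin_le_of_mul_mem ?_ fun F hF => mul_mem_iSup_span ?_
  · simpa [mono_zero] using mem_iSup_ghostSpan (U := U) 0 0 0 0 (one_mem _)
  rintro _ _ ⟨m, l, j, i, x, hx, -, rfl⟩
  rcases hF with (⟨g, rfl⟩ | ⟨a, rfl⟩) | (rfl | rfl | rfl | rfl)
  · simp only [mul_mul_comm_of_even (inv_fn g)]
    exact mem_iSup_ghostSpan m l j i (mul_mem (fn_mem g) hx)
  · rw [← mul_mul_comm_of_even (inv_mono m l), mul_pow_mul_of_odd (inv_theta a) inv_gc,
      mul_pow_mul_of_odd (inv_theta a) inv_gb]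
    simp only [mul_smul_comm]
    exact Submodule.smul_mem _ _ (Submodule.smul_mem _ _
      (mem_iSup_ghostSpan m l j i (mul_mem (theta_mem a) hx)))
  · rw [← mul_mul_comm_of_even (inv_mono m l), mul_pow_mul_of_odd inv_gb inv_gc,
      ← mul_assoc gb, ← pow_succ', mul_smul_comm]
    exact Submodule.smul_mem _ _ (mem_iSup_ghostSpan m l j (i + 1) hx)
  · rw [← mul_mul_comm_of_even (inv_mono m l), ← mul_assoc gc, ← pow_succ']
    exact mem_iSup_ghostSpan m l (j + 1) i hx
  · rw [← mul_assoc, gbeta, mono_mul, zero_add]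
    exact mem_iSup_ghostSpan (1 + m) l j i hx
  · rw [← mul_assoc, ggamma, mono_mul, zero_add, ← Nat.cast_one, ← Nat.cast_add]
    exact mem_iSup_ghostSpan m (1 + l) j i hx

theorem funcsW_le_iSup : Subalgebra.toSubmodule (funcsW U) ≤ ⨆ n, ghostSpanW U n := by
  refine adjoin_le_of_mul_mem ?_ fun F hF => mul_mem_iSup_span ?_
  · simpa [mono_zero] using mem_iSup_ghostSpanW (U := U) 0 0 (one_mem _)
  rintro _ _ ⟨l, j, x, hx, -, rfl⟩
  rcases hF with (⟨g, rfl⟩ | ⟨a, rfl⟩) | (rfl | rfl)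
  · simp only [mul_mul_comm_of_even (inv_fn g)]
    exact mem_iSup_ghostSpanW l j (mul_mem (fn_mem g) hx)
  · rw [← mul_mul_comm_of_even (inv_mono 0 l), mul_pow_mul_of_odd (inv_theta a) inv_gc]
    simp only [mul_smul_comm]
    exact Submodule.smul_mem _ _ (mem_iSup_ghostSpanW l j (mul_mem (theta_mem a) hx))
  · rw [← mul_mul_comm_of_even (inv_mono 0 l), ← mul_assoc gc, ← pow_succ']
    exact mem_iSup_ghostSpanW l (j + 1) hx
  · rw [← mul_assoc, ggamma, mono_mul, zero_add, ← Nat.cast_one, ← Nat.cast_add]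
    exact mem_iSup_ghostSpanW (1 + l) j hx

theorem ghostSpan_le (n : ℤ) : ghostSpan U n ≤ Subalgebra.toSubmodule (funcs U) ⊓ deg U n := by
  refine Submodule.span_le.2 ?_
  rintro _ ⟨m, l, j, i, x, hx, h, rfl⟩
  refine ⟨Subalgebra.mul_mem _ mono_mem (mul_mem (pow_mem gc_mem _) (mul_mem (pow_mem gb_mem _)
    (funcsO_le_funcs hx))), ?_⟩
  refine mul_mem_deg (mono_mem_deg m l rfl) (mul_mem_deg (pow_mem_deg gc_mem_deg j)
    (mul_mem_deg (pow_mem_deg gb_mem_deg i) (funcsO_deg hx) rfl) rfl) ?_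
  rw [← h]
  ring

theorem ghostSpanW_le (n : ℤ) : ghostSpanW U n ≤ Subalgebra.toSubmodule (funcsW U) ⊓ deg U n := by
  refine Submodule.span_le.2 ?_
  rintro _ ⟨l, j, x, hx, h, rfl⟩
  refine ⟨Subalgebra.mul_mem _ mono_mem_W (mul_mem (pow_mem gc_mem_W _) (funcsO_le_funcsW hx)), ?_⟩
  refine mul_mem_deg (mono_mem_deg 0 l rfl) (mul_mem_deg (pow_mem_deg gc_mem_deg j)
    (funcsO_deg hx) rfl) ?_
  rw [← h]
  simp

theorem iSupIndep_deg : iSupIndep (deg U) :=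
  (Module.End.eigenspaces_iSupIndep (ghost : Module.End ℝ (Fun U))).comp Int.cast_injective

/-- Homogeneous components of a sum of homogeneous submodules. -/
theorem mem_of_mem_iSup_of_mem_deg {W : ℤ → Submodule ℝ (Fun U)} (hW : ∀ n, W n ≤ deg U n)
    {n : ℤ} {F : Fun U} (hF : F ∈ ⨆ n, W n) (hn : F ∈ deg U n) : F ∈ W n := by
  have h : ⨆ n, W n ≤ W n ⊔ ⨆ (m) (_ : m ≠ n), W m := by
    refine iSup_le fun m => ?_
    by_cases hm : m = n
    · subst hm; exact le_sup_left
    · exact le_sup_of_le_right (le_iSup₂_of_le m hm le_rfl)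
  obtain ⟨a, ha, b, hb, rfl⟩ := Submodule.mem_sup.1 (h hF)
  have hb' : b ∈ ⨆ (m) (_ : m ≠ n), deg U m := (iSup₂_mono fun m _ => hW m) hb
  have hb'' : b ∈ deg U n := by simpa using sub_mem hn (hW n ha)
  rw [Submodule.disjoint_def.1 (iSupIndep_deg n) b hb'' hb', add_zero]
  exact ha

theorem mem_ghostSpan {n : ℤ} {F : Fun U} (hF : F ∈ funcs U) (hn : F ∈ deg U n) :
    F ∈ ghostSpan U n :=
  mem_of_mem_iSup_of_mem_deg (fun n => (ghostSpan_le n).trans inf_le_right) (funcs_le_iSup hF) hn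

theorem mem_ghostSpanW {n : ℤ} {F : Fun U} (hF : F ∈ funcsW U) (hn : F ∈ deg U n) :
    F ∈ ghostSpanW U n :=
  mem_of_mem_iSup_of_mem_deg (fun n => (ghostSpanW_le n).trans inf_le_right) (funcsW_le_iSup hF) hn

/-- The subalgebra is the sum of its homogeneous parts. -/
def IsGraded (S : Subalgebra ℝ (Fun U)) : Prop :=
  Subalgebra.toSubmodule S ≤ ⨆ n, Subalgebra.toSubmodule S ⊓ deg U n

theorem isGraded_funcs : IsGraded (funcs U) := funcs_le_iSup.trans (iSup_mono ghostSpan_le)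

/-- A homogeneous coboundary has a homogeneous primitive. -/
theorem exists_primitive_mem_deg (e : Frame U) (B : Matrix (Fin d) (Fin d) (SmoothFn U))
    {S : Subalgebra ℝ (Fun U)} (hS : IsGraded S) {n : ℤ} {G : Fun U} (hG : G ∈ S)
    (hn : Q e B G ∈ deg U n) :
    Q e B G ∈ (deg U (n - 1) ⊓ Subalgebra.toSubmodule S).map (Q e B) := by
  refine mem_of_mem_iSup_of_mem_deg
    (W := fun n => (deg U (n - 1) ⊓ Subalgebra.toSubmodule S).map (Q e B)) ?_ ?_ hn
  · intro n
    rintro _ ⟨F, hF, rfl⟩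
    simpa using Q_mem_deg e B hF.1
  · have h := Submodule.mem_map_of_mem (f := Q e B) (hS hG)
    rw [Submodule.map_iSup] at h
    refine (iSup_le fun m => ?_ : (⨆ m, (Subalgebra.toSubmodule S ⊓ deg U m).map (Q e B)) ≤ _) h
    refine le_iSup_of_le (m + 1) ?_
    rw [add_sub_cancel_right, inf_comm]

end Expansion

/-! ### Coefficients of monomials in `β`, `γ` -/

section Coefficients

/-- The superfunctions which do not depend on `β`, `γ`. -/
def consts (U : Opens (Fin d → ℝ)) : Subalgebra ℝ (Fun U) :=
  Algebra.adjoin ℝ (Set.range fn ∪ Set.range odd)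

theorem funcsO_le_consts : funcsO U ≤ consts U := by
  refine Algebra.adjoin_mono (Set.union_subset_union_right _ ?_)
  rintro _ ⟨a, rfl⟩
  exact ⟨_, rfl⟩

theorem gb_mem_consts : gb ∈ consts U := Algebra.subset_adjoin (Or.inr ⟨_, rfl⟩)
theorem gc_mem_consts : gc ∈ consts U := Algebra.subset_adjoin (Or.inr ⟨_, rfl⟩)

theorem exists_eq_single {F : Fun U} (hF : F ∈ consts U) :
    ∃ u : Coef U, F = AddMonoidAlgebra.single 0 u := by
  induction hF using Algebra.adjoin_induction with
  | mem F hF => rcases hF with ⟨g, rfl⟩ | ⟨i, rfl⟩ <;> exact ⟨_, rfl⟩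
  | algebraMap r =>
    refine ⟨r • 1, ?_⟩
    rw [Algebra.algebraMap_eq_smul_one, ← AddMonoidAlgebra.smul_single]
    rfl
  | add F G _ _ hF hG =>
    obtain ⟨u, rfl⟩ := hF
    obtain ⟨v, rfl⟩ := hG
    exact ⟨u + v, (AddMonoidAlgebra.single_add ..).symm⟩
  | mul F G _ _ hF hG =>
    obtain ⟨u, rfl⟩ := hF
    obtain ⟨v, rfl⟩ := hG
    exact ⟨u * v, by rw [AddMonoidAlgebra.single_mul_single, add_zero]⟩

/-- Keep the coefficients of the monomials `β^m γ^l` with `(m, l) = k`, and drop this monomial. -/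
def coeffAt (k : ℕ × ℤ) : Fun U →ₗ[ℝ] Fun U :=
  Finsupp.lsum ℝ (fun k' : ℕ × ℤ => if k' = k then AddMonoidAlgebra.lsingle 0 else 0) ∘ₗ
    (AddMonoidAlgebra.coeffLinearEquiv ℝ).toLinearMap

/-- Drop the monomials with a negative power of `γ`. -/
def dropNeg : Fun U →ₗ[ℝ] Fun U :=
  Finsupp.lsum ℝ (fun k : ℕ × ℤ => if 0 ≤ k.2 then AddMonoidAlgebra.lsingle k else 0) ∘ₗ
    (AddMonoidAlgebra.coeffLinearEquiv ℝ).toLinearMap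

theorem coeffAt_single (k k' : ℕ × ℤ) (u : Coef U) :
    coeffAt k (AddMonoidAlgebra.single k' u) = if k' = k then AddMonoidAlgebra.single 0 u else 0 := by
  simp only [coeffAt, AddMonoidAlgebra.coeffLinearEquiv, LinearMap.comp_apply]
  split_ifs with h <;> simp [h]

theorem dropNeg_single (k : ℕ × ℤ) (u : Coef U) :
    dropNeg (AddMonoidAlgebra.single k u) = if 0 ≤ k.2 then AddMonoidAlgebra.single k u else 0 := by
  simp only [dropNeg, AddMonoidAlgebra.coeffLinearEquiv, LinearMap.comp_apply]
  split_ifs with h <;> simp [h]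

theorem coeffAt_mono (k : ℕ × ℤ) (m : ℕ) (l : ℤ) {F : Fun U} (hF : F ∈ consts U) :
    coeffAt k (mono m l * F) = if (m, l) = k then F else 0 := by
  obtain ⟨u, rfl⟩ := exists_eq_single hF
  rw [mono, AddMonoidAlgebra.single_mul_single, add_zero, one_mul, coeffAt_single]

theorem dropNeg_mono (m : ℕ) (l : ℤ) {F : Fun U} (hF : F ∈ consts U) :
    dropNeg (mono m l * F) = if 0 ≤ l then mono m l * F else 0 := by
  obtain ⟨u, rfl⟩ := exists_eq_single hF
  rw [mono, AddMonoidAlgebra.single_mul_single, add_zero, one_mul, dropNeg_single]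

theorem dropNeg_mul {F : Fun U} (hF : F ∈ consts U) (G : Fun U) :
    dropNeg (F * G) = F * dropNeg G := by
  obtain ⟨u, rfl⟩ := exists_eq_single hF
  refine AddMonoidAlgebra.induction_linear G (by simp) (fun G G' h h' => by
    simp only [mul_add, map_add, h, h']) fun k v => ?_
  rw [AddMonoidAlgebra.single_mul_single, dropNeg_single, dropNeg_single, zero_add]
  split_ifs
  · rw [AddMonoidAlgebra.single_mul_single, zero_add]
  · rw [mul_zero]

theorem gc_mul_eq_zero {F : Fun U} (hF : dL (Sum.inr 1) F = 0) (h : gc * F = 0) : F = 0 := by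
  have h' := congrArg (dL (Sum.inr 1)) h
  simpa [(isOddDer_dL _).mul, hF] using h'

theorem gb_mul_eq_zero {F : Fun U} (hF : dL (Sum.inr 0) F = 0) (h : gb * F = 0) : F = 0 := by
  have h' := congrArg (dL (Sum.inr 0)) h
  simpa [(isOddDer_dL _).mul, hF] using h'

theorem ggamma_mul_cancel {F : Fun U} (h : ggamma * F = 0) : F = 0 := by
  rw [← one_mul F, ← gammaInv_mul_ggamma, mul_assoc, h, mul_zero]

theorem ggamma_sq_mul_cancel {F : Fun U} (h : ggamma ^ 2 * F = 0) : F = 0 := by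
  rw [pow_two, mul_assoc] at h
  exact ggamma_mul_cancel (ggamma_mul_cancel h)

theorem ggamma_sq : (ggamma ^ 2 : Fun U) = mono 0 2 := by
  rw [pow_two, ggamma, mono_mul]; rfl

end Coefficients

/-! ### Normal forms modulo `γ²` and `c` -/

section NormalForm

/-- The elements `γ² w + c v` with `w`, `v` in the subalgebra. -/
def higher (S : Subalgebra ℝ (Fun U)) : Submodule ℝ (Fun U) :=
  (Subalgebra.toSubmodule S).map (LinearMap.mulLeft ℝ (ggamma ^ 2))
    ⊔ (Subalgebra.toSubmodule S).map (LinearMap.mulLeft ℝ gc)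

theorem mem_higher {S : Subalgebra ℝ (Fun U)} {F : Fun U} :
    F ∈ higher S ↔ ∃ w ∈ S, ∃ v ∈ S, F = ggamma ^ 2 * w + gc * v := by
  simp only [higher, Submodule.mem_sup, Submodule.mem_map, Subalgebra.mem_toSubmodule,
    LinearMap.mulLeft_apply]
  constructor
  · rintro ⟨_, ⟨G, hG, rfl⟩, _, ⟨G', hG', rfl⟩, rfl⟩
    exact ⟨G, hG, G', hG', rfl⟩
  · rintro ⟨G, hG, G', hG', rfl⟩
    exact ⟨_, ⟨G, hG, rfl⟩, _, ⟨G', hG', rfl⟩, rfl⟩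

theorem gc_mul_mem_higher {S : Subalgebra ℝ (Fun U)} {F : Fun U} (hF : F ∈ S) :
    gc * F ∈ higher S :=
  mem_higher.2 ⟨0, zero_mem _, F, hF, by rw [mul_zero, zero_add]⟩

theorem mono_add_two_mul_mem_higher (m l : ℕ) {F : Fun U} (hF : F ∈ funcs U) :
    mono m (l + 2) * F ∈ higher (funcs U) :=
  mem_higher.2 ⟨mono m l * F, mul_mem mono_mem hF, 0, zero_mem _, by
    rw [mul_zero, add_zero, ggamma_sq, ← mul_assoc, mono_mul, zero_add, add_comm (2 : ℤ)]⟩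

theorem mono_mul_gc_mul_mem_higher (m l : ℕ) {F : Fun U} (hF : F ∈ funcs U) :
    mono m l * (gc * F) ∈ higher (funcs U) := by
  rw [mul_mul_comm_of_even (inv_mono m l)]
  exact gc_mul_mem_higher (mul_mem mono_mem hF)

variable (e : Frame U) (B : Matrix (Fin d) (Fin d) (SmoothFn U))

/-- Cocycles `γ² w + c v` are coboundaries: the differential maps `-c w` to `γ² w + c Q w`. -/
theorem exists_primitive_of_mem_higher {S : Subalgebra ℝ (Fun U)} (hS : gc ∈ S) {F : Fun U}
    (hF : F ∈ higher S) (hQ : Q e B F = 0) : ∃ G ∈ S, Q e B G = F := by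
  obtain ⟨w, hw, v, -, rfl⟩ := mem_higher.1 hF
  have h1 : Q e B (ggamma ^ 2 * w + gc * v) = -(ggamma ^ 2 * (v - Q e B w)) - gc * Q e B v := by
    rw [map_add, Q_gc_mul, pow_two, mul_assoc, Q_ggamma_mul, Q_ggamma_mul]
    noncomm_ring
  have h2 : ggamma ^ 2 * (gc * (v - Q e B w)) = 0 := by
    have h := congrArg (gc * ·) (h1.symm.trans hQ)
    simp only [mul_sub gc, mul_neg, gc_mul_gc_mul, mul_zero, sub_zero, neg_eq_zero] at h
    rwa [← mul_assoc, pow_two, mul_assoc ggamma, ggamma_comm gc, ← mul_assoc, ggamma_comm gc,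
      mul_assoc gc, mul_assoc gc, ← pow_two]
  have h3 := ggamma_sq_mul_cancel h2
  refine ⟨-(gc * w), neg_mem (mul_mem hS hw), ?_⟩
  rw [map_neg, Q_gc_mul]
  rw [mul_sub, sub_eq_zero] at h3
  rw [h3]
  abel

/-- The element `β^{a₀} m₀ + β^{a₁} b m₁ + γ (β^{a₂} n₀ + β^{a₃} b n₁)`. -/
def normalForm (a₀ a₁ a₂ a₃ : ℕ) (m₀ m₁ n₀ n₁ : Fun U) : Fun U :=
  mono a₀ 0 * m₀ + mono a₁ 0 * (gb * m₁) + mono a₂ 1 * n₀ + mono a₃ 1 * (gb * n₁)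

theorem normalForm_add (a₀ a₁ a₂ a₃ : ℕ) (m₀ m₁ n₀ n₁ m₀' m₁' n₀' n₁' : Fun U) :
    normalForm a₀ a₁ a₂ a₃ (m₀ + m₀') (m₁ + m₁') (n₀ + n₀') (n₁ + n₁')
      = normalForm a₀ a₁ a₂ a₃ m₀ m₁ n₀ n₁ + normalForm a₀ a₁ a₂ a₃ m₀' m₁' n₀' n₁' := by
  simp only [normalForm, mul_add]
  abel

theorem normalForm_sub (a₀ a₁ a₂ a₃ : ℕ) (m₀ m₁ n₀ n₁ m₀' m₁' n₀' n₁' : Fun U) :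
    normalForm a₀ a₁ a₂ a₃ (m₀ - m₀') (m₁ - m₁') (n₀ - n₀') (n₁ - n₁')
      = normalForm a₀ a₁ a₂ a₃ m₀ m₁ n₀ n₁ - normalForm a₀ a₁ a₂ a₃ m₀' m₁' n₀' n₁' := by
  simp only [normalForm, mul_sub]
  abel

theorem normalForm_smul (a₀ a₁ a₂ a₃ : ℕ) (r : ℝ) (m₀ m₁ n₀ n₁ : Fun U) :
    normalForm a₀ a₁ a₂ a₃ (r • m₀) (r • m₁) (r • n₀) (r • n₁)
      = r • normalForm a₀ a₁ a₂ a₃ m₀ m₁ n₀ n₁ := by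
  simp only [normalForm, mul_smul_comm, smul_add]

/-- Every function of ghost number `-k ≤ 0` has a normal form modulo `γ²` and `c`. -/
theorem exists_normalForm (k : ℕ) {F : Fun U} (hF : F ∈ funcs U) (hk : F ∈ deg U (-k)) :
    ∃ m₀ ∈ funcsO U, ∃ m₁ ∈ funcsO U, ∃ n₀ ∈ funcsO U, ∃ n₁ ∈ funcsO U, (k = 0 → m₁ = 0) ∧
      F - normalForm k (k - 1) (k + 1) k m₀ m₁ n₀ n₁ ∈ higher (funcs U) := by
  have h := mem_ghostSpan hF hk
  clear hF hk
  induction h using Submodule.span_induction with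
  | zero =>
    refine ⟨0, zero_mem _, 0, zero_mem _, 0, zero_mem _, 0, zero_mem _, fun _ => rfl, ?_⟩
    simp [normalForm]
  | add F F' _ _ h h' =>
    obtain ⟨m₀, h0, m₁, h1, n₀, h2, n₁, h3, h4, h5⟩ := h
    obtain ⟨m₀', h0', m₁', h1', n₀', h2', n₁', h3', h4', h5'⟩ := h'
    refine ⟨_, add_mem h0 h0', _, add_mem h1 h1', _, add_mem h2 h2', _, add_mem h3 h3',
      fun hk => by rw [h4 hk, h4' hk, add_zero], ?_⟩
    rw [normalForm_add, add_sub_add_comm]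
    exact add_mem h5 h5'
  | smul r F _ h =>
    obtain ⟨m₀, h0, m₁, h1, n₀, h2, n₁, h3, h4, h5⟩ := h
    refine ⟨r • m₀, Subalgebra.smul_mem _ h0 _, r • m₁, Subalgebra.smul_mem _ h1 _, r • n₀,
      Subalgebra.smul_mem _ h2 _, r • n₁, Subalgebra.smul_mem _ h3 _,
      fun hk => by rw [h4 hk, smul_zero], ?_⟩
    rw [normalForm_smul, ← smul_sub]
    exact Submodule.smul_mem _ _ h5
  | mem F hF =>
    obtain ⟨m, l, j, i, x, hx, h, rfl⟩ := hF
    have hx' := funcsO_le_funcs hx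
    rcases j with _ | j
    · rcases i with _ | _ | i
      · rcases l with _ | _ | l
        · obtain rfl : m = k := by lia
          refine ⟨x, hx, 0, zero_mem _, 0, zero_mem _, 0, zero_mem _, fun _ => rfl, ?_⟩
          simp [normalForm]
        · obtain rfl : m = k + 1 := by lia
          refine ⟨0, zero_mem _, 0, zero_mem _, x, hx, 0, zero_mem _, fun _ => rfl, ?_⟩
          simp [normalForm]
        · refine ⟨0, zero_mem _, 0, zero_mem _, 0, zero_mem _, 0, zero_mem _, fun _ => rfl, ?_⟩
          simpa [normalForm, add_assoc, one_add_one_eq_two] using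
            mono_add_two_mul_mem_higher m l hx'
      · rcases l with _ | _ | l
        · obtain rfl : k = m + 1 := by lia
          refine ⟨0, zero_mem _, x, hx, 0, zero_mem _, 0, zero_mem _, fun h => by simp at h, ?_⟩
          simp [normalForm]
        · obtain rfl : m = k := by lia
          refine ⟨0, zero_mem _, 0, zero_mem _, 0, zero_mem _, x, hx, fun _ => rfl, ?_⟩
          simp [normalForm]
        · refine ⟨0, zero_mem _, 0, zero_mem _, 0, zero_mem _, 0, zero_mem _, fun _ => rfl, ?_⟩
          simpa [normalForm, add_assoc, one_add_one_eq_two] using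
            mono_add_two_mul_mem_higher m l (mul_mem gb_mem hx')
      · refine ⟨0, zero_mem _, 0, zero_mem _, 0, zero_mem _, 0, zero_mem _, fun _ => rfl, ?_⟩
        rw [pow_succ', pow_succ', mul_assoc gb, mul_assoc gb, ← mul_assoc gb gb, gb_sq]
        simp [normalForm]
    · refine ⟨0, zero_mem _, 0, zero_mem _, 0, zero_mem _, 0, zero_mem _, fun _ => rfl, ?_⟩
      rw [pow_succ', mul_assoc gc]
      simpa [normalForm] using mono_mul_gc_mul_mem_higher m l
        (mul_mem (pow_mem gc_mem j) (mul_mem (pow_mem gb_mem i) hx'))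

theorem coeffAt_ggamma_sq_mul (m : ℕ) {l : ℤ} (hl : l < 2) {F : Fun U} (hF : F ∈ funcs U) :
    coeffAt (m, l) (ggamma ^ 2 * F) = 0 := by
  have h := funcs_le_iSup hF
  clear hF
  simp only [ghostSpan] at h
  rw [← Submodule.span_iUnion] at h
  induction h using Submodule.span_induction with
  | zero => simp
  | add F F' _ _ h h' => rw [mul_add, map_add, h, h', add_zero]
  | smul r F _ h => rw [mul_smul_comm, map_smul, h, smul_zero]
  | mem F hF =>
    simp only [Set.mem_iUnion] at hF
    obtain ⟨n, m', l', j, i, x, hx, -, rfl⟩ := hF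
    rw [ggamma_sq, ← mul_assoc, mono_mul, coeffAt_mono _ _ _ (mul_mem (pow_mem gc_mem_consts _)
      (mul_mem (pow_mem gb_mem_consts _) (funcsO_le_consts hx))), if_neg]
    simp only [Prod.mk.injEq]
    lia

/-- The coefficients of a normal form are determined modulo `γ²` and `c`: multiplication by `c`, and by
`c b`, isolates them, after which they are the coefficients of distinct monomials in `β`, `γ`. -/
theorem normalForm_unique {a₀ a₁ a₂ a₃ : ℕ} {m₀ m₁ n₀ n₁ : Fun U} (h0 : m₀ ∈ funcsO U)
    (h1 : m₁ ∈ funcsO U) (h2 : n₀ ∈ funcsO U) (h3 : n₁ ∈ funcsO U)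
    (h : normalForm a₀ a₁ a₂ a₃ m₀ m₁ n₀ n₁ ∈ higher (funcs U)) :
    m₀ = 0 ∧ m₁ = 0 ∧ n₀ = 0 ∧ n₁ = 0 := by
  obtain ⟨w, hw, v, hv, h⟩ := mem_higher.1 h
  have hc : mono a₀ 0 * (gc * m₀) + mono a₁ 0 * (gc * (gb * m₁)) + mono a₂ 1 * (gc * n₀)
      + mono a₃ 1 * (gc * (gb * n₁)) = ggamma ^ 2 * (gc * w) := by
    have h' := congrArg (gc * ·) h
    simp only [normalForm, mul_add, gc_mul_gc_mul, add_zero] at h'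
    rw [mul_mul_comm_of_even (F := ggamma ^ 2) (by rw [map_pow, inv_ggamma])]
    simpa only [mul_mul_comm_of_even (inv_mono _ _) gc] using h'
  have hcc : ∀ {x : Fun U}, x ∈ funcsO U → gc * x ∈ consts U := fun hx =>
    mul_mem gc_mem_consts (funcsO_le_consts hx)
  have hcb : ∀ {x : Fun U}, x ∈ funcsO U → gc * (gb * x) ∈ consts U := fun hx =>
    mul_mem gc_mem_consts (mul_mem gb_mem_consts (funcsO_le_consts hx))
  have key : ∀ (a : ℕ) (l : ℤ), l < 2 →
      (if (a₀, 0) = (a, l) then gc * m₀ else 0) + (if (a₁, 0) = (a, l) then gc * (gb * m₁) else 0)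
      + (if (a₂, 1) = (a, l) then gc * n₀ else 0)
      + (if (a₃, 1) = (a, l) then gc * (gb * n₁) else 0) = 0 := by
    intro a l hl
    have h' := congrArg (coeffAt (a, l)) hc
    rw [coeffAt_ggamma_sq_mul a hl (mul_mem gc_mem hw)] at h'
    simpa only [map_add, coeffAt_mono _ _ _ (hcc h0), coeffAt_mono _ _ _ (hcc h2),
      coeffAt_mono _ _ _ (hcb h1), coeffAt_mono _ _ _ (hcb h3)] using h'
  have hm : ∀ {x : Fun U}, x ∈ funcsO U → gb * (gc * x) = 0 → x = 0 := fun hx h =>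
    gc_mul_eq_zero (dL_inr_funcsO _ hx)
      (gb_mul_eq_zero (by simp [(isOddDer_dL _).mul, dL_inr_funcsO _ hx]) h)
  have hn : ∀ {x : Fun U}, x ∈ funcsO U → gc * (gb * x) = 0 → x = 0 := fun hx h =>
    gb_mul_eq_zero (dL_inr_funcsO _ hx)
      (gc_mul_eq_zero (by simp [(isOddDer_dL _).mul, dL_inr_funcsO _ hx]) h)
  have hb : ∀ x : Fun U, gb * (gc * (gb * x)) = 0 := fun x => by
    rw [← mul_assoc, gb_mul_gc, neg_mul, mul_assoc, ← mul_assoc gb, gb_sq, zero_mul, mul_zero,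
      neg_zero]
  have e0 : m₀ = 0 := by
    refine hm h0 ?_
    have h' := congrArg (gb * ·) (key a₀ 0 (by norm_num))
    simpa [mul_add, hb] using h'
  have e2 : n₀ = 0 := by
    refine hm h2 ?_
    have h' := congrArg (gb * ·) (key a₂ 1 (by norm_num))
    simpa [mul_add, hb] using h'
  refine ⟨e0, hn h1 ?_, e2, hn h3 ?_⟩
  · simpa [e0] using key a₁ 0 (by norm_num)
  · simpa [e2] using key a₃ 1 (by norm_num)

end NormalForm

/-! ### The differential of a normal form -/

section QNormalForm

variable (e : Frame U) (B : Matrix (Fin d) (Fin d) (SmoothFn U))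

theorem Q_mono (m : ℕ) (l : ℤ) : Q e B (mono m l)
    = (m : ℝ) • (mono (m - 1) l * (-piFn U + (2 : ℝ) • (ggamma * gb))) := by
  induction m with
  | zero => simp [Q_mono_zero]
  | succ m ih =>
    have h : (mono (m + 1) l : Fun U) = mono m l * gbeta := by
      rw [gbeta, mono_mul, add_zero]
    rw [h, (isOddDer_Q e B).mul, ih, Q_gbeta, inv_mono, smul_mul_assoc, mul_assoc, ← gbeta_comm,
      ← mul_assoc, gbeta, mono_mul, Nat.add_sub_cancel, add_zero]
    rcases m with _ | m
    · simp
    · rw [Nat.add_sub_cancel]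
      push_cast
      module

theorem Q_mono_mul (m : ℕ) (l : ℤ) (F : Fun U) : Q e B (mono m l * F)
    = (m : ℝ) • (mono (m - 1) l * ((-piFn U + (2 : ℝ) • (ggamma * gb)) * F))
      + mono m l * Q e B F := by
  rw [(isOddDer_Q e B).mul, Q_mono, inv_mono, smul_mul_assoc, mul_assoc]

theorem gb_mul_gb_mul (F : Fun U) : gb * (gb * F) = 0 := by rw [← mul_assoc, gb_sq, zero_mul]

theorem pi_mul_pi_mul (F : Fun U) : piFn U * (piFn U * F) = 0 := by
  rw [← mul_assoc, odd_mul_self inv_pi, zero_mul]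

theorem mono_mul_ggamma_mul (m : ℕ) (l : ℤ) (F : Fun U) :
    mono m l * (ggamma * F) = mono m (l + 1) * F := by
  rw [← mul_assoc, ggamma, mono_mul, add_zero]

theorem Q_mem_higher {F : Fun U} (hF : F ∈ higher (funcs U)) : Q e B F ∈ higher (funcs U) := by
  obtain ⟨w, hw, v, hv, rfl⟩ := mem_higher.1 hF
  refine mem_higher.2 ⟨Q e B w - v, subalgebra_sub_mem (Q_mem e B hw) hv, -Q e B v,
    neg_mem (Q_mem e B hv), ?_⟩
  rw [map_add, Q_gc_mul, pow_two, mul_assoc, Q_ggamma_mul, Q_ggamma_mul]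
  noncomm_ring

theorem gb_mul_pi_mul (F : Fun U) : piFn U * (gb * F) = -(gb * (piFn U * F)) := by
  rw [← mul_assoc, odd_anticomm inv_pi inv_gb, neg_mul, mul_assoc]

theorem gb_mul_ggamma_mul (F : Fun U) : gb * (ggamma * F) = ggamma * (gb * F) :=
  (mul_mul_comm_of_even inv_ggamma _ _).symm

theorem Q_gb_mul (F : Fun U) : Q e B (gb * F) = (1 / 2 : ℝ) • (bigR e B * F) - gb * Q e B F := by
  rw [(isOddDer_Q e B).mul, Q_gb, inv_gb, smul_mul_assoc, neg_mul, sub_eq_add_neg]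

/-- The differential modulo `γ²` and `c`, in terms of normal forms. -/
theorem Q_normalForm (k : ℕ) {m₀ m₁ n₀ n₁ : Fun U} (h0 : m₀ ∈ funcsO U)
    (h1 : m₁ ∈ funcsO U) (h2 : n₀ ∈ funcsO U) (h3 : n₁ ∈ funcsO U) :
    Q e B (normalForm k (k - 1) (k + 1) k m₀ m₁ n₀ n₁)
      - normalForm (k - 1) (k - 2) k (k - 1)
        ((1 / 2 : ℝ) • (bigR e B * m₁) - (k : ℝ) • (piFn U * m₀))
        (((k - 1 : ℕ) : ℝ) • (piFn U * m₁))
        (opD e B m₀ - (k + 1 : ℝ) • (piFn U * n₀) + (1 / 2 : ℝ) • (bigR e B * n₁))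
        ((2 * k : ℝ) • m₀ - opD e B m₁ + (k : ℝ) • (piFn U * n₁)) ∈ higher (funcs U) := by
  have hγ : ∀ (m l : ℕ) {F : Fun U}, F ∈ funcs U → mono m (l + 2) * F ∈ higher (funcs U) :=
    fun m l F hF => mono_add_two_mul_mem_higher m l hF
  have hc : ∀ (m l : ℕ) {F : Fun U}, F ∈ funcs U → mono m l * (gc * F) ∈ higher (funcs U) :=
    fun m l F hF => mono_mul_gc_mul_mem_higher m l hF
  have hb : ∀ {F : Fun U}, F ∈ funcs U → gb * F ∈ funcs U := fun hF => mul_mem gb_mem hF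
  have e0 : Q e B (mono k 0 * m₀) - (mono (k - 1) 0 * (-((k : ℝ) • (piFn U * m₀)))
      + mono (k - 1) 1 * (gb * ((2 * k : ℝ) • m₀)) + mono k 1 * opD e B m₀)
      ∈ higher (funcs U) := by
    have h := hc k 0 (funcsO_le_funcs (opH_mem e B h0))
    convert h using 1
    rw [Q_mono_mul, Q_funcsO e B h0]
    simp only [add_mul, mul_add, neg_mul, mul_neg, smul_mul_assoc, mul_smul_comm, mul_assoc,
      mono_mul_ggamma_mul, zero_add, Nat.cast_zero]
    module
  have e1 : Q e B (mono (k - 1) 0 * (gb * m₁)) - (mono (k - 1) 0 * ((1 / 2 : ℝ) • (bigR e B * m₁))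
      + mono (k - 2) 0 * (gb * (((k - 1 : ℕ) : ℝ) • (piFn U * m₁)))
      - mono (k - 1) 1 * (gb * opD e B m₁)) ∈ higher (funcs U) := by
    have h := hc (k - 1) 0 (hb (funcsO_le_funcs (opH_mem e B h1)))
    convert h using 1
    rw [Q_mono_mul, Q_gb_mul, Q_funcsO e B h1, Nat.sub_sub]
    simp only [add_mul, mul_add, neg_mul, mul_neg, smul_mul_assoc, mul_smul_comm, mul_assoc,
      mul_sub, gb_mul_pi_mul, gb_mul_gb_mul, mul_zero, smul_zero, gb_mul_ggamma_mul,
      mono_mul_ggamma_mul, zero_add, Nat.cast_zero]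
    rw [← mul_assoc gb gc, gb_mul_gc]
    simp only [neg_mul, mul_neg, mul_assoc]
    module
  have e2 : Q e B (mono (k + 1) 1 * n₀) - mono k 1 * (-((k + 1 : ℝ) • (piFn U * n₀)))
      ∈ higher (funcs U) := by
    have h := add_mem (add_mem (hγ k 0 (Subalgebra.smul_mem _ (hb (funcsO_le_funcs h2))
      (2 * (k + 1) : ℝ))) (hγ (k + 1) 0 (funcsO_le_funcs (opD_mem e B h2))))
      (hc (k + 1) 1 (funcsO_le_funcs (opH_mem e B h2)))
    convert h using 1
    rw [Q_mono_mul, Q_funcsO e B h2, Nat.add_sub_cancel]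
    simp only [add_mul, mul_add, neg_mul, mul_neg, smul_mul_assoc, mul_smul_comm, mul_assoc,
      mono_mul_ggamma_mul, zero_add, Nat.cast_zero, Nat.cast_one, one_add_one_eq_two]
    push_cast
    module
  have e3 : Q e B (mono k 1 * (gb * n₁)) - (mono k 1 * ((1 / 2 : ℝ) • (bigR e B * n₁))
      + mono (k - 1) 1 * (gb * ((k : ℝ) • (piFn U * n₁)))) ∈ higher (funcs U) := by
    have h := add_mem (hγ k 0 (neg_mem (hb (funcsO_le_funcs (opD_mem e B h3)))))
      (hc k 1 (hb (funcsO_le_funcs (opH_mem e B h3))))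
    convert h using 1
    rw [Q_mono_mul, Q_gb_mul, Q_funcsO e B h3]
    simp only [add_mul, mul_add, neg_mul, mul_neg, smul_mul_assoc, mul_smul_comm, mul_assoc,
      mul_sub, gb_mul_pi_mul, gb_mul_gb_mul, mul_zero, smul_zero, gb_mul_ggamma_mul,
      mono_mul_ggamma_mul, zero_add, Nat.cast_zero, Nat.cast_one, one_add_one_eq_two]
    rw [← mul_assoc gb gc, gb_mul_gc]
    simp only [neg_mul, mul_neg, mul_assoc]
    module
  convert add_mem (add_mem (add_mem e0 e1) e2) e3 using 1
  simp only [normalForm, map_add, mul_add, mul_sub, mul_neg]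
  abel

end QNormalForm

/-! ### The top form `Θ` -/

section TopForm

theorem mul_list_prod_eq_zero {x : Fun U} (hx : inv x = -x) {l : List (Fun U)}
    (hl : ∀ y ∈ l, inv y = -y) (h : x ∈ l) : x * l.prod = 0 := by
  induction l with
  | nil => simp at h
  | cons y l ih =>
    rw [List.prod_cons, ← mul_assoc]
    rcases List.mem_cons.1 h with rfl | h
    · rw [odd_mul_self hx, zero_mul]
    · rw [odd_anticomm hx (hl y (by simp)), neg_mul, mul_assoc,
        ih (fun z hz => hl z (by simp [hz])) h, mul_zero, neg_zero]

theorem theta_mul_Theta (a : Fin d) : theta a * Theta U = 0 := by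
  refine mul_list_prod_eq_zero (inv_theta a) ?_ (List.mem_ofFn.2 ⟨a, rfl⟩)
  intro y hy
  obtain ⟨b, rfl⟩ := List.mem_ofFn.1 hy
  exact inv_theta b

theorem Theta_mem : Theta U ∈ funcsO U := by
  refine list_prod_mem fun y hy => ?_
  obtain ⟨b, rfl⟩ := List.mem_ofFn.1 hy
  exact theta_mem b

theorem pi_mul_Theta : piFn U * Theta U = 0 := by
  rw [piFn, Finset.sum_mul]
  exact Finset.sum_eq_zero fun a _ => by rw [mul_assoc, theta_mul_Theta, mul_zero]

/-- `θ^b ∂_a Θ = δ^b_a Θ`. -/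
theorem theta_mul_dL_Theta (a b : Fin d) :
    theta b * dL (Sum.inl a) (Theta U) = if a = b then Theta U else 0 := by
  have h := congrArg (dL (Sum.inl a)) (theta_mul_Theta (U := U) b)
  rw [(isOddDer_dL _).mul, dL_theta, inv_theta, map_zero, neg_mul, ← sub_eq_add_neg,
    sub_eq_zero] at h
  rw [← h, ite_mul, one_mul, zero_mul]

theorem evenDer_Theta {D : Fun U →ₗ[ℝ] Fun U} (hD : IsEvenDer D) (h : ∀ a, D (theta a) = 0) :
    D (Theta U) = 0 := by
  have key : ∀ l : List (Fun U), (∀ y ∈ l, D y = 0) → D l.prod = 0 := by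
    intro l hl
    induction l with
    | nil => exact hD.one
    | cons y l ih =>
      rw [List.prod_cons, hD.mul, hl y (by simp), ih fun z hz => hl z (by simp [hz]), zero_mul,
        mul_zero, add_zero]
  refine key _ fun y hy => ?_
  obtain ⟨b, rfl⟩ := List.mem_ofFn.1 hy
  exact h b

theorem dP_Theta (a : Fin d) : dP a (Theta U) = 0 := evenDer_Theta (isEvenDer_dP a) (by simp)
theorem dX_Theta (μ : Fin d) : dX μ (Theta U) = 0 := evenDer_Theta (isEvenDer_dX μ) (by simp)

/-- `p² = p_a p_a`. -/
def momSq (U : Opens (Fin d → ℝ)) : Fun U := ∑ a, mom a * mom a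

variable (e : Frame U) (B : Matrix (Fin d) (Fin d) (SmoothFn U))

/-- `{π, π} = 2 p² + N`, where `N` is a sum of terms `W_{ab} θ^a θ^b` with `W_{ab}` even. -/
theorem bigR_decomp : ∃ W : Fin d → Fin d → Fun U, (∀ a b, W a b ∈ funcsO U) ∧
    (∀ a b, inv (W a b) = W a b) ∧
    bigR e B = (2 : ℝ) • momSq U + ∑ a, ∑ b, W a b * (theta a * theta b) := by
  refine ⟨fun a c => bracketPP e B a c
    - (2 : ℝ) • ∑ b, ∑ μ, base (coframe e μ a * connection e b c μ) * mom b, ?_, ?_, ?_⟩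
  · exact fun a c => subalgebra_sub_mem (bracketPP_mem e B a c) (Subalgebra.smul_mem _
      (sum_mem fun b _ => sum_mem fun μ _ => mul_mem (base_mem _) (mom_mem _)) _)
  · simp [inv_bracketPP]
  · have h1 : ∀ a b, mom b * bracketPTheta e a b * theta a
        = -(theta a * bracketPTheta e a b * mom b) := fun a b => by
      rw [mul_assoc, mom_comm, odd_anticomm (inv_bracketPTheta e a b) (inv_theta a), neg_mul]
    have h2 : ∑ a, ∑ b, theta a * bracketPTheta e a b * mom b
        = -∑ a, ∑ c, (∑ b, ∑ μ, base (coframe e μ a * connection e b c μ) * mom b)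
            * (theta a * theta c) := by
      rw [← Finset.sum_neg_distrib]
      refine Finset.sum_congr rfl fun a _ => ?_
      simp only [bracketPTheta, mul_neg, neg_mul, Finset.mul_sum, Finset.sum_mul,
        Finset.sum_neg_distrib, neg_inj]
      symm
      rw [Finset.sum_comm]
      refine Finset.sum_congr rfl fun b _ => ?_
      rw [Finset.sum_comm]
      refine Finset.sum_congr rfl fun μ _ => Finset.sum_congr rfl fun c _ => ?_
      rw [← mom_comm b (theta a * _), mul_assoc (base _), ← mul_mul_comm_of_even (inv_base _) (theta a),
        mul_mul_comm_of_even (inv_mom b) (base _), mul_mul_comm_of_even (inv_mom b) (theta a)]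
    have h3 : ∀ a b, theta a * bracketPP e B a b * theta b
        = bracketPP e B a b * (theta a * theta b) := fun a b => by
      rw [← even_comm (inv_bracketPP e B a b), mul_assoc]
    simp only [bigR, bracket, dX_pi, dP_pi, dL_pi, dR_pi, dL_inr_funcsO _ pi_mem,
      dR_inr_funcsO _ pi_mem, dBeta_funcsO pi_mem, dGamma_funcsO pi_mem, mul_zero, zero_mul,
      sub_zero, add_zero, zero_add, h1, sub_neg_eq_add, Finset.sum_add_distrib, h3,
      Finset.sum_const_zero]
    rw [h2]
    simp only [momSq, sub_mul, Finset.sum_sub_distrib, smul_mul_assoc, ← Finset.smul_sum]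
    module

theorem bigR_mul_dL_Theta (a : Fin d) :
    bigR e B * dL (Sum.inl a) (Theta U) = (2 : ℝ) • (momSq U * dL (Sum.inl a) (Theta U)) := by
  obtain ⟨W, -, -, h⟩ := bigR_decomp e B
  rw [h, add_mul, Finset.sum_mul, smul_mul_assoc, add_eq_left]
  refine Finset.sum_eq_zero fun b _ => ?_
  rw [Finset.sum_mul]
  refine Finset.sum_eq_zero fun c _ => ?_
  rw [mul_assoc, mul_assoc, theta_mul_dL_Theta]
  split_ifs
  · rw [theta_mul_Theta, mul_zero]
  · rw [mul_zero, mul_zero]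

theorem opD_base_mul_Theta (g : SmoothFn U) : opD e B (base g) * Theta U = 0 := by
  rw [opD_base, Finset.sum_mul]
  refine Finset.sum_eq_zero fun μ _ => ?_
  rw [piP_eq, ← base_comm, Finset.mul_sum, Finset.sum_mul]
  exact Finset.sum_eq_zero fun a _ => by
    rw [mul_assoc, mul_assoc, theta_mul_Theta, mul_zero, mul_zero]

theorem opD_Theta : opD e B (Theta U) = (2 : ℝ) • ∑ a, mom a * dL (Sum.inl a) (Theta U) := by
  have h : ∀ a b, theta a * bracketPTheta e a b * dL (Sum.inl b) (Theta U) = 0 := by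
    intro a b
    simp only [bracketPTheta, mul_neg, neg_mul, Finset.mul_sum, Finset.sum_mul]
    rw [neg_eq_zero]
    refine Finset.sum_eq_zero fun μ _ => Finset.sum_eq_zero fun c _ => ?_
    rw [mul_assoc, mul_assoc, theta_mul_dL_Theta]
    split_ifs
    · rw [← mul_mul_comm_of_even (inv_base _), theta_mul_Theta, mul_zero]
    · simp
  rw [opD_eq]
  simp only [bracket, dX_pi, dP_pi, dR_pi, dX_Theta, dP_Theta, dL_inr_funcsO _ Theta_mem,
    dR_inr_funcsO _ pi_mem, dBeta_funcsO pi_mem, dGamma_funcsO pi_mem, mul_zero, zero_mul,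
    sub_zero, add_zero, zero_add, h, Finset.sum_const_zero, Finset.smul_sum]

theorem opH_Theta : opH e B (Theta U) = 0 := by
  have h1 : ∀ a b, bracketPTheta e a b * dL (Sum.inl b) (Theta U) = 0 := by
    intro a b
    simp only [bracketPTheta, neg_mul, Finset.sum_mul, mul_assoc, theta_mul_dL_Theta, mul_ite,
      mul_zero, Finset.sum_ite_eq, Finset.mem_univ, if_true]
    rw [neg_eq_zero]
    refine Finset.sum_eq_zero fun μ _ => ?_
    have h : connection e b b μ = 0 := by
      have h := connection_antisymm e b b μ
      have h2 : (2 : ℝ) • connection e b b μ = 0 := by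
        rw [two_smul]; nth_rw 1 [h]; rw [neg_add_cancel]
      exact (smul_eq_zero.1 h2).resolve_left (by norm_num)
    rw [h, mul_zero, base_zero, zero_mul]
  have h2 : ∀ a, dR (Sum.inl a) (bigR e B) * dL (Sum.inl a) (Theta U) = 0 := by
    intro a
    have h := congrArg (dL (Sum.inl a)) (bigR_mul_dL_Theta e B a)
    have h3 : dL (Sum.inl a) (dL (Sum.inl a) (Theta U)) = 0 :=
      eq_zero_of_eq_neg (dL_comm _ _ _)
    have h4 : dL (Sum.inl a) (momSq U) = 0 := by simp [momSq, (isOddDer_dL _).mul]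
    have h5 : dR (Sum.inl a) (bigR e B) = -dL (Sum.inl a) (bigR e B) := by
      rw [dR_eq, ← neg_inj, ← dL_inv, inv_bigR, neg_neg]
    rw [(isOddDer_dL _).mul, map_smul, (isOddDer_dL _).mul, h3, h4] at h
    rw [h5, neg_mul, neg_eq_zero]
    simpa using h
  rw [opH_eq]
  simp only [bracket, dX_Theta, dP_Theta, dL_inr_funcsO _ Theta_mem, mul_assoc, h1, h2,
    dBeta_funcsO (bigR_mem e B), dGamma_funcsO (bigR_mem e B), mul_zero, zero_mul, smul_zero,
    sub_zero, add_zero, Finset.sum_const_zero]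

theorem bracket_opD_base_Theta (g : SmoothFn U) :
    bracket e B (opD e B (base g)) (Theta U)
      = (2 : ℝ) • ∑ a, ∑ μ, base (coframe e μ a * pd μ g) * dL (Sum.inl a) (Theta U) := by
  have hR : ∀ a, dR (Sum.inl a) (opD e B (base g)) = ∑ μ, base (coframe e μ a * pd μ g) := by
    intro a
    rw [dR_eq, opD_base]
    simp only [piP_eq, map_sum, map_mul, (isOddDer_dL _).mul, dL_base, zero_mul, dL_theta, inv_base,
      zero_add, mul_zero, add_zero, mul_ite, mul_one, Finset.sum_ite_eq, Finset.mem_univ, if_true,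
      base_mul]
  have hP : ∀ a, dP a (opD e B (base g)) = 0 := by
    intro a
    rw [opD_base]
    simp [piP_eq, (isEvenDer_dP _).mul]
  have hm := opD_mem e B (base_mem (U := U) g)
  simp only [bracket, dX_Theta, dP_Theta, hP, hR, dL_inr_funcsO _ Theta_mem, dBeta_funcsO hm,
    dGamma_funcsO hm, mul_zero, zero_mul, sub_zero, add_zero, zero_add, Finset.sum_const_zero,
    Finset.smul_sum, Finset.sum_mul]

theorem opD_base_mul (g : SmoothFn U) :
    opD e B (base g * Theta U) = base g * opD e B (Theta U) := by
  rw [(isOddDer_opD e B).mul, opD_base_mul_Theta, zero_add, inv_base]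

/-- `{π, {π, f Θ}} = π {{π, f}, Θ}`. -/
theorem opH_base_mul_Theta (hB : IsClosedTwoForm B) (g : SmoothFn U) :
    opH e B (base g * Theta U) = piFn U * bracket e B (opD e B (base g)) (Theta U) := by
  rw [(isEvenDer_opH e B).mul, opH_Theta, mul_zero, add_zero, bracket_opD_base_Theta,
    ← opD_opD e B hB (base_mem g)]
  have h := congrArg (opD e B) (opD_base_mul_Theta e B g)
  rw [(isOddDer_opD e B).mul, map_zero] at h
  have hi : inv (opD e B (base g)) = -opD e B (base g) := by
    rw [← neg_inj, neg_neg, ← (isOddDer_opD e B).inv_apply, inv_base]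
  rw [hi, neg_mul, ← sub_eq_add_neg, sub_eq_zero] at h
  have h1 : ∀ a, piFn U * dL (Sum.inl a) (Theta U) = mom a * Theta U := by
    intro a
    simp only [piFn, Finset.sum_mul, mul_assoc, theta_mul_dL_Theta, mul_ite, mul_zero,
      Finset.sum_ite_eq, Finset.mem_univ, if_true]
  have h2 : ∀ a, opD e B (base g) * dL (Sum.inl a) (Theta U)
      = ∑ μ, base (coframe e μ a * pd μ g) * Theta U := by
    intro a
    rw [opD_base, Finset.sum_mul]
    refine Finset.sum_congr rfl fun μ _ => ?_
    rw [piP_eq, ← base_comm, mul_assoc, Finset.sum_mul]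
    simp only [mul_assoc, theta_mul_dL_Theta, mul_ite, mul_zero, Finset.sum_ite_eq,
      Finset.mem_univ, if_true, base_mul]
    rw [mul_mul_comm_of_even (inv_base _)]
  rw [h, opD_Theta, mul_smul_comm, mul_smul_comm]
  refine congrArg _ ?_
  rw [Finset.mul_sum, Finset.mul_sum]
  refine Finset.sum_congr rfl fun a _ => ?_
  rw [← mul_mul_comm_of_even (inv_mom a), h2, Finset.mul_sum, Finset.mul_sum]
  refine Finset.sum_congr rfl fun μ _ => ?_
  rw [mul_mul_comm_of_even (inv_mom a), ← mul_mul_comm_of_even (inv_base _) (piFn U), h1]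

end TopForm

/-! ### The cocycles `X_k(f)` and `Y_k(f)` -/

section Representatives

theorem divBeta_natCast (k : ℕ) :
    (divBeta (k : ℤ) : Fun U) = ((k.factorial : ℝ)⁻¹) • mono k 0 := by
  simp [divBeta]

theorem divBeta_of_neg {k : ℤ} (hk : k < 0) : (divBeta k : Fun U) = 0 := by simp [divBeta, hk]

theorem divBeta_mem (k : ℤ) : (divBeta k : Fun U) ∈ funcs U := by
  rw [divBeta]
  split_ifs
  · exact zero_mem _
  · exact Subalgebra.smul_mem _ (mono_mem (l := 0)) _

theorem divBeta_mem_deg (k : ℤ) {n : ℤ} (h : -k = n) : (divBeta k : Fun U) ∈ deg U n := by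
  rcases lt_or_ge k 0 with hk | hk
  · rw [divBeta_of_neg hk]; exact zero_mem _
  · lift k to ℕ using hk
    rw [divBeta_natCast]
    exact Submodule.smul_mem _ _ (mono_mem_deg k 0 (by lia))

variable (e : Frame U) (B : Matrix (Fin d) (Fin d) (SmoothFn U))

theorem Q_divBeta_mul (k : ℤ) (F : Fun U) : Q e B (divBeta k * F)
    = divBeta (k - 1) * ((-piFn U + (2 : ℝ) • (ggamma * gb)) * F) + divBeta k * Q e B F := by
  rcases lt_or_ge k 0 with hk | hk
  · rw [divBeta_of_neg hk, divBeta_of_neg (by lia)]; simp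
  lift k to ℕ using hk
  rcases k with _ | k
  · rw [divBeta_of_neg (by simp : ((0 : ℕ) : ℤ) - 1 < 0), divBeta_natCast, smul_mul_assoc,
      map_smul, Q_mono_mul]
    simp
  · have h : ((k + 1 : ℕ) : ℤ) - 1 = k := by lia
    rw [h, divBeta_natCast, divBeta_natCast, smul_mul_assoc, map_smul, Q_mono_mul, smul_add,
      smul_smul, smul_mul_assoc, smul_mul_assoc, Nat.add_sub_cancel]
    congr 2
    rw [Nat.factorial_succ]
    push_cast
    field_simp

theorem Q_gammaInv_mul (F : Fun U) : Q e B (gammaInv * F) = gammaInv * Q e B F := by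
  rw [(isOddDer_Q e B).mul, Q_gammaInv, zero_mul, zero_add, inv_gammaInv]

theorem gammaInv_mul_ggamma_mul (F : Fun U) : gammaInv * (ggamma * F) = F := by
  rw [← mul_assoc, gammaInv_mul_ggamma, one_mul]

theorem gammaInv_mul_mul (F G : Fun U) : F * (gammaInv * G) = gammaInv * (F * G) :=
  (mul_mul_comm_of_even inv_gammaInv _ _).symm

theorem ggamma_mul_mul (F G : Fun U) : F * (ggamma * G) = ggamma * (F * G) :=
  (mul_mul_comm_of_even inv_ggamma _ _).symm

theorem divBeta_mul_ggamma_mul (k : ℤ) (F : Fun U) :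
    divBeta k * (ggamma * F) = ggamma * (divBeta k * F) := ggamma_mul_mul _ _

theorem gc_mul_ggamma_mul (F : Fun U) : gc * (ggamma * F) = ggamma * (gc * F) := ggamma_mul_mul _ _

theorem pi_mul_base_mul_Theta (g : SmoothFn U) : piFn U * (base g * Theta U) = 0 := by
  rw [← mul_mul_comm_of_even (inv_base g), pi_mul_Theta, mul_zero]

theorem pi_mul_gc_mul (F : Fun U) : piFn U * (gc * F) = -(gc * (piFn U * F)) := by
  rw [← mul_assoc, odd_anticomm inv_pi inv_gc, neg_mul, mul_assoc]

/-- The differential of `γ⁻¹ β^{[k]} c E`. -/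
theorem Q_gammaInv_divBeta_gc (k : ℤ) {E : Fun U} (hE : E ∈ funcsO U) :
    Q e B (gammaInv * (divBeta k * (gc * E)))
      = gammaInv * (divBeta (k - 1) * (gc * (piFn U * E))) + (2 : ℝ) • (divBeta (k - 1) * (gb * (gc * E)))
        - ggamma * (divBeta k * E) - divBeta k * (gc * opD e B E) := by
  rw [Q_gammaInv_mul, Q_divBeta_mul, Q_gc_mul, Q_funcsO e B hE]
  simp only [add_mul, mul_add, mul_sub, neg_mul, mul_neg, smul_mul_assoc, mul_smul_comm, mul_assoc,
    pi_mul_gc_mul, gc_mul_ggamma_mul, divBeta_mul_ggamma_mul, gc_mul_gc_mul, add_zero,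
    neg_neg, pow_two, gammaInv_mul_ggamma_mul]
  abel

/-- The differential of `γ⁻¹ β^{[k]} E`. -/
theorem Q_gammaInv_divBeta (k : ℤ) {E : Fun U} (hE : E ∈ funcsO U) :
    Q e B (gammaInv * (divBeta k * E))
      = -(gammaInv * (divBeta (k - 1) * (piFn U * E))) + (2 : ℝ) • (divBeta (k - 1) * (gb * E))
        + divBeta k * opD e B E + gammaInv * (divBeta k * (gc * opH e B E)) := by
  rw [Q_gammaInv_mul, Q_divBeta_mul, Q_funcsO e B hE]
  simp only [add_mul, mul_add, neg_mul, mul_neg, smul_mul_assoc, mul_smul_comm, mul_assoc,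
    divBeta_mul_ggamma_mul, gammaInv_mul_ggamma_mul]
  abel

theorem xi_base (k : ℕ) (g : SmoothFn U) :
    xi k (base g) = -(gammaInv * (divBeta k * (gc * (base g * Theta U)))) := by
  simp only [xi, mul_assoc, gammaInv_mul_mul]

theorem eta_base (k : ℕ) (g : SmoothFn U) :
    eta e B k (base g) = gammaInv * (divBeta (k - 1) * (base g * Theta U))
      - gammaInv * (divBeta k * (gc * bracket e B (opD e B (base g)) (Theta U))) := by
  simp only [eta, mul_assoc, opD_eq]

theorem X_base (k : ℕ) (g : SmoothFn U) :
    X e B k (base g) = ggamma * (divBeta k * (base g * Theta U))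
      - (2 : ℝ) • (divBeta (k - 1) * (gb * (gc * (base g * Theta U))))
      + divBeta k * (gc * (base g * opD e B (Theta U))) := by
  rw [X, xi_base, map_neg, Q_gammaInv_divBeta_gc e B _ (mul_mem (base_mem g) Theta_mem),
    pi_mul_base_mul_Theta, opD_base_mul]
  simp only [mul_zero]
  abel

theorem Y_base (hB : IsClosedTwoForm B) (k : ℕ) (g : SmoothFn U) :
    Y e B k (base g) = (2 : ℝ) • (divBeta (k - 2) * (gb * (base g * Theta U)))
      + divBeta (k - 1) * (base g * opD e B (Theta U))
      - ((2 : ℝ) • (divBeta (k - 1) * (gb * (gc * bracket e B (opD e B (base g)) (Theta U))))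
        - ggamma * (divBeta k * bracket e B (opD e B (base g)) (Theta U)))
      + divBeta k * (gc * opD e B (bracket e B (opD e B (base g)) (Theta U))) := by
  rw [Y, eta_base, map_sub, Q_gammaInv_divBeta_gc e B _ (bracket_mem e B (opD_mem e B (base_mem g))
    Theta_mem), Q_gammaInv_divBeta e B _ (mul_mem (base_mem g) Theta_mem),
    pi_mul_base_mul_Theta, opD_base_mul, opH_base_mul_Theta e B hB,
    show (k : ℤ) - 1 - 1 = k - 2 by ring]
  simp only [mul_zero]
  abel

theorem X_base_mem (k : ℕ) (g : SmoothFn U) : X e B k (base g) ∈ funcs U := by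
  have hE := funcsO_le_funcs (mul_mem (base_mem (U := U) g) Theta_mem)
  have hE' := funcsO_le_funcs (mul_mem (base_mem (U := U) g) (opD_mem e B Theta_mem))
  rw [X_base]
  exact add_mem (subalgebra_sub_mem (mul_mem ggamma_mem (mul_mem (divBeta_mem _) hE))
    (Subalgebra.smul_mem _ (mul_mem (divBeta_mem _) (mul_mem gb_mem (mul_mem gc_mem hE))) _))
    (mul_mem (divBeta_mem _) (mul_mem gc_mem hE'))

theorem Y_base_mem (hB : IsClosedTwoForm B) (k : ℕ) (g : SmoothFn U) :
    Y e B k (base g) ∈ funcs U := by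
  have hE := funcsO_le_funcs (mul_mem (base_mem (U := U) g) Theta_mem)
  have hE' := funcsO_le_funcs (mul_mem (base_mem (U := U) g) (opD_mem e B Theta_mem))
  have hm := bracket_mem e B (opD_mem e B (base_mem (U := U) g)) Theta_mem
  have hG := funcsO_le_funcs hm
  have hG' := funcsO_le_funcs (opD_mem e B hm)
  rw [Y_base e B hB]
  exact add_mem (subalgebra_sub_mem (add_mem
      (Subalgebra.smul_mem _ (mul_mem (divBeta_mem _) (mul_mem gb_mem hE)) _)
      (mul_mem (divBeta_mem _) hE'))
    (subalgebra_sub_mem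
      (Subalgebra.smul_mem _ (mul_mem (divBeta_mem _) (mul_mem gb_mem (mul_mem gc_mem hG))) _)
      (mul_mem ggamma_mem (mul_mem (divBeta_mem _) hG))))
    (mul_mem (divBeta_mem _) (mul_mem gc_mem hG'))

theorem X_base_mem_deg (k : ℕ) (g : SmoothFn U) {n : ℤ} (hn : 1 - k = n) :
    X e B k (base g) ∈ deg U n := by
  refine (show (-k : ℤ) + 1 = n by lia) ▸ Q_mem_deg e B ?_
  rw [xi_base]
  exact neg_mem (mul_mem_deg gammaInv_mem_deg (mul_mem_deg (divBeta_mem_deg k rfl)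
    (mul_mem_deg gc_mem_deg (funcsO_deg (mul_mem (base_mem g) Theta_mem)) rfl) rfl) (by lia))

theorem Y_base_mem_deg (k : ℕ) (g : SmoothFn U) {n : ℤ} (hn : 1 - k = n) :
    Y e B k (base g) ∈ deg U n := by
  refine (show (-k : ℤ) + 1 = n by lia) ▸ Q_mem_deg e B ?_
  rw [eta_base]
  exact sub_mem (mul_mem_deg gammaInv_mem_deg (mul_mem_deg (divBeta_mem_deg _ rfl)
    (funcsO_deg (mul_mem (base_mem g) Theta_mem)) rfl) (by lia))
    (mul_mem_deg gammaInv_mem_deg (mul_mem_deg (divBeta_mem_deg k rfl)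
    (mul_mem_deg gc_mem_deg (funcsO_deg (bracket_mem e B (opD_mem e B (base_mem g)) Theta_mem))
      rfl) rfl) (by lia))

theorem X_add (k : ℕ) (f f' : Fun U) : X e B k (f + f') = X e B k f + X e B k f' := by
  simp only [X, xi, mul_add, add_mul, neg_add, map_add]

theorem X_smul (k : ℕ) (r : ℝ) (f : Fun U) : X e B k (r • f) = r • X e B k f := by
  simp only [X, xi, mul_smul_comm, smul_mul_assoc, ← smul_neg, map_smul]

theorem Y_add (k : ℕ) (f f' : Fun U) : Y e B k (f + f') = Y e B k f + Y e B k f' := by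
  simp only [Y, eta, ← opD_eq, map_add, bracket_add_left, mul_add, add_mul, add_sub_add_comm]

theorem Y_smul (k : ℕ) (r : ℝ) (f : Fun U) : Y e B k (r • f) = r • Y e B k f := by
  simp only [Y, eta, ← opD_eq, map_smul, bracket_smul_left, mul_smul_comm, smul_mul_assoc,
    ← smul_sub]

theorem bracket_pi_ggamma_mul (F : Fun U) :
    opD e B (ggamma * F) = ggamma * opD e B F := by
  have h : opD e B ggamma = 0 := by
    rw [opD_eq]
    simp [bracket, dR_inr_funcsO _ pi_mem, dBeta_funcsO pi_mem,
      dGamma_funcsO pi_mem]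
  rw [(isOddDer_opD e B).mul, h, zero_mul, zero_add, inv_ggamma]

theorem opD_gc_mul (F : Fun U) : opD e B (gc * F) = -(gc * opD e B F) := by
  have h : opD e B gc = 0 := by
    rw [opD_eq]
    simp [bracket, dR_inr_funcsO _ pi_mem]
  rw [(isOddDer_opD e B).mul, h, zero_mul, zero_add, inv_gc, neg_mul]

theorem X_ggamma_mul (k : ℕ) (f : Fun U) : X e B k (ggamma * f) = ggamma * X e B k f := by
  rw [X, X, ← Q_ggamma_mul]
  simp only [xi, mul_assoc, mul_neg, ggamma_mul_mul]

theorem Y_ggamma_mul (k : ℕ) (f : Fun U) : Y e B k (ggamma * f) = ggamma * Y e B k f := by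
  rw [Y, Y, ← Q_ggamma_mul, eta, ← opD_eq, bracket_pi_ggamma_mul,
    bracket_mul_left e B (by simp) (by simp) (by simp) Theta_mem, opD_eq]
  simp only [eta, mul_assoc, mul_sub, ggamma_mul_mul]

theorem X_gc_mul (k : ℕ) (f : Fun U) : X e B k (gc * f) = 0 := by
  have h : gc * (gc * f * Theta U) = 0 := by rw [mul_assoc, gc_mul_gc_mul]
  rw [X, xi, mul_assoc, mul_assoc, mul_assoc, h]
  simp

theorem Y_zero_gc_mul (f : Fun U) : Y e B 0 (gc * f) = 0 := by
  rw [Y, eta, ← opD_eq, opD_gc_mul, bracket_neg_left,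
    bracket_mul_left e B (by simp) (by simp) (by simp) Theta_mem, divBeta_of_neg (by simp)]
  simp only [mul_assoc, mul_neg, gc_mul_gc_mul, mul_zero, zero_mul, neg_zero, sub_zero, map_zero]

theorem Y_succ_gc_mul (k : ℕ) (f : Fun U) : Y e B (k + 1) (gc * f) = -X e B k f := by
  rw [Y, X, eta, ← opD_eq, opD_gc_mul, bracket_neg_left,
    bracket_mul_left e B (by simp) (by simp) (by simp) Theta_mem, ← map_neg,
    show ((k + 1 : ℕ) : ℤ) - 1 = k by lia]
  simp only [xi, mul_assoc, mul_neg, gc_mul_gc_mul, mul_zero, neg_zero, sub_zero, gammaInv_mul_mul,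
    neg_neg]

/-- `X_k(f)` and `Y_k(f)` contain no negative powers of `γ`. The explicit formulas show this for
`f ∈ C^∞(U)`; the general case follows since `X_k(c f) = 0`, `Y_{k+1}(c f) = -X_k(f)`, and both are
linear over polynomials in `γ`. -/
theorem X_Y_mem (hB : IsClosedTwoForm B) {f : Fun U} (hf : f ∈ funcsUW U) :
    (∀ k, X e B k f ∈ funcs U) ∧ ∀ k, Y e B k f ∈ funcs U := by
  let T : Submodule ℝ (Fun U) :=
    { carrier := {f | (∀ k, X e B k f ∈ funcs U) ∧ ∀ k, Y e B k f ∈ funcs U}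
      add_mem' := fun h h' => ⟨fun k => by rw [X_add]; exact add_mem (h.1 k) (h'.1 k),
        fun k => by rw [Y_add]; exact add_mem (h.2 k) (h'.2 k)⟩
      zero_mem' := ⟨fun k => by
          have h := X_smul e B k 0 0
          rw [zero_smul, zero_smul] at h
          rw [h]; exact zero_mem _, fun k => by
          have h := Y_smul e B k 0 0
          rw [zero_smul, zero_smul] at h
          rw [h]; exact zero_mem _⟩
      smul_mem' := fun r f h => ⟨fun k => by rw [X_smul]; exact Subalgebra.smul_mem _ (h.1 k) _,
        fun k => by rw [Y_smul]; exact Subalgebra.smul_mem _ (h.2 k) _⟩ }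
  have hγ : ∀ f ∈ T, ggamma * f ∈ T := fun f h =>
    ⟨fun k => by rw [X_ggamma_mul]; exact mul_mem ggamma_mem (h.1 k),
      fun k => by rw [Y_ggamma_mul]; exact mul_mem ggamma_mem (h.2 k)⟩
  have hc : ∀ f ∈ T, gc * f ∈ T := fun f h =>
    ⟨fun k => by rw [X_gc_mul]; exact zero_mem _, fun k => by
      rcases k with _ | k
      · rw [Y_zero_gc_mul]; exact zero_mem _
      · rw [Y_succ_gc_mul]; exact neg_mem (h.1 k)⟩
  -- products with further functions of `x` must be controlled along with `f` itself
  let T' : Submodule ℝ (Fun U) :=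
    { carrier := {f | ∀ g : SmoothFn U, base g * f ∈ T}
      add_mem' := fun h h' g => by rw [mul_add]; exact add_mem (h g) (h' g)
      zero_mem' := fun g => by rw [mul_zero]; exact zero_mem _
      smul_mem' := fun r f h g => by rw [mul_smul_comm]; exact Submodule.smul_mem _ _ (h g) }
  have h1 : (1 : Fun U) ∈ T' := fun g => by
    rw [mul_one]; exact ⟨fun k => X_base_mem e B k g, fun k => Y_base_mem e B hB k g⟩
  have h2 : ∀ F ∈ Set.range base ∪ {gc, ggamma}, ∀ G ∈ T', F * G ∈ T' := by
    rintro _ (⟨f, rfl⟩ | rfl | rfl) G hG g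
    · rw [← mul_assoc, ← base_mul]; exact hG _
    · rw [mul_mul_comm_of_even (inv_base g)]; exact hc _ (hG g)
    · rw [mul_mul_comm_of_even (inv_base g)]; exact hγ _ (hG g)
  have h := adjoin_le_of_mul_mem h1 h2 hf 1
  rwa [base_one, one_mul] at h

end Representatives

/-! ### Integration along the rays in the fibres of `T^*U` -/

section FibreMean

/-- The value of `g` at the point `(x, t p)`, for `z = (x, p)`. -/
def ray (g : SmoothFn (cotangent U)) (z : (Fin d → ℝ) × (Fin d → ℝ)) (t : ℝ) : ℝ :=
  ext (cotangent U) g.1 (z.1, t • z.2)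

theorem ray_apply (g : SmoothFn (cotangent U)) (z : cotangent U) (t : ℝ) :
    ray g z.1 t = g.1 ⟨(z.1.1, t • z.1.2), z.2⟩ :=
  ext_apply (cotangent U) g.1 ⟨(z.1.1, t • z.1.2), z.2⟩

theorem ray_one (g : SmoothFn (cotangent U)) (z : cotangent U) : ray g z.1 1 = g.1 z := by
  rw [ray_apply]
  exact congrArg g.1 (Subtype.ext (Prod.ext rfl (one_smul ℝ z.1.2)))

theorem ray_add (g h : SmoothFn (cotangent U)) (z : cotangent U) (t : ℝ) :
    ray (g + h) z.1 t = ray g z.1 t + ray h z.1 t := by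
  simp only [ray_apply]; rfl

theorem ray_mul (g h : SmoothFn (cotangent U)) (z : cotangent U) (t : ℝ) :
    ray (g * h) z.1 t = ray g z.1 t * ray h z.1 t := by
  simp only [ray_apply]; rfl

theorem ray_smul (r : ℝ) (g : SmoothFn (cotangent U)) (z : cotangent U) (t : ℝ) :
    ray (r • g) z.1 t = r * ray g z.1 t := by
  simp only [ray_apply]; rfl

theorem ray_momentum (a : Fin d) (z : cotangent U) (t : ℝ) :
    ray (momentum U a) z.1 t = t * z.1.2 a := by
  rw [ray_apply]; rfl

theorem contDiffOn_ray (g : SmoothFn (cotangent U)) :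
    ContDiffOn ℝ ∞ (fun q : ((Fin d → ℝ) × (Fin d → ℝ)) × ℝ => ray g q.1 q.2)
      ((cotangent U : Set _) ×ˢ Set.univ) := by
  have hg : ContDiffOn ℝ ∞ (ext (cotangent U) g.1) (cotangent U) := g.2
  refine hg.comp (f := fun q : ((Fin d → ℝ) × (Fin d → ℝ)) × ℝ => (q.1.1, q.2 • q.1.2)) ?_ ?_
  · exact ContDiff.contDiffOn (by fun_prop)
  · exact fun q hq => hq.1

theorem continuous_ray (g : SmoothFn (cotangent U)) (z : cotangent U) :
    Continuous (ray g z.1) := by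
  rw [← continuousOn_univ]
  exact (contDiffOn_ray g).continuousOn.comp (f := fun t => (z.1, t)) (by fun_prop)
    fun t _ => ⟨z.2, trivial⟩

theorem hasDerivAt_ray (g : SmoothFn (cotangent U)) (z : cotangent U) (t : ℝ) :
    HasDerivAt (ray g z.1)
      (∑ a, z.1.2 a * ray (dirDeriv _ (0, Pi.single a 1) g) z.1 t) t := by
  have h1 : HasDerivAt (fun t : ℝ => (z.1.1, t • z.1.2)) ((0 : Fin d → ℝ), z.1.2) t := by
    refine (hasDerivAt_const t z.1.1).prodMk ?_
    simpa using (hasDerivAt_id t).smul_const z.1.2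
  have h2 := (differentiableAt_ext g ⟨(z.1.1, t • z.1.2), z.2⟩).hasFDerivAt.comp_hasDerivAt t h1
  refine h2.congr_deriv ?_
  have h3 : ((0 : Fin d → ℝ), z.1.2)
      = ∑ a, z.1.2 a • ((0 : Fin d → ℝ), (Pi.single a 1 : Fin d → ℝ)) := by
    refine Prod.ext ?_ ?_
    · simp [Prod.fst_sum]
    · simp only [Prod.snd_sum, Prod.smul_snd]
      exact pi_eq_sum_univ' z.1.2 |>.trans (by simp)
  rw [h3, map_sum]
  refine Finset.sum_congr rfl fun a _ => ?_
  rw [map_smul, smul_eq_mul, ray_apply]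
  rfl

open MeasureTheory in
theorem contDiffOn_integral_ray (s : ℕ) (g : SmoothFn (cotangent U)) :
    ContDiffOn ℝ ∞ (fun z => ∫ t in (0 : ℝ)..1, t ^ s * ray g z t) (cotangent U) := by
  let χ : ContDiffBump (0 : ℝ) := ⟨1, 2, one_pos, one_lt_two⟩
  -- the integral is the value at `0` of a convolution with a function of compact support
  let f : ℝ → ℝ := Set.indicator (Set.Ioc 0 1) fun t => t ^ s
  let G : (Fin d → ℝ) × (Fin d → ℝ) → ℝ → ℝ := fun z y => χ y * ray g z (-y)
  have hf : LocallyIntegrable f volume := by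
    refine Integrable.locallyIntegrable ?_
    rw [integrable_indicator_iff measurableSet_Ioc]
    exact ((continuous_pow s).integrableOn_Icc (a := 0) (b := 1)).mono_set Set.Ioc_subset_Icc_self
  have hG : ContDiffOn ℝ ((⊤ : ℕ∞) : WithTop ℕ∞) (Function.uncurry G)
      ((cotangent U : Set _) ×ˢ Set.univ) := by
    refine ContDiffOn.mul ?_ ?_
    · exact (χ.contDiff.comp contDiff_snd).contDiffOn
    · exact (contDiffOn_ray g).comp (f := fun q : ((Fin d → ℝ) × (Fin d → ℝ)) × ℝ => (q.1, -q.2))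
        (ContDiff.contDiffOn (by fun_prop)) fun q hq => ⟨hq.1, trivial⟩
  have h := contDiffOn_convolution_right_with_param_comp (μ := volume) (ContinuousLinearMap.mul ℝ ℝ)
    (v := fun _ => (0 : ℝ)) contDiffOn_const (cotangent U).isOpen
    (isCompact_closedBall (0 : ℝ) 2) (f := f) (g := G) ?_ hf hG
  · refine h.congr fun z hz => ?_
    rw [convolution, intervalIntegral.integral_of_le zero_le_one, ← integral_indicator measurableSet_Ioc]
    refine integral_congr_ae (Filter.Eventually.of_forall fun t => ?_)
    simp only [ContinuousLinearMap.mul_apply', f, G, zero_sub, neg_neg]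
    by_cases ht : t ∈ Set.Ioc (0 : ℝ) 1
    · rw [Set.indicator_of_mem ht, Set.indicator_of_mem ht, χ.one_of_mem_closedBall, one_mul]
      simp only [Metric.mem_closedBall, dist_zero_right, norm_neg, Real.norm_eq_abs, χ]
      exact abs_le.2 ⟨by linarith [ht.1], ht.2⟩
    · rw [Set.indicator_of_notMem ht, Set.indicator_of_notMem ht, zero_mul]
  · intro z y _ hy
    have : χ y = 0 := by
      refine χ.zero_of_le_dist ?_
      rw [Metric.mem_closedBall, not_le] at hy
      exact hy.le
    simp [G, this]

/-- The weighted mean `g ↦ ∫₀¹ t^s g(x, t p) dt` along the rays in the fibres. -/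
def fibreMean (s : ℕ) : SmoothFn (cotangent U) →ₗ[ℝ] SmoothFn (cotangent U) where
  toFun g := ⟨fun z => ∫ t in (0 : ℝ)..1, t ^ s * ray g z.1 t,
    (contDiffOn_ext_iff (cotangent U) _ (fun z => ∫ t in (0 : ℝ)..1, t ^ s * ray g z t)
      fun _ => rfl).2 (contDiffOn_integral_ray s g)⟩
  map_add' g h := SmoothFn.ext fun z => by
    change ∫ t in (0 : ℝ)..1, t ^ s * ray (g + h) z.1 t
      = (∫ t in (0 : ℝ)..1, t ^ s * ray g z.1 t) + ∫ t in (0 : ℝ)..1, t ^ s * ray h z.1 t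
    simp only [ray_add, mul_add]
    exact intervalIntegral.integral_add
      (((continuous_pow s).mul (continuous_ray g z)).intervalIntegrable _ _)
      (((continuous_pow s).mul (continuous_ray h z)).intervalIntegrable _ _)
  map_smul' r g := SmoothFn.ext fun z => by
    change ∫ t in (0 : ℝ)..1, t ^ s * ray (r • g) z.1 t
      = r * ∫ t in (0 : ℝ)..1, t ^ s * ray g z.1 t
    simp only [ray_smul, mul_left_comm _ r]
    exact intervalIntegral.integral_const_mul _ _

theorem fibreMean_apply (s : ℕ) (g : SmoothFn (cotangent U)) (z : cotangent U) :
    (fibreMean s g).1 z = ∫ t in (0 : ℝ)..1, t ^ s * ray g z.1 t := rfl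

theorem fibreMean_momentum_mul (s : ℕ) (a : Fin d) (g : SmoothFn (cotangent U)) :
    fibreMean s (momentum U a * g) = momentum U a * fibreMean (s + 1) g := by
  refine SmoothFn.ext fun z => ?_
  change _ = z.1.2 a * (fibreMean (s + 1) g).1 z
  rw [fibreMean_apply, fibreMean_apply, ← intervalIntegral.integral_const_mul]
  refine intervalIntegral.integral_congr fun t _ => ?_
  simp only [ray_mul, ray_momentum]
  ring

theorem sum_apply_smoothFn {E : Type*} [NormedAddCommGroup E] [NormedSpace ℝ E] {W : Opens E}
    {ι : Type*} (s : Finset ι) (g : ι → SmoothFn W) (z : W) : (∑ i ∈ s, g i).1 z = ∑ i ∈ s, (g i).1 z := by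
  classical
  induction s using Finset.induction_on with
  | empty => rfl
  | insert i s hi ih => rw [Finset.sum_insert hi, Finset.sum_insert hi, ← ih]; rfl

/-- The Euler field `p_a ∂/∂p_a` plus `s + 1` is inverted by the mean with weight `t^s`. -/
theorem fibreMean_euler (s : ℕ) (g : SmoothFn (cotangent U)) :
    fibreMean s (∑ a, momentum U a * dirDeriv _ (0, Pi.single a 1) g + ((s : ℝ) + 1) • g) = g := by
  refine SmoothFn.ext fun z => ?_
  have h : ∀ t ∈ Set.uIcc (0 : ℝ) 1, HasDerivAt (fun t => t ^ (s + 1) * ray g z.1 t)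
      (t ^ s * ray (∑ a, momentum U a * dirDeriv _ (0, Pi.single a 1) g + ((s : ℝ) + 1) • g) z.1 t)
      t := by
    intro t _
    refine ((hasDerivAt_pow (s + 1) t).mul (hasDerivAt_ray g z t)).congr_deriv ?_
    rw [ray_add, ray_smul]
    have : ray (∑ a, momentum U a * dirDeriv _ (0, Pi.single a 1) g) z.1 t
        = t * ∑ a, z.1.2 a * ray (dirDeriv _ (0, Pi.single a 1) g) z.1 t := by
      rw [ray_apply, sum_apply_smoothFn, Finset.mul_sum]
      refine Finset.sum_congr rfl fun a _ => ?_
      rw [← ray_apply _ z t, ray_mul, ray_momentum, mul_assoc]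
    rw [this, Nat.add_sub_cancel]
    push_cast
    ring
  have h' := intervalIntegral.integral_eq_sub_of_hasDerivAt h
    (((continuous_pow s).mul (continuous_ray _ z)).intervalIntegrable _ _)
  rw [fibreMean_apply, h', ray_one]
  simp

/-- Hadamard's lemma along the fibres. -/
theorem exists_eq_pull_add (g : SmoothFn (cotangent U)) : ∃ f : SmoothFn U,
    g = pull f + ∑ a, momentum U a * fibreMean 0 (dirDeriv _ (0, Pi.single a 1) g) := by
  have hg : ContDiffOn ℝ ∞ (ext (cotangent U) g.1) (cotangent U) := g.2
  let f : SmoothFn U := ⟨fun x => g.1 ⟨(x.1, 0), x.2⟩,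
    (contDiffOn_ext_iff U _ (fun x => ext (cotangent U) g.1 (x, 0))
      fun x => (ext_apply (cotangent U) g.1 ⟨(x.1, 0), x.2⟩).symm).2
      (hg.comp (f := fun x : Fin d → ℝ => (x, (0 : Fin d → ℝ))) (ContDiff.contDiffOn (by fun_prop))
        fun _ hx => hx)⟩
  refine ⟨f, SmoothFn.ext fun z => ?_⟩
  have h := intervalIntegral.integral_eq_sub_of_hasDerivAt (a := 0) (b := 1)
    (fun t _ => hasDerivAt_ray g z t) ((continuous_finsetSum _ fun a _ =>
      continuous_const.mul (continuous_ray _ z)).intervalIntegrable _ _)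
  have hi : ∀ a ∈ Finset.univ, IntervalIntegrable (fun t => z.1.2 a
      * ray (dirDeriv _ (0, Pi.single a 1) g) z.1 t) MeasureTheory.volume 0 1 := fun a _ =>
    (continuous_const.mul (continuous_ray _ z)).intervalIntegrable _ _
  rw [intervalIntegral.integral_finsetSum hi, ray_one] at h
  have h0 : ray g z.1 0 = f.1 ⟨z.1.1, z.2⟩ := by
    rw [ray_apply]
    exact congrArg g.1 (Subtype.ext (Prod.ext rfl (zero_smul ℝ z.1.2)))
  change g.1 z = f.1 ⟨z.1.1, z.2⟩
    + (∑ a, momentum U a * fibreMean 0 (dirDeriv _ (0, Pi.single a 1) g)).1 z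
  rw [sum_apply_smoothFn, ← h0, ← sub_eq_iff_eq_add', ← h]
  refine Finset.sum_congr rfl fun a _ => ?_
  change _ = z.1.2 a * (fibreMean 0 _).1 z
  rw [fibreMean_apply, intervalIntegral.integral_const_mul]
  simp only [pow_zero, one_mul]

end FibreMean

/-! ### The Koszul complex of `π` -/

section Koszul

/-- The iterated derivative `∂_{a₁} ⋯ ∂_{aₛ} Θ` for a list `[a₁, …, aₛ]`. -/
def topDeriv (U : Opens (Fin d → ℝ)) : List (Fin d) → Fun U
  | [] => Theta U
  | a :: l => dL (Sum.inl a) (topDeriv U l)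

/-- Functions of `x, p, θ` of degree `d - s` in `θ`. -/
def codegree (U : Opens (Fin d → ℝ)) (s : ℕ) : Submodule ℝ (Fun U) :=
  Submodule.span ℝ {F | ∃ (g : SmoothFn (cotangent U)) (l : List (Fin d)), l.length = s ∧
    F = fn g * topDeriv U l}

theorem topDeriv_mem (l : List (Fin d)) : topDeriv U l ∈ funcsO U := by
  induction l with
  | nil => exact Theta_mem
  | cons a l ih => exact dL_mem _ ih

theorem codegree_le (s : ℕ) : codegree U s ≤ Subalgebra.toSubmodule (funcsO U) := by
  refine Submodule.span_le.2 ?_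
  rintro _ ⟨g, l, -, rfl⟩
  exact Subalgebra.mul_mem _ (fn_mem g) (topDeriv_mem l)

theorem dL_mem_span_topDeriv (a : Fin d) {F : Fun U}
    (hF : F ∈ Submodule.span ℝ (Set.range (topDeriv U))) :
    dL (Sum.inl a) F ∈ Submodule.span ℝ (Set.range (topDeriv U)) := by
  induction hF using Submodule.span_induction with
  | mem F hF =>
    obtain ⟨l, rfl⟩ := hF
    exact Submodule.subset_span ⟨a :: l, rfl⟩
  | zero => rw [map_zero]; exact zero_mem _
  | add F F' _ _ h h' => rw [map_add]; exact add_mem h h'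
  | smul r F _ h => rw [map_smul]; exact Submodule.smul_mem _ _ h

theorem theta_mul_topDeriv_mem (b : Fin d) (l : List (Fin d)) :
    theta b * topDeriv U l ∈ Submodule.span ℝ (Set.range (topDeriv U)) := by
  induction l with
  | nil => rw [topDeriv, theta_mul_Theta]; exact zero_mem _
  | cons a l ih =>
    have h : theta b * topDeriv U (a :: l)
        = (if a = b then topDeriv U l else 0) - dL (Sum.inl a) (theta b * topDeriv U l) := by
      rw [(isOddDer_dL _).mul, dL_theta, inv_theta, topDeriv]
      split_ifs <;> simp
    rw [h]
    refine sub_mem ?_ (dL_mem_span_topDeriv a ih)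
    split_ifs
    · exact Submodule.subset_span ⟨l, rfl⟩
    · exact zero_mem _

theorem dL_list_prod_theta {a : Fin d} {l : List (Fin d)} (ha : a ∉ l) :
    dL (Sum.inl a) ((l.map theta).prod : Fun U) = 0 := by
  induction l with
  | nil => exact (isOddDer_dL _).one
  | cons b l ih =>
    rw [List.mem_cons, not_or] at ha
    rw [List.map_cons, List.prod_cons, (isOddDer_dL _).mul, dL_theta, if_neg ha.1, ih ha.2]
    simp

theorem one_mem_span_topDeriv : (1 : Fun U) ∈ Submodule.span ℝ (Set.range (topDeriv U)) := by
  have key : ∀ l : List (Fin d), l.Nodup →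
      ((l.map theta).prod : Fun U) ∈ Submodule.span ℝ (Set.range (topDeriv U)) →
      (1 : Fun U) ∈ Submodule.span ℝ (Set.range (topDeriv U)) := by
    intro l hl h
    induction l with
    | nil => exact h
    | cons a l ih =>
      rw [List.nodup_cons] at hl
      refine ih hl.2 ?_
      have h' := dL_mem_span_topDeriv a h
      rwa [List.map_cons, List.prod_cons, (isOddDer_dL _).mul, dL_theta, if_pos rfl, one_mul,
        dL_list_prod_theta hl.1, mul_zero, add_zero] at h'
  refine key (List.finRange d) (List.nodup_finRange d) ?_
  rw [← List.ofFn_eq_map]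
  exact Submodule.subset_span ⟨[], rfl⟩

theorem fn_mul_mem_iSup_codegree (g : SmoothFn (cotangent U)) {F : Fun U}
    (hF : F ∈ Submodule.span ℝ (Set.range (topDeriv U))) : fn g * F ∈ ⨆ s, codegree U s := by
  refine mul_mem_of_mem_span ?_ F hF
  rintro _ ⟨l, rfl⟩
  exact Submodule.mem_iSup_of_mem l.length (Submodule.subset_span ⟨g, l, rfl, rfl⟩)

theorem funcsO_le_iSup_codegree : Subalgebra.toSubmodule (funcsO U) ≤ ⨆ s, codegree U s := by
  refine adjoin_le_of_mul_mem ?_ fun F hF => mul_mem_iSup_span ?_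
  · simpa [fn_one] using fn_mul_mem_iSup_codegree (U := U) 1 one_mem_span_topDeriv
  rintro _ _ ⟨g, l, -, rfl⟩
  rcases hF with ⟨f, rfl⟩ | ⟨a, rfl⟩
  · rw [← mul_assoc, ← fn_mul]
    exact fn_mul_mem_iSup_codegree _ (Submodule.subset_span ⟨l, rfl⟩)
  · rw [← mul_mul_comm_of_even (inv_fn g)]
    exact fn_mul_mem_iSup_codegree _ (theta_mul_topDeriv_mem a l)

/-- The number operator `θ^a ∂/∂θ^a`. -/
def number (U : Opens (Fin d → ℝ)) : Module.End ℝ (Fun U) :=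
  ∑ a, LinearMap.mulLeft ℝ (theta a) ∘ₗ dL (Sum.inl a)

/-- The Euler field `p_a ∂/∂p_a`. -/
def euler (U : Opens (Fin d → ℝ)) : Fun U →ₗ[ℝ] Fun U :=
  ∑ a, LinearMap.mulLeft ℝ (mom a) ∘ₗ dP a

/-- The second-order operator `∂²/∂p_a ∂θ^a`. -/
def iota (U : Opens (Fin d → ℝ)) : Fun U →ₗ[ℝ] Fun U := ∑ a, dP a ∘ₗ dL (Sum.inl a)

theorem number_apply (F : Fun U) : number U F = ∑ a, theta a * dL (Sum.inl a) F := by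
  simp [number, LinearMap.sum_apply]

theorem euler_apply (F : Fun U) : euler U F = ∑ a, mom a * dP a F := by
  simp [euler, LinearMap.sum_apply]

theorem iota_apply (F : Fun U) : iota U F = ∑ a, dP a (dL (Sum.inl a) F) := by
  simp [iota, LinearMap.sum_apply]

theorem dL_pi_mul (a : Fin d) (F : Fun U) :
    dL (Sum.inl a) (piFn U * F) = mom a * F - piFn U * dL (Sum.inl a) F := by
  rw [(isOddDer_dL _).mul, dL_pi, inv_pi, neg_mul, sub_eq_add_neg]

/-- The homotopy formula for multiplication by `π`. -/
theorem iota_pi_mul (F : Fun U) :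
    iota U (piFn U * F) + piFn U * iota U F = (d : ℝ) • F + euler U F - number U F := by
  have h : ∀ a, dP a (dL (Sum.inl a) (piFn U * F)) + piFn U * dP a (dL (Sum.inl a) F)
      = F + mom a * dP a F - theta a * dL (Sum.inl a) F := by
    intro a
    rw [dL_pi_mul, map_sub, (isEvenDer_dP a).mul, (isEvenDer_dP a).mul, dP_pi, dP_mom, if_pos rfl,
      one_mul]
    abel
  rw [iota_apply, iota_apply, Finset.mul_sum, ← Finset.sum_add_distrib, Finset.sum_congr rfl
    fun a _ => h a, Finset.sum_sub_distrib, Finset.sum_add_distrib, euler_apply, number_apply]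
  simp [← Nat.cast_smul_eq_nsmul ℝ]

theorem number_pi_mul (F : Fun U) :
    number U (piFn U * F) = piFn U * F + piFn U * number U F := by
  have h : ∀ a, theta a * dL (Sum.inl a) (piFn U * F)
      = mom a * theta a * F + piFn U * (theta a * dL (Sum.inl a) F) := by
    intro a
    rw [dL_pi_mul, mul_sub, ← mul_assoc, ← mom_comm, ← mul_assoc (theta a),
      odd_anticomm (inv_theta a) inv_pi, neg_mul, sub_neg_eq_add, mul_assoc (piFn U)]
  rw [number_apply, number_apply, Finset.sum_congr rfl fun a _ => h a, Finset.sum_add_distrib,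
    ← Finset.sum_mul, ← Finset.mul_sum]
  rfl

theorem number_topDeriv (l : List (Fin d)) :
    number U (topDeriv U l) = ((d : ℝ) - l.length) • topDeriv U l := by
  induction l with
  | nil =>
    simp only [number_apply, topDeriv, theta_mul_dL_Theta]
    simp [← Nat.cast_smul_eq_nsmul ℝ]
  | cons b l ih =>
    have h : ∀ a, theta a * dL (Sum.inl a) (topDeriv U (b :: l))
        = dL (Sum.inl b) (theta a * dL (Sum.inl a) (topDeriv U l))
          - if b = a then dL (Sum.inl a) (topDeriv U l) else 0 := by
      intro a
      rw [topDeriv, (isOddDer_dL _).mul, dL_theta, inv_theta, dL_comm (Sum.inl a)]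
      split_ifs <;> simp
    rw [number_apply, Finset.sum_congr rfl fun a _ => h a, Finset.sum_sub_distrib, ← map_sum,
      ← number_apply, ih, map_smul, Finset.sum_ite_eq, if_pos (Finset.mem_univ _), topDeriv,
      List.length_cons]
    push_cast
    module

theorem number_of_mem_codegree {s : ℕ} {F : Fun U} (hF : F ∈ codegree U s) :
    number U F = ((d : ℝ) - s) • F := by
  induction hF using Submodule.span_induction with
  | zero => simp
  | add F F' _ _ h h' => rw [map_add, h, h', smul_add]
  | smul r F _ h => rw [map_smul, h, smul_comm]
  | mem F hF =>
    obtain ⟨g, l, rfl, rfl⟩ := hF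
    rw [← mul_smul_comm, ← number_topDeriv, number_apply, number_apply, Finset.mul_sum]
    refine Finset.sum_congr rfl fun a _ => ?_
    rw [(isOddDer_dL _).mul, dL_fn, zero_mul, zero_add, inv_fn, mul_mul_comm_of_even (inv_fn g)]

/-- The weighted means along the fibres, acting on superfunctions. -/
def mean (U : Opens (Fin d → ℝ)) (s : ℕ) : Fun U →ₗ[ℝ] Fun U :=
  mapCoef ((fibreMean s).rTensor _)

theorem mean_elt (s : ℕ) (k : ℕ × ℤ) (g : SmoothFn (cotangent U))
    (w : ExteriorAlgebra ℝ (Odd d → ℝ)) : mean U s (elt k g w) = elt k (fibreMean s g) w := by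
  rw [mean, elt, mapCoef_single, LinearMap.rTensor_tmul, elt]

theorem mean_pi_mul (s : ℕ) (F : Fun U) : mean U s (piFn U * F) = piFn U * mean U (s + 1) F := by
  induction F using fun_induction with
  | h0 => simp
  | hadd F G hF hG => simp only [mul_add, map_add, hF, hG]
  | helt k g w =>
    simp only [piFn, Finset.sum_mul, map_sum]
    refine Finset.sum_congr rfl fun a _ => ?_
    rw [mean_elt, mom, fn_eq, theta, odd_eq, elt_mul, elt_mul, elt_mul, mean_elt, mul_one,
      fibreMean_momentum_mul]

theorem elt_smul (r : ℝ) (k : ℕ × ℤ) (g : SmoothFn (cotangent U))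
    (w : ExteriorAlgebra ℝ (Odd d → ℝ)) : elt k (r • g) w = r • elt k g w := by
  rw [elt, ← TensorProduct.smul_tmul', ← AddMonoidAlgebra.smul_single, elt]

theorem elt_sum {ι : Type*} (t : Finset ι) (k : ℕ × ℤ) (g : ι → SmoothFn (cotangent U))
    (w : ExteriorAlgebra ℝ (Odd d → ℝ)) : elt k (∑ i ∈ t, g i) w = ∑ i ∈ t, elt k (g i) w := by
  classical
  induction t using Finset.induction_on with
  | empty => simp [elt]
  | insert i t hi ih => rw [Finset.sum_insert hi, Finset.sum_insert hi, elt_add_left, ih]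

theorem mean_euler (s : ℕ) (F : Fun U) :
    mean U s (euler U F + ((s : ℝ) + 1) • F) = F := by
  induction F using fun_induction with
  | h0 => simp
  | hadd F G hF hG =>
    rw [map_add (euler U), smul_add, add_add_add_comm, map_add, hF, hG]
  | helt k g w =>
    have h : euler U (elt k g w)
        = elt k (∑ a, momentum U a * dirDeriv _ (0, Pi.single a 1) g) w := by
      rw [euler_apply, elt_sum]
      refine Finset.sum_congr rfl fun a _ => ?_
      rw [dP, evenDeriv_elt, mom, fn_eq, elt_mul, zero_add, one_mul]
    rw [h, ← elt_smul, ← elt_add_left, mean_elt, fibreMean_euler]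

theorem exists_topDeriv_eq_elt (l : List (Fin d)) : ∃ w, topDeriv U l = elt 0 1 w := by
  induction l with
  | nil =>
    have key : ∀ l : List (Fin d), ∃ w, ((l.map theta).prod : Fun U) = elt 0 1 w := by
      intro l
      induction l with
      | nil => exact ⟨1, rfl⟩
      | cons a l ih =>
        obtain ⟨w, hw⟩ := ih
        refine ⟨ExteriorAlgebra.ι ℝ (Pi.single (Sum.inl a) 1) * w, ?_⟩
        rw [List.map_cons, List.prod_cons, hw, theta, odd_eq, elt_mul, add_zero, one_mul]
    rw [topDeriv, Theta, List.ofFn_eq_map]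
    exact key _
  | cons a l ih =>
    obtain ⟨w, hw⟩ := ih
    exact ⟨_, by rw [topDeriv, hw, dL_elt]⟩

theorem mean_mem (s : ℕ) {F : Fun U} (hF : F ∈ funcsO U) : mean U s F ∈ funcsO U := by
  have h : (⨆ s, codegree U s) ≤ (Subalgebra.toSubmodule (funcsO U)).comap (mean U s) := by
    refine iSup_le fun j => Submodule.span_le.2 ?_
    rintro _ ⟨g, l, -, rfl⟩
    obtain ⟨w, hw⟩ := exists_topDeriv_eq_elt (U := U) l
    have hm : mean U s (fn g * topDeriv U l) = fn (fibreMean s g) * topDeriv U l := by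
      rw [hw, fn_eq, elt_mul, mean_elt, fn_eq, elt_mul, mul_one, mul_one]
    change mean U s (fn g * topDeriv U l) ∈ funcsO U
    rw [hm]
    exact mul_mem (fn_mem _) (topDeriv_mem l)
  exact h (funcsO_le_iSup_codegree hF)

theorem iota_mem {F : Fun U} (hF : F ∈ funcsO U) : iota U F ∈ funcsO U := by
  rw [iota_apply]
  exact sum_mem fun a _ => dP_mem a (dL_mem _ hF)

/-- The elements `f Θ + π y`, where `f` depends on `x` only. -/
def topOrPi (U : Opens (Fin d → ℝ)) : Submodule ℝ (Fun U) :=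
  (LinearMap.range (baseHom U).toLinearMap).map (LinearMap.mulRight ℝ (Theta U))
    ⊔ (Subalgebra.toSubmodule (funcsO U)).map (LinearMap.mulLeft ℝ (piFn U))

theorem mem_topOrPi {F : Fun U} :
    F ∈ topOrPi U ↔ ∃ f : SmoothFn U, ∃ y ∈ funcsO U, F = base f * Theta U + piFn U * y := by
  simp only [topOrPi, Submodule.mem_sup, Submodule.mem_map, LinearMap.mem_range,
    Subalgebra.mem_toSubmodule]
  constructor
  · rintro ⟨_, ⟨_, ⟨f, rfl⟩, rfl⟩, _, ⟨y, hy, rfl⟩, rfl⟩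
    exact ⟨f, y, hy, rfl⟩
  · rintro ⟨f, y, hy, rfl⟩
    exact ⟨_, ⟨_, ⟨f, rfl⟩, rfl⟩, _, ⟨y, hy, rfl⟩, rfl⟩

theorem pi_mul_dL_Theta (a : Fin d) :
    piFn U * dL (Sum.inl a) (Theta U) = mom a * Theta U := by
  simp only [piFn, Finset.sum_mul, mul_assoc, theta_mul_dL_Theta, mul_ite, mul_zero,
    Finset.sum_ite_eq, Finset.mem_univ, if_true]

/-- In top degree `F = g Θ`, and Hadamard's lemma in `p` expands `g` around the zero section. In
lower degree the homotopy formula shows that `F` is `π` times a fibre mean of `∂²F/∂p_a∂θ^a`. -/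
theorem mem_topOrPi_of_mem_codegree {s : ℕ} {F : Fun U} (hF : F ∈ codegree U s)
    (h : piFn U * F = 0) : F ∈ topOrPi U := by
  rcases s with _ | s
  · refine (Submodule.span_le.2 ?_ : codegree U 0 ≤ topOrPi U) hF
    rintro _ ⟨g, l, hl, rfl⟩
    obtain rfl := List.length_eq_zero_iff.1 hl
    obtain ⟨f, hf⟩ := exists_eq_pull_add g
    refine mem_topOrPi.2 ⟨f, ∑ a, fn (fibreMean 0 (dirDeriv _ (0, Pi.single a 1) g))
      * dL (Sum.inl a) (Theta U), sum_mem fun a _ => mul_mem (fn_mem _) (dL_mem _ Theta_mem), ?_⟩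
    conv_lhs => rw [hf]
    rw [topDeriv, fn_add, fn_sum, add_mul, Finset.sum_mul, Finset.mul_sum]
    refine congrArg₂ _ rfl (Finset.sum_congr rfl fun a _ => ?_)
    rw [fn_mul, ← mul_mul_comm_of_even (inv_fn _), pi_mul_dL_Theta, mul_assoc,
      mul_mul_comm_of_even (inv_fn _)]
    rfl
  · have h1 := iota_pi_mul F
    rw [h, map_zero, zero_add, number_of_mem_codegree hF] at h1
    have h2 : piFn U * iota U F = euler U F + ((s : ℝ) + 1) • F := by
      rw [h1]
      push_cast
      module
    have h3 : F = piFn U * mean U (s + 1) (iota U F) := by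
      rw [← mean_pi_mul, h2, mean_euler]
    refine mem_topOrPi.2 ⟨0, _, mean_mem (s + 1) (iota_mem (codegree_le _ hF)), ?_⟩
    rw [base_zero, zero_mul, zero_add]
    exact h3

/-- Exactness of the Koszul complex of `π`, up to the functions `f Θ`. -/
theorem mem_topOrPi_of_pi_mul_eq_zero {F : Fun U} (hF : F ∈ funcsO U) (h : piFn U * F = 0) :
    F ∈ topOrPi U := by
  obtain ⟨f, hf, rfl⟩ := (Submodule.mem_iSup_iff_exists_finsupp _ _).1 (funcsO_le_iSup_codegree hF)
  have hind : iSupIndep fun s : ℕ => Module.End.eigenspace (number U) ((d : ℝ) - s + 1) :=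
    (Module.End.eigenspaces_iSupIndep (number U)).comp
      (f := fun s : ℕ => (d : ℝ) - s + 1) fun s s' h => by simpa using h
  have h0 : ∀ s ∈ f.support, piFn U * f s = 0 := by
    refine (iSupIndep_iff_finsetSum_eq_zero_imp_eq_zero _).1 hind f.support (fun s => piFn U * f s)
      (fun s _ => ?_) (by rw [← Finset.mul_sum]; exact h)
    rw [Module.End.mem_eigenspace_iff, number_pi_mul, number_of_mem_codegree (hf s), mul_smul_comm]
    module
  exact sum_mem fun s hs => mem_topOrPi_of_mem_codegree (hf s) (h0 s hs)

end Koszul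

/-! ### `{π, π}` is not a zero divisor -/

section Regularity

theorem fn_mul_eq_mapCoef (g : SmoothFn (cotangent U)) (F : Fun U) :
    fn g * F = mapCoef ((LinearMap.mulLeft ℝ g).rTensor _) F := by
  induction F using fun_induction with
  | h0 => simp
  | hadd F G hF hG => rw [mul_add, map_add, hF, hG]
  | helt k h w =>
    rw [fn_eq, elt_mul, zero_add, one_mul, elt, elt, mapCoef_single, LinearMap.rTensor_tmul,
      LinearMap.mulLeft_apply]

/-- A function on `T^*U` that is not a zero divisor among functions stays so among superfunctions,
since the exterior algebra is flat over `ℝ`. -/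
theorem eq_zero_of_fn_mul_eq_zero {g : SmoothFn (cotangent U)}
    (hg : ∀ h : SmoothFn (cotangent U), g * h = 0 → h = 0) {F : Fun U} (hF : fn g * F = 0) :
    F = 0 := by
  have h1 : Function.Injective ((LinearMap.mulLeft ℝ g).rTensor
      (ExteriorAlgebra ℝ (Odd d → ℝ))) :=
    Module.Flat.rTensor_preserves_injective_linearMap _
      ((injective_iff_map_eq_zero _).2 fun h hh => hg h hh)
  rw [fn_mul_eq_mapCoef, mapCoef, LinearMap.comp_apply, LinearMap.comp_apply] at hF
  have hF' := (LinearEquiv.map_eq_zero_iff _).1 hF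
  refine (LinearEquiv.map_eq_zero_iff (AddMonoidAlgebra.coeffLinearEquiv ℝ)).1
    (Finsupp.ext fun k => ?_)
  have h2 := DFunLike.congr_fun hF' k
  rw [Finsupp.mapRange.linearMap_apply, Finsupp.mapRange_apply] at h2
  exact h1 (h2.trans (map_zero _).symm)

/-- `p²` vanishes on the zero section only, whose complement is dense. -/
theorem eq_zero_of_sum_momentum_sq_mul [NeZero d] {h : SmoothFn (cotangent U)}
    (hh : (∑ a, momentum U a * momentum U a) * h = 0) : h = 0 := by
  have hp : ∀ z : cotangent U, z.1.2 ≠ 0 → h.1 z = 0 := by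
    intro z hz
    have h1 : (∑ a, z.1.2 a * z.1.2 a) * h.1 z = 0 := by
      have h2 := congrArg (fun f : SmoothFn (cotangent U) => f.1 z) hh
      rw [Finset.sum_mul] at h2
      simp only [sum_apply_smoothFn] at h2
      rw [Finset.sum_mul]
      exact h2
    refine (mul_eq_zero.1 h1).resolve_left fun h0 => hz (funext fun a => ?_)
    have := (Finset.sum_eq_zero_iff_of_nonneg fun a _ => mul_self_nonneg (z.1.2 a)).1 h0 a
      (Finset.mem_univ a)
    simpa using this
  refine SmoothFn.ext fun z => ?_
  by_cases hz : z.1.2 = 0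
  · -- approach the zero section along a fibre
    let c : ℝ → (Fin d → ℝ) × (Fin d → ℝ) := fun t => (z.1.1, t • Pi.single 0 1)
    have hc : Continuous c := by fun_prop
    have hc0 : c 0 = z.1 := Prod.ext rfl (by simp [c, hz])
    have hcont : ContinuousAt (fun t => ext (cotangent U) h.1 (c t)) 0 := by
      refine ContinuousAt.comp (g := ext (cotangent U) h.1) ?_ hc.continuousAt
      rw [hc0]
      exact (differentiableAt_ext h z).continuousAt
    have hev : ∀ᶠ t in nhdsWithin (0 : ℝ) {0}ᶜ, ext (cotangent U) h.1 (c t) = 0 := by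
      refine eventually_nhdsWithin_of_forall fun t ht => ?_
      have hm : c t ∈ cotangent U := z.2
      rw [ext_apply (cotangent U) h.1 ⟨c t, hm⟩]
      refine hp _ fun h0 => ht ?_
      have := congrFun h0 0
      simpa [c] using this
    have hlim := tendsto_nhds_unique (hcont.tendsto.mono_left nhdsWithin_le_nhds)
      (tendsto_const_nhds.congr' (hev.mono fun _ h => h.symm))
    rw [hc0, ext_apply] at hlim
    exact hlim
  · exact hp z hz

theorem momSq_eq_fn : momSq U = fn (∑ a, momentum U a * momentum U a) := by
  rw [momSq, fn_sum]
  exact Finset.sum_congr rfl fun a _ => (fn_mul _ _).symm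

theorem eq_zero_of_momSq_mul [NeZero d] {F : Fun U} (hF : momSq U * F = 0) : F = 0 :=
  eq_zero_of_fn_mul_eq_zero (fun _ => eq_zero_of_sum_momentum_sq_mul) (momSq_eq_fn (U := U) ▸ hF)

variable (e : Frame U) (B : Matrix (Fin d) (Fin d) (SmoothFn U))

/-- `{π, π}` is `2 p²` up to a nilpotent, hence not a zero divisor. -/
theorem eq_zero_of_bigR_mul [NeZero d] {F : Fun U} (hF : bigR e B * F = 0) : F = 0 := by
  obtain ⟨W, -, hW, hR⟩ := bigR_decomp e B
  have heven : ∀ a b, inv (W a b * (theta a * theta b)) = W a b * (theta a * theta b) := by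
    intro a b
    rw [map_mul, map_mul, hW, inv_theta, inv_theta, neg_mul_neg]
  have hnil : IsNilpotent (∑ a, ∑ b, W a b * (theta a * theta b)) := by
    rw [← Finset.sum_product']
    refine Commute.isNilpotent_sum (fun i _ => ⟨2, ?_⟩) fun i j _ _ => even_comm (heven _ _) _
    have h0 : theta i.1 * theta i.2 * theta i.1 = (0 : Fun U) := by
      rw [theta_anticomm, neg_mul, mul_assoc, odd_mul_self (inv_theta _), mul_zero, neg_zero]
    rw [pow_two, mul_assoc, ← mul_mul_comm_of_even (hW _ _) (theta i.1 * theta i.2),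
      ← mul_assoc (theta i.1 * theta i.2), h0, zero_mul, mul_zero, mul_zero]
  obtain ⟨m, hm⟩ := hnil
  set N := ∑ a, ∑ b, W a b * (theta a * theta b) with hN
  have h1 : (2 : ℝ) • (momSq U * F) = -(N * F) := by
    rw [hR, add_mul, smul_mul_assoc] at hF
    exact eq_neg_of_add_eq_zero_left hF
  have hP : inv (momSq U) = momSq U := by rw [momSq_eq_fn, inv_fn]
  have h2 : ∀ j, j ≤ m → N ^ (m - j) * F = 0 := by
    intro j
    induction j with
    | zero => intro _; rw [Nat.sub_zero, hm, zero_mul]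
    | succ j ih =>
      intro hj
      refine eq_zero_of_momSq_mul ?_
      have h3 := ih (by omega)
      rw [show m - j = m - (j + 1) + 1 by omega, pow_succ, mul_assoc, ← neg_eq_zero, ← mul_neg,
        ← h1, mul_smul_comm, ← mul_mul_comm_of_even hP] at h3
      exact (smul_eq_zero.1 h3).resolve_left two_ne_zero
  simpa using h2 m le_rfl

/-- For `d = 0` the function `{π, π}` vanishes, but then so does `π`. -/
theorem pi_mul_eq_zero_of_bigR_mul {F : Fun U} (hF : bigR e B * (piFn U * F) = 0) :
    piFn U * F = 0 := by
  rcases d with _ | d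
  · simp [piFn]
  · exact eq_zero_of_bigR_mul e B hF

end Regularity

/-! ### Cohomology in negative degrees -/

section Negative

/-- `F` is `β^k m₀ + β^{k-1} b m₁ + γ β^{k+1} n₀ + γ β^k b n₁` modulo `γ²` and `c`, where the
coefficients depend on `x, p, θ`. -/
structure HasNormalForm (k : ℕ) (F m₀ m₁ n₀ n₁ : Fun U) : Prop where
  h0 : m₀ ∈ funcsO U
  h1 : m₁ ∈ funcsO U
  h2 : n₀ ∈ funcsO U
  h3 : n₁ ∈ funcsO U
  mem : F - normalForm k (k - 1) (k + 1) k m₀ m₁ n₀ n₁ ∈ higher (funcs U)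

theorem HasNormalForm.sub {k : ℕ} {F F' m₀ m₁ n₀ n₁ m₀' m₁' n₀' n₁' : Fun U}
    (h : HasNormalForm k F m₀ m₁ n₀ n₁) (h' : HasNormalForm k F' m₀' m₁' n₀' n₁') :
    HasNormalForm k (F - F') (m₀ - m₀') (m₁ - m₁') (n₀ - n₀') (n₁ - n₁') :=
  ⟨subalgebra_sub_mem h.h0 h'.h0, subalgebra_sub_mem h.h1 h'.h1, subalgebra_sub_mem h.h2 h'.h2,
    subalgebra_sub_mem h.h3 h'.h3, by
      rw [normalForm_sub, sub_sub_sub_comm]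
      exact sub_mem h.mem h'.mem⟩

variable (e : Frame U) (B : Matrix (Fin d) (Fin d) (SmoothFn U))

/-- The coboundary of `β^{k+1} a₀ + β^k b a₁ + γ β^{k+2} a₂` modulo `γ²` and `c`. -/
theorem hasNormalForm_Q (k : ℕ) {a₀ a₁ a₂ : Fun U} (h0 : a₀ ∈ funcsO U) (h1 : a₁ ∈ funcsO U)
    (h2 : a₂ ∈ funcsO U) :
    ∃ G ∈ funcs U, HasNormalForm k (Q e B G)
      ((1 / 2 : ℝ) • (bigR e B * a₁) - (k + 1 : ℝ) • (piFn U * a₀))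
      ((k : ℝ) • (piFn U * a₁))
      (opD e B a₀ - (k + 2 : ℝ) • (piFn U * a₂))
      ((2 * (k + 1) : ℝ) • a₀ - opD e B a₁) := by
  refine ⟨normalForm (k + 1) k (k + 2) (k + 1) a₀ a₁ a₂ 0, ?_, ?_, ?_, ?_, ?_, ?_⟩
  · have hb : ∀ {F : Fun U}, F ∈ funcsO U → gb * F ∈ funcs U := fun hF =>
      mul_mem gb_mem (funcsO_le_funcs hF)
    have hm : ∀ m : ℕ, (mono m 0 : Fun U) ∈ funcs U := fun m => mono_mem (l := 0)
    have hm' : ∀ m : ℕ, (mono m 1 : Fun U) ∈ funcs U := fun m => mono_mem (l := 1)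
    exact add_mem (add_mem (add_mem (mul_mem (hm _) (funcsO_le_funcs h0))
      (mul_mem (hm _) (hb h1))) (mul_mem (hm' _) (funcsO_le_funcs h2)))
      (mul_mem (hm' _) (hb (zero_mem _)))
  · exact subalgebra_sub_mem (Subalgebra.smul_mem _ (mul_mem (bigR_mem e B) h1) _)
      (Subalgebra.smul_mem _ (mul_mem pi_mem h0) _)
  · exact Subalgebra.smul_mem _ (mul_mem pi_mem h1) _
  · exact subalgebra_sub_mem (opD_mem e B h0) (Subalgebra.smul_mem _ (mul_mem pi_mem h2) _)
  · exact subalgebra_sub_mem (Subalgebra.smul_mem _ h0 _) (opD_mem e B h1)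
  · have h := Q_normalForm e B (k + 1) h0 h1 h2 (zero_mem _)
    rw [mul_zero, mul_zero, smul_zero, smul_zero, add_zero, add_zero, Nat.add_sub_cancel,
      show k + 1 - 2 = k - 1 by omega] at h
    convert h using 4 <;> push_cast <;> module

/-- The cocycle condition modulo `γ²` and `c`. -/
theorem HasNormalForm.cocycle {k : ℕ} {F m₀ m₁ n₀ n₁ : Fun U}
    (h : HasNormalForm k F m₀ m₁ n₀ n₁) (hF : Q e B F = 0) :
    (1 / 2 : ℝ) • (bigR e B * m₁) - (k : ℝ) • (piFn U * m₀) = 0 ∧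
    opD e B m₀ - (k + 1 : ℝ) • (piFn U * n₀) + (1 / 2 : ℝ) • (bigR e B * n₁) = 0 ∧
    (2 * k : ℝ) • m₀ - opD e B m₁ + (k : ℝ) • (piFn U * n₁) = 0 := by
  have hQ := Q_normalForm e B k h.h0 h.h1 h.h2 h.h3
  have hQ' := Q_mem_higher e B h.mem
  rw [map_sub, hF, zero_sub] at hQ'
  have hu := neg_mem (add_mem hQ hQ')
  rw [sub_add_eq_add_sub, add_neg_cancel, zero_sub, neg_neg] at hu
  have hR := bigR_mem e B
  have := normalForm_unique
    (subalgebra_sub_mem (Subalgebra.smul_mem _ (mul_mem hR h.h1) _)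
      (Subalgebra.smul_mem _ (mul_mem pi_mem h.h0) _))
    (Subalgebra.smul_mem _ (mul_mem pi_mem h.h1) _)
    (add_mem (subalgebra_sub_mem (opD_mem e B h.h0)
      (Subalgebra.smul_mem _ (mul_mem pi_mem h.h2) _))
      (Subalgebra.smul_mem _ (mul_mem hR h.h3) _))
    (add_mem (subalgebra_sub_mem (Subalgebra.smul_mem _ h.h0 _) (opD_mem e B h.h1))
      (Subalgebra.smul_mem _ (mul_mem pi_mem h.h3) _)) hu
  exact ⟨this.1, this.2.2.1, this.2.2.2⟩

theorem hasNormalForm_X (k : ℕ) (f : SmoothFn U) :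
    HasNormalForm k (X e B (k + 1) (base f)) 0 0
      (((k + 1).factorial : ℝ)⁻¹ • (base f * Theta U)) 0 := by
  have hE := mul_mem (base_mem (U := U) f) Theta_mem
  have hE' := mul_mem (base_mem (U := U) f) (opD_mem e B Theta_mem)
  refine ⟨zero_mem _, zero_mem _, Subalgebra.smul_mem _ hE _, zero_mem _, ?_⟩
  have h1 : gc * ((2 : ℝ) • (divBeta k * (gb * (base f * Theta U)))) ∈ higher (funcs U) :=
    gc_mul_mem_higher (Subalgebra.smul_mem _ (mul_mem (divBeta_mem _)
      (mul_mem gb_mem (funcsO_le_funcs hE))) _)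
  have h2 : gc * (divBeta (k + 1 : ℕ) * (base f * opD e B (Theta U))) ∈ higher (funcs U) :=
    gc_mul_mem_higher (mul_mem (divBeta_mem _) (funcsO_le_funcs hE'))
  convert add_mem h1 h2 using 1
  rw [X_base, show ((k + 1 : ℕ) : ℤ) - 1 = k by lia, divBeta_natCast (k + 1), divBeta_natCast]
  simp only [normalForm, mul_zero, add_zero, zero_add,
    mul_smul_comm, smul_mul_assoc, ← mul_mul_comm_of_even (inv_mono _ _) gc]
  rw [← mul_assoc ggamma, ggamma, mono_mul, ← mul_assoc gb gc, gb_mul_gc]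
  simp only [neg_mul, mul_neg, mul_assoc, zero_add, add_zero]
  module

theorem hasNormalForm_Y (hB : IsClosedTwoForm B) (k : ℕ) (g : SmoothFn U) :
    ∃ m₀ n₀, HasNormalForm (k + 1) (Y e B (k + 2) (base g)) m₀
      ((2 * (k.factorial : ℝ)⁻¹) • (base g * Theta U)) n₀ 0 := by
  have hE := mul_mem (base_mem (U := U) g) Theta_mem
  have hE' := mul_mem (base_mem (U := U) g) (opD_mem e B Theta_mem)
  have hm := bracket_mem e B (opD_mem e B (base_mem (U := U) g)) Theta_mem
  set E := bracket e B (opD e B (base g)) (Theta U) with hEdef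
  refine ⟨((k + 1).factorial : ℝ)⁻¹ • (base g * opD e B (Theta U)), ((k + 2).factorial : ℝ)⁻¹ • E,
    Subalgebra.smul_mem _ hE' _, Subalgebra.smul_mem _ hE _, Subalgebra.smul_mem _ hm _,
    zero_mem _, ?_⟩
  have h1 : gc * ((2 : ℝ) • (divBeta (k + 1 : ℕ) * (gb * E))) ∈ higher (funcs U) :=
    gc_mul_mem_higher (Subalgebra.smul_mem _ (mul_mem (divBeta_mem _)
      (mul_mem gb_mem (funcsO_le_funcs hm))) _)
  have h2 : gc * (divBeta (k + 2 : ℕ) * opD e B E) ∈ higher (funcs U) :=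
    gc_mul_mem_higher (mul_mem (divBeta_mem _) (funcsO_le_funcs (opD_mem e B hm)))
  convert add_mem h1 h2 using 1
  rw [Y_base e B hB, ← hEdef, show ((k + 2 : ℕ) : ℤ) - 1 = (k + 1 : ℕ) by lia,
    show ((k + 2 : ℕ) : ℤ) - 2 = k by lia, divBeta_natCast, divBeta_natCast, divBeta_natCast]
  simp only [normalForm, mul_zero, add_zero, Nat.add_sub_cancel,
    mul_smul_comm, smul_mul_assoc, ← mul_mul_comm_of_even (inv_mono _ _) gc]
  rw [← mul_assoc ggamma, ggamma, mono_mul, ← mul_assoc gb gc, gb_mul_gc]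
  simp only [neg_mul, mul_neg, mul_assoc, zero_add, add_zero]
  module

/-- The coefficient of `b` in a cocycle is `g Θ + π y`, hence vanishes after subtracting a cocycle
`Y` and a coboundary. -/
theorem HasNormalForm.exists_sub_Y (hB : IsClosedTwoForm B) {k : ℕ} {F m₀ m₁ n₀ n₁ : Fun U}
    (hN : HasNormalForm (k + 1) F m₀ m₁ n₀ n₁) (hQ : Q e B F = 0) :
    ∃ g : SmoothFn U, ∃ G ∈ funcs U, ∃ a₀ a₂ a₃,
      HasNormalForm (k + 1) (F - Y e B (k + 2) (base g) - Q e B G) a₀ 0 a₂ a₃ := by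
  have hk0 : ((k + 1 : ℕ) : ℝ) ≠ 0 := by positivity
  obtain ⟨g, y, hy, hm₁⟩ :
      ∃ g : SmoothFn U, ∃ y ∈ funcsO U, m₁ = base g * Theta U + piFn U * y := by
    refine mem_topOrPi.1 (mem_topOrPi_of_pi_mul_eq_zero hN.h1 (pi_mul_eq_zero_of_bigR_mul e B ?_))
    -- Multiplied by `π`, the first cocycle equation reads `{π, π} π m₁ = 0`.
    have h := congrArg (piFn U * ·) (hN.cocycle e B hQ).1
    simp only [mul_sub, mul_smul_comm, pi_mul_pi_mul, smul_zero, sub_zero, mul_zero] at h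
    rw [mul_mul_comm_of_even (inv_bigR e B)]
    exact (smul_eq_zero.1 h).resolve_left (by norm_num)
  obtain ⟨G, hG, hN₁⟩ := hasNormalForm_Q e B (k + 1) (zero_mem _)
    (Subalgebra.smul_mem _ hy ((k + 1 : ℕ) : ℝ)⁻¹) (zero_mem _)
  obtain ⟨m₀', n₀', hY⟩ := hasNormalForm_Y e B hB k ((2 * (k.factorial : ℝ)⁻¹)⁻¹ • g)
  have hf : (2 * (k.factorial : ℝ)⁻¹) ≠ 0 := by positivity
  have h0 : m₁ - (2 * (k.factorial : ℝ)⁻¹) • (base ((2 * (k.factorial : ℝ)⁻¹)⁻¹ • g) * Theta U)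
      - ((k + 1 : ℕ) : ℝ) • (piFn U * (((k + 1 : ℕ) : ℝ)⁻¹ • y)) = 0 := by
    rw [base_smul, smul_mul_assoc, smul_smul, mul_inv_cancel₀ hf, one_smul, mul_smul_comm,
      smul_smul, mul_inv_cancel₀ hk0, one_smul, hm₁, add_sub_cancel_left, sub_self]
  have hN := (hN.sub hY).sub hN₁
  rw [h0] at hN
  exact ⟨_, G, hG, _, _, _, hN⟩

/-- The cocycle condition expresses the coefficient of `β^k` through that of `γ β^k b`, and the
coboundary of a multiple of `β^{k+1}` removes both. -/
theorem HasNormalForm.exists_sub_Q {k : ℕ} {F a₀ a₂ a₃ : Fun U}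
    (hN : HasNormalForm (k + 1) F a₀ 0 a₂ a₃) (hQ : Q e B F = 0) :
    ∃ G ∈ funcs U, ∃ a, HasNormalForm (k + 1) (F - Q e B G) 0 0 a 0 := by
  have hk0 : ((k + 1 : ℕ) : ℝ) ≠ 0 := by positivity
  have ha₀ : a₀ = -((1 / 2 : ℝ) • (piFn U * a₃)) := by
    have h := (hN.cocycle e B hQ).2.2
    rw [map_zero, sub_zero] at h
    have h' : ((2 * (k + 1 : ℕ) : ℝ)) • (a₀ + (1 / 2 : ℝ) • (piFn U * a₃)) = 0 := by
      rw [← h]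
      module
    exact eq_neg_of_add_eq_zero_left ((smul_eq_zero.1 h').resolve_left (by positivity))
  obtain ⟨G, hG, hN₂⟩ := hasNormalForm_Q e B (k + 1)
    (Subalgebra.smul_mem _ hN.h3 (2 * ((k + 1 : ℕ) + 1 : ℝ))⁻¹) (zero_mem _) (zero_mem _)
  have hN := hN.sub hN₂
  have hk1 : (2 * ((k + 1 : ℕ) + 1 : ℝ)) ≠ 0 := by positivity
  have h0 : a₀ - ((1 / 2 : ℝ) • (bigR e B * 0) - ((k + 1 : ℕ) + 1 : ℝ)
      • (piFn U * ((2 * ((k + 1 : ℕ) + 1 : ℝ))⁻¹ • a₃))) = 0 := by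
    rw [ha₀, mul_zero, smul_zero, zero_sub, sub_neg_eq_add, mul_smul_comm, smul_smul,
      neg_add_eq_zero]
    congr 1
    field_simp
  rw [h0, smul_smul, mul_inv_cancel₀ hk1, one_smul, map_zero, sub_zero, sub_self, mul_zero,
    smul_zero, sub_zero] at hN
  exact ⟨G, hG, _, hN⟩

/-- The remaining coefficient is annihilated by `π`, hence equal to `f Θ + π y`; the second term is
the coboundary of a multiple of `γ β^{k+2}`. -/
theorem HasNormalForm.exists_eq_X (hB : IsClosedTwoForm B) {k : ℕ} {F a : Fun U}
    (hN : HasNormalForm (k + 1) F 0 0 a 0) (hQ : Q e B F = 0) :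
    ∃ f : SmoothFn U, ∃ G ∈ funcs U, F = X e B (k + 2) (base f) + Q e B G := by
  obtain ⟨f, y, hy, ha⟩ : ∃ f : SmoothFn U, ∃ y ∈ funcsO U,
      a = base f * Theta U + piFn U * y := by
    refine mem_topOrPi.1 (mem_topOrPi_of_pi_mul_eq_zero hN.h2 ?_)
    have h := (hN.cocycle e B hQ).2.1
    rw [map_zero, zero_sub, mul_zero, smul_zero, add_zero, neg_eq_zero] at h
    exact (smul_eq_zero.1 h).resolve_left (by positivity)
  obtain ⟨G, hG, hN₃⟩ := hasNormalForm_Q e B (k + 1) (zero_mem _) (zero_mem _)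
    (Subalgebra.smul_mem _ hy (-((k + 1 : ℕ) + 2 : ℝ)⁻¹))
  have hk2 : ((k + 1 : ℕ) + 2 : ℝ) ≠ 0 := by positivity
  have hf2 : ((k + 1 + 1).factorial : ℝ) ≠ 0 := by positivity
  have h0 : a - ((k + 1 + 1).factorial : ℝ)⁻¹
        • (base (((k + 1 + 1).factorial : ℝ) • f) * Theta U)
      - (opD e B 0 - ((k + 1 : ℕ) + 2 : ℝ) • (piFn U * (-((k + 1 : ℕ) + 2 : ℝ)⁻¹ • y))) = 0 := by
    rw [base_smul, smul_mul_assoc, smul_smul, inv_mul_cancel₀ hf2, one_smul, ha,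
      add_sub_cancel_left, map_zero, zero_sub, mul_smul_comm, smul_smul, mul_neg,
      mul_inv_cancel₀ hk2, neg_smul, one_smul, neg_neg, sub_self]
  have hN := (hN.sub (hasNormalForm_X e B (k + 1) (((k + 1 + 1).factorial : ℝ) • f))).sub hN₃
  rw [h0] at hN
  have h3 := hN.mem
  simp only [map_zero, smul_zero, sub_zero, normalForm, mul_zero, add_zero] at h3
  obtain ⟨G', hG', h4⟩ := exists_primitive_of_mem_higher e B gc_mem h3 (by
    rw [map_sub, map_sub, hQ, X, Q_Q e B hB, Q_Q e B hB, sub_zero, sub_zero])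
  refine ⟨((k + 1 + 1).factorial : ℝ) • f, G + G', add_mem hG hG', ?_⟩
  rw [map_add, h4]
  abel

/-- Cocycles of ghost number `-k < 0` are cohomologous to sums of cocycles `X` and `Y`. -/
theorem exists_eq_X_add_Y (hB : IsClosedTwoForm B) {k : ℕ} (hk : 1 ≤ k) {F : Fun U}
    (hF : F ∈ funcs U) (hd : F ∈ deg U (-k)) (hQ : Q e B F = 0) :
    ∃ f g : SmoothFn U, ∃ G ∈ funcs U,
      F = X e B (k + 1) (base f) + Y e B (k + 1) (base g) + Q e B G := by
  obtain ⟨k, rfl⟩ : ∃ k', k = k' + 1 := ⟨k - 1, by omega⟩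
  obtain ⟨m₀, h0, m₁, h1, n₀, h2, n₁, h3, -, h⟩ := exists_normalForm _ hF hd
  have hN : HasNormalForm (k + 1) F m₀ m₁ n₀ n₁ := ⟨h0, h1, h2, h3, h⟩
  obtain ⟨g, G₁, hG₁, a₀, a₂, a₃, hN₁⟩ := hN.exists_sub_Y e B hB hQ
  have hQ₁ : Q e B (F - Y e B (k + 2) (base g) - Q e B G₁) = 0 := by
    rw [map_sub, map_sub, hQ, Y, Q_Q e B hB, Q_Q e B hB, sub_zero, sub_zero]
  obtain ⟨G₂, hG₂, a, hN₂⟩ := hN₁.exists_sub_Q e B hQ₁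
  obtain ⟨f, G₃, hG₃, h3⟩ := hN₂.exists_eq_X e B hB (by rw [map_sub, hQ₁, Q_Q e B hB, sub_zero])
  refine ⟨f, g, G₁ + G₂ + G₃, add_mem (add_mem hG₁ hG₂) hG₃, ?_⟩
  rw [sub_eq_iff_eq_add, sub_eq_iff_eq_add, sub_eq_iff_eq_add] at h3
  rw [h3, map_add, map_add]
  abel

end Negative

/-! ### Division by `γ` -/

section Division

variable (e : Frame U) (B : Matrix (Fin d) (Fin d) (SmoothFn U))

/-- On functions of `x, p, θ, c, γ`, dividing by `γ²` and dropping negative powers of `γ` stays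
inside the algebra. -/
theorem dropNeg_div_mem {G : Fun U} (hG : G ∈ funcsW U) :
    dropNeg (mono 0 (-2) * G) ∈ funcsW U := by
  have h : ⨆ n, ghostSpanW U n ≤ (Subalgebra.toSubmodule (funcsW U)).comap
      (dropNeg ∘ₗ LinearMap.mulLeft ℝ (mono 0 (-2))) := by
    refine iSup_le fun n => Submodule.span_le.2 ?_
    rintro _ ⟨l, j, x, hx, -, rfl⟩
    change dropNeg (mono 0 (-2) * (mono 0 l * (gc ^ j * x))) ∈ funcsW U
    rw [← mul_assoc, mono_mul, zero_add,
      dropNeg_mono _ _ (mul_mem (pow_mem gc_mem_consts _) (funcsO_le_consts hx))]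
    split_ifs with hl
    · obtain ⟨l', hl'⟩ := Int.eq_ofNat_of_zero_le hl
      rw [hl']
      exact mul_mem mono_mem_W (mul_mem (pow_mem gc_mem_W _) (funcsO_le_funcsW hx))
    · exact zero_mem _
  exact h (funcsW_le_iSup hG)

theorem dropNeg_eq_self {G : Fun U} (hG : G ∈ funcsW U) : dropNeg G = G := by
  have h : ⨆ n, ghostSpanW U n ≤ LinearMap.eqLocus (dropNeg : Fun U →ₗ[ℝ] Fun U) LinearMap.id := by
    refine iSup_le fun n => Submodule.span_le.2 ?_
    rintro _ ⟨l, j, x, hx, -, rfl⟩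
    change dropNeg (mono 0 l * (gc ^ j * x)) = mono 0 l * (gc ^ j * x)
    rw [dropNeg_mono _ _ (mul_mem (pow_mem gc_mem_consts _) (funcsO_le_consts hx)),
      if_pos (by simp)]
  exact h (funcsW_le_iSup hG)

/-- `γ` is not a zero divisor modulo the ideal `(π, {π, π})`. -/
theorem mem_zeroLocus_of_ggamma_sq_mul {F : Fun U} (hF : F ∈ funcsW U)
    (h : ggamma ^ 2 * F ∈ zeroLocus e B) : F ∈ zeroLocus e B := by
  obtain ⟨G, hG, G', hG', h⟩ := (mem_zeroLocus e B).1 h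
  refine (mem_zeroLocus e B).2 ⟨_, dropNeg_div_mem hG, _, dropNeg_div_mem hG', ?_⟩
  have h1 := congrArg (fun x => dropNeg (mono 0 (-2) * x)) h
  simp only [mul_add, map_add, mul_mul_comm_of_even (inv_mono 0 (-2))] at h1
  rw [dropNeg_mul (funcsO_le_consts pi_mem), dropNeg_mul (funcsO_le_consts (bigR_mem e B)),
    ← mul_mul_comm_of_even (inv_mono 0 (-2)), ← mul_assoc, ggamma_sq, mono_mul] at h1
  rw [← h1, show ((-2 : ℤ) + 2) = 0 by norm_num, mono_zero, one_mul, dropNeg_eq_self hF]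

theorem gc_mul_mem_zeroLocus {F : Fun U} (hF : F ∈ zeroLocus e B) : gc * F ∈ zeroLocus e B := by
  obtain ⟨G, hG, G', hG', rfl⟩ := (mem_zeroLocus e B).1 hF
  refine (mem_zeroLocus e B).2 ⟨-(gc * G), neg_mem (mul_mem gc_mem_W hG), gc * G',
    mul_mem gc_mem_W hG', ?_⟩
  rw [mul_add, ← mul_mul_comm_of_even (inv_bigR e B), mul_neg, pi_mul_gc_mul, neg_neg]

/-- If `γ² w + c v` is a cocycle modulo `(π, {π, π})`, then `v = Q w` modulo `c` and the ideal. -/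
theorem gc_mul_sub_mem_zeroLocus {w v : Fun U} (hw : w ∈ funcsW U) (hv : v ∈ funcsW U)
    (h : Q e B (ggamma ^ 2 * w + gc * v) ∈ zeroLocus e B) :
    gc * (v - Q e B w) ∈ zeroLocus e B := by
  refine mem_zeroLocus_of_ggamma_sq_mul e B
    (mul_mem gc_mem_W (subalgebra_sub_mem hv (Q_mem_W e B hw))) ?_
  have h1 : ggamma ^ 2 * (gc * (v - Q e B w)) = -(gc * Q e B (ggamma ^ 2 * w + gc * v)) := by
    rw [map_add, Q_gc_mul, pow_two, mul_assoc, mul_assoc, Q_ggamma_mul, Q_ggamma_mul]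
    simp only [mul_add, mul_sub, mul_neg, gc_mul_gc_mul, mul_assoc, gc_mul_ggamma_mul, sub_zero]
    abel
  rw [h1]
  exact neg_mem (gc_mul_mem_zeroLocus e B h)

/-- The coefficient of `γ` and no `c`. -/
def gammaCoeff (U : Opens (Fin d → ℝ)) : Fun U →ₗ[ℝ] Fun U :=
  dL (Sum.inr 1) ∘ₗ LinearMap.mulLeft ℝ gc ∘ₗ coeffAt (0, 1)

theorem gammaCoeff_apply (F : Fun U) :
    gammaCoeff U F = dL (Sum.inr 1) (gc * coeffAt (0, 1) F) := rfl

theorem gammaCoeff_mono_mul (l j : ℕ) {x : Fun U} (hx : x ∈ funcsO U) :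
    gammaCoeff U (mono 0 l * (gc ^ j * x)) = if l = 1 ∧ j = 0 then x else 0 := by
  rw [gammaCoeff_apply,
    coeffAt_mono _ _ _ (mul_mem (pow_mem gc_mem_consts _) (funcsO_le_consts hx))]
  rcases j with _ | j
  · by_cases hl : l = 1
    · simp [hl, (isOddDer_dL _).mul, dL_inr_funcsO _ hx]
    · simp [hl]
  · rw [pow_succ', mul_assoc]
    split_ifs <;> simp_all [gc_mul_gc_mul]

theorem gammaCoeff_mem {G : Fun U} (hG : G ∈ funcsW U) : gammaCoeff U G ∈ funcsO U := by
  have h : ⨆ n, ghostSpanW U n ≤ (Subalgebra.toSubmodule (funcsO U)).comap (gammaCoeff U) := by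
    refine iSup_le fun n => Submodule.span_le.2 ?_
    rintro _ ⟨l, j, x, hx, -, rfl⟩
    change gammaCoeff U (mono 0 l * (gc ^ j * x)) ∈ funcsO U
    rw [gammaCoeff_mono_mul l j hx]
    split_ifs
    · exact hx
    · exact zero_mem _
  exact h (funcsW_le_iSup hG)

theorem coeffAt_mul (k : ℕ × ℤ) {F : Fun U} (hF : F ∈ consts U) (G : Fun U) :
    coeffAt k (F * G) = F * coeffAt k G := by
  obtain ⟨u, rfl⟩ := exists_eq_single hF
  refine AddMonoidAlgebra.induction_linear G (by simp) (fun G G' h h' => by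
    simp only [mul_add, map_add, h, h']) fun k' v => ?_
  rw [AddMonoidAlgebra.single_mul_single, coeffAt_single, coeffAt_single, zero_add]
  split_ifs
  · rw [AddMonoidAlgebra.single_mul_single, zero_add]
  · rw [mul_zero]

theorem gammaCoeff_mul {F : Fun U} (hF : F ∈ funcsO U) (G : Fun U) :
    gammaCoeff U (F * G) = F * gammaCoeff U G := by
  rw [gammaCoeff_apply, gammaCoeff_apply, coeffAt_mul _ (funcsO_le_consts hF), ← mul_assoc,
    odd_comm inv_gc, mul_assoc, (isOddDer_dL _).mul (inv F), inv_inv,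
    dL_inr_funcsO _ (inv_mem_funcsO hF), zero_mul, zero_add]

end Division

/-! ### Cohomology in positive degrees -/

section Positive

variable (e : Frame U) (B : Matrix (Fin d) (Fin d) (SmoothFn U))

theorem exists_eq_sq_add {n : ℤ} (hn : 2 ≤ n) {F : Fun U} (hF : F ∈ funcsW U) (hd : F ∈ deg U n) :
    ∃ w ∈ funcsW U, ∃ v ∈ funcsW U, v ∈ deg U (n - 1) ∧ w ∈ deg U (n - 2) ∧
      F = ggamma ^ 2 * w + gc * v := by
  have h := mem_ghostSpanW hF hd
  clear hF hd
  induction h using Submodule.span_induction with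
  | zero => exact ⟨0, zero_mem _, 0, zero_mem _, zero_mem _, zero_mem _, by simp⟩
  | add F F' _ _ h h' =>
    obtain ⟨w, hw, v, hv, hvd, hwd, rfl⟩ := h
    obtain ⟨w', hw', v', hv', hvd', hwd', rfl⟩ := h'
    refine ⟨w + w', add_mem hw hw', v + v', add_mem hv hv', add_mem hvd hvd', add_mem hwd hwd', ?_⟩
    rw [mul_add, mul_add, add_add_add_comm]
  | smul r F _ h =>
    obtain ⟨w, hw, v, hv, hvd, hwd, rfl⟩ := h
    refine ⟨r • w, Subalgebra.smul_mem _ hw _, r • v, Subalgebra.smul_mem _ hv _,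
      Submodule.smul_mem _ _ hvd, Submodule.smul_mem _ _ hwd, ?_⟩
    rw [mul_smul_comm, mul_smul_comm, smul_add]
  | mem F hF =>
    obtain ⟨l, j, x, hx, h, rfl⟩ := hF
    rcases j with _ | j
    · obtain ⟨l, rfl⟩ : ∃ l', l = l' + 2 := ⟨l - 2, by lia⟩
      refine ⟨mono 0 l * x, mul_mem mono_mem_W (funcsO_le_funcsW hx), 0, zero_mem _, zero_mem _,
        mul_mem_deg (mono_mem_deg 0 l rfl) (funcsO_deg hx) (by push_cast at h ⊢; lia), ?_⟩
      rw [pow_zero, one_mul, ggamma_sq, mul_zero, add_zero, ← mul_assoc, mono_mul, zero_add,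
        Nat.cast_add, add_comm (l : ℤ)]
      rfl
    · refine ⟨0, zero_mem _, mono 0 l * (gc ^ j * x), mul_mem mono_mem_W
        (mul_mem (pow_mem gc_mem_W _) (funcsO_le_funcsW hx)), mul_mem_deg (mono_mem_deg 0 l rfl)
        (mul_mem_deg (pow_mem_deg gc_mem_deg j) (funcsO_deg hx) rfl) (by push_cast at h ⊢; lia),
        zero_mem _, ?_⟩
      rw [pow_succ', mul_assoc gc, mul_zero, zero_add, mul_mul_comm_of_even (inv_mono 0 l)]

/-- An element of degree at least two is `γ² w + c v`, and differs from `-Q(c w)` by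
`c (v - Q w)`, which is in the ideal if the element is a cocycle modulo the ideal. -/
theorem subsingleton_Hred {n : ℤ} (hn : 2 ≤ n) : Subsingleton (Hred e B n) := by
  rw [Submodule.Quotient.subsingleton_iff, eq_top_iff]
  rintro ⟨F, ⟨hd, hF⟩, hQ⟩ -
  obtain ⟨w, hw, v, hv, hvd, hwd, rfl⟩ := exists_eq_sq_add hn hF hd
  refine Submodule.mem_sup.2 ⟨ggamma ^ 2 * w + gc * Q e B w, ⟨-(gc * w), ⟨?_, ?_⟩, ?_⟩,
    gc * (v - Q e B w), ⟨?_, gc_mul_sub_mem_zeroLocus e B hw hv hQ⟩, ?_⟩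
  · exact neg_mem (mul_mem_deg gc_mem_deg hwd (by ring))
  · exact Subalgebra.neg_mem _ (mul_mem gc_mem_W hw)
  · rw [map_neg, Q_gc_mul]
    abel
  · refine mul_mem_deg gc_mem_deg (sub_mem hvd ?_) (add_sub_cancel 1 n)
    exact (show n - 2 + 1 = n - 1 by ring) ▸ Q_mem_deg e B hwd
  · change ggamma ^ 2 * w + gc * Q e B w + gc * (v - Q e B w) = ggamma ^ 2 * w + gc * v
    rw [mul_sub]
    abel

theorem mem_higher_of_two_le {n : ℤ} (hn : 2 ≤ n) {F : Fun U} (hF : F ∈ funcs U)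
    (hd : F ∈ deg U n) : F ∈ higher (funcs U) := by
  refine (Submodule.span_le.2 ?_ : ghostSpan U n ≤ higher (funcs U)) (mem_ghostSpan hF hd)
  rintro _ ⟨m, l, j, i, x, hx, h, rfl⟩
  have hx' := mul_mem (pow_mem gb_mem i) (funcsO_le_funcs hx)
  rcases j with _ | j
  · obtain ⟨l, rfl⟩ : ∃ l', l = l' + 2 := ⟨l - 2, by lia⟩
    rw [pow_zero, one_mul]
    exact mono_add_two_mul_mem_higher m l hx'
  · rw [pow_succ', mul_assoc gc]
    exact mono_mul_gc_mul_mem_higher m l (mul_mem (pow_mem gc_mem j) hx')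

theorem mem_coboundaries_of_mem_higher {n : ℤ} {F : Fun U} (hF : F ∈ higher (funcs U))
    (hd : F ∈ deg U n) (hQ : Q e B F = 0) :
    F ∈ coboundaries (Q e B) (deg U) (Subalgebra.toSubmodule (funcs U)) ⊥ n := by
  obtain ⟨G, hG, rfl⟩ := exists_primitive_of_mem_higher e B gc_mem hF hQ
  exact Submodule.mem_sup_left (exists_primitive_mem_deg e B isGraded_funcs hG hd)

theorem subsingleton_H {n : ℤ} (hn : 2 ≤ n) : Subsingleton (H e B n) := by
  rw [Submodule.Quotient.subsingleton_iff, eq_top_iff]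
  rintro ⟨F, ⟨hd, hF⟩, hQ⟩ -
  exact mem_coboundaries_of_mem_higher e B (mem_higher_of_two_le hn hF hd) hd hQ

/-- The cocycle `γ f + c {π, f}` of degree one attached to a function `f` of `x, p, θ`. -/
def zeta : Fun U →ₗ[ℝ] Fun U := LinearMap.mulLeft ℝ ggamma + LinearMap.mulLeft ℝ gc ∘ₗ opD e B

theorem zeta_apply (f : Fun U) : zeta e B f = ggamma * f + gc * opD e B f := rfl

theorem zeta_mem_W {f : Fun U} (hf : f ∈ funcsO U) : zeta e B f ∈ funcsW U :=
  add_mem (mul_mem ggamma_mem_W (funcsO_le_funcsW hf))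
    (mul_mem gc_mem_W (funcsO_le_funcsW (opD_mem e B hf)))

theorem zeta_mem_deg {f : Fun U} (hf : f ∈ funcsO U) : zeta e B f ∈ deg U 1 :=
  add_mem (mul_mem_deg ggamma_mem_deg (funcsO_deg hf))
    (mul_mem_deg gc_mem_deg (funcsO_deg (opD_mem e B hf)))

theorem Q_eq_zeta (hB : IsClosedTwoForm B) {f : Fun U} (hf : f ∈ funcsO U) :
    Q e B f = zeta e B (opD e B f) := by
  rw [zeta_apply, opD_opD e B hB hf, Q_funcsO e B hf]

theorem Q_zeta (hB : IsClosedTwoForm B) {f : Fun U} (hf : f ∈ funcsO U) :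
    Q e B (zeta e B f) = 0 := by
  rw [zeta_apply, map_add, Q_ggamma_mul, Q_gc_mul, Q_funcsO e B hf,
    Q_funcsO e B (opD_mem e B hf), opD_opD e B hB hf]
  simp only [mul_add, gc_mul_gc_mul, gc_mul_ggamma_mul, pow_two, mul_assoc]
  abel

theorem zeta_mem_Z (hB : IsClosedTwoForm B) {f : Fun U} (hf : f ∈ funcsO U) :
    zeta e B f ∈ Z e B 1 :=
  ⟨⟨zeta_mem_deg e B hf, funcsW_le_funcs (zeta_mem_W e B hf)⟩, Q_zeta e B hB hf⟩

theorem zeta_mem_Zred (hB : IsClosedTwoForm B) {f : Fun U} (hf : f ∈ funcsO U) :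
    zeta e B f ∈ Zred e B 1 := by
  refine ⟨⟨zeta_mem_deg e B hf, zeta_mem_W e B hf⟩, ?_⟩
  change Q e B (zeta e B f) ∈ zeroLocus e B
  rw [Q_zeta e B hB hf]
  exact zero_mem _

theorem exists_eq_gamma_add {F : Fun U} (hF : F ∈ funcsW U) (hd : F ∈ deg U 1) :
    ∃ f ∈ funcsO U, ∃ v ∈ funcsO U, F = ggamma * f + gc * v := by
  have h := mem_ghostSpanW hF hd
  clear hF hd
  induction h using Submodule.span_induction with
  | zero => exact ⟨0, zero_mem _, 0, zero_mem _, by simp⟩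
  | add F F' _ _ h h' =>
    obtain ⟨w, hw, v, hv, rfl⟩ := h
    obtain ⟨w', hw', v', hv', rfl⟩ := h'
    refine ⟨w + w', add_mem hw hw', v + v', add_mem hv hv', ?_⟩
    rw [mul_add, mul_add, add_add_add_comm]
  | smul r F _ h =>
    obtain ⟨w, hw, v, hv, rfl⟩ := h
    refine ⟨r • w, Subalgebra.smul_mem _ hw _, r • v, Subalgebra.smul_mem _ hv _, ?_⟩
    rw [mul_smul_comm, mul_smul_comm, smul_add]
  | mem F hF =>
    obtain ⟨l, j, x, hx, h, rfl⟩ := hF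
    rcases j with _ | j
    · obtain rfl : l = 1 := by lia
      exact ⟨x, hx, 0, zero_mem _, by simp [ggamma]⟩
    · obtain rfl : l = 0 := by lia
      obtain rfl : j = 0 := by lia
      exact ⟨0, zero_mem _, x, hx, by simp [mono_zero]⟩

theorem gc_mul_Q_gamma_add {f : Fun U} (hf : f ∈ funcsO U) (v : Fun U) :
    gc * Q e B (ggamma * f + gc * v) = ggamma ^ 2 * (gc * (opD e B f - v)) := by
  rw [map_add, Q_gc_mul, pow_two, mul_assoc, mul_assoc, Q_ggamma_mul, Q_funcsO e B hf]
  simp only [mul_add, mul_sub, mul_neg, gc_mul_gc_mul, gc_mul_ggamma_mul, sub_zero, mul_zero,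
    add_zero]
  abel

/-- Cocycles of degree one modulo `(π, {π, π})` are the cocycles `γ f + c {π, f}` up to the
ideal. -/
theorem exists_sub_zeta_mem_zeroLocus {F : Fun U} (hF : F ∈ Zred e B 1) :
    ∃ f ∈ funcsO U, F - zeta e B f ∈ zeroLocus e B := by
  obtain ⟨⟨hd, hW⟩, hQ⟩ := hF
  obtain ⟨f, hf, v, hv, rfl⟩ := exists_eq_gamma_add hW hd
  refine ⟨f, hf, ?_⟩
  have h : gc * (opD e B f - v) ∈ zeroLocus e B := by
    refine mem_zeroLocus_of_ggamma_sq_mul e B (mul_mem gc_mem_W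
      (subalgebra_sub_mem (funcsO_le_funcsW (opD_mem e B hf)) (funcsO_le_funcsW hv))) ?_
    rw [← gc_mul_Q_gamma_add e B hf]
    exact gc_mul_mem_zeroLocus e B hQ
  rw [zeta_apply, add_sub_add_left_eq_sub, ← mul_sub, ← neg_sub, mul_neg]
  exact neg_mem h

/-- A cocycle of degree one depending on `x, p, θ, c, γ` only is `γ f + c {π, f}`. -/
theorem exists_eq_zeta {F : Fun U} (hF : F ∈ ZW e B 1) : ∃ f ∈ funcsO U, F = zeta e B f := by
  obtain ⟨⟨hd, hW⟩, hQ⟩ := hF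
  obtain ⟨f, hf, v, hv, rfl⟩ := exists_eq_gamma_add hW hd
  refine ⟨f, hf, ?_⟩
  have h1 := gc_mul_Q_gamma_add e B hf v
  have hQ' : Q e B (ggamma * f + gc * v) = 0 := hQ
  rw [hQ', mul_zero] at h1
  have h2 := gc_mul_eq_zero (dL_inr_funcsO _ (subalgebra_sub_mem (opD_mem e B hf) hv))
    (ggamma_sq_mul_cancel h1.symm)
  rw [zeta_apply, sub_eq_zero.1 h2]

/-- Modulo `γ²` and `c`, the only monomials of ghost number one are `γ` times functions of
`x, p, θ`. -/
theorem exists_sub_zeta_mem_higher {F : Fun U} (hF : F ∈ funcs U) (hd : F ∈ deg U 1) :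
    ∃ f ∈ funcsO U, F - zeta e B f ∈ higher (funcs U) := by
  have key : ∃ f ∈ funcsO U, F - ggamma * f ∈ higher (funcs U) := by
    have h := mem_ghostSpan hF hd
    clear hF hd
    induction h using Submodule.span_induction with
    | zero => exact ⟨0, zero_mem _, by simp⟩
    | add F F' _ _ h h' =>
      obtain ⟨f, hf, h⟩ := h
      obtain ⟨f', hf', h'⟩ := h'
      refine ⟨f + f', add_mem hf hf', ?_⟩
      rw [mul_add, add_sub_add_comm]
      exact add_mem h h'
    | smul r F _ h =>
      obtain ⟨f, hf, h⟩ := h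
      refine ⟨r • f, Subalgebra.smul_mem _ hf _, ?_⟩
      rw [mul_smul_comm, ← smul_sub]
      exact Submodule.smul_mem _ _ h
    | mem F hF =>
      obtain ⟨m, l, j, i, x, hx, h, rfl⟩ := hF
      have hx' := mul_mem (pow_mem gb_mem i) (funcsO_le_funcs hx)
      rcases j with _ | j
      · rcases l with _ | _ | l
        · lia
        · obtain rfl : m = 0 := by lia
          obtain rfl : i = 0 := by lia
          exact ⟨x, hx, by simp [ggamma]⟩
        · refine ⟨0, zero_mem _, ?_⟩
          rw [pow_zero, one_mul, mul_zero, sub_zero]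
          exact mono_add_two_mul_mem_higher m l hx'
      · refine ⟨0, zero_mem _, ?_⟩
        rw [pow_succ', mul_assoc gc, mul_zero, sub_zero]
        exact mono_mul_gc_mul_mem_higher m l (mul_mem (pow_mem gc_mem j) hx')
  obtain ⟨f, hf, h⟩ := key
  refine ⟨f, hf, ?_⟩
  rw [zeta_apply, ← sub_sub]
  exact sub_mem h (gc_mul_mem_higher (funcsO_le_funcs (opD_mem e B hf)))

/-- The functions `{π, m} + π n + {π, π} n'` of `x, p, θ`, which are the `f` for which the cocycle
`γ f + c {π, f}` is exact. -/
def exactFns : Submodule ℝ (Fun U) :=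
  (Subalgebra.toSubmodule (funcsO U)).map (opD e B)
    ⊔ (Subalgebra.toSubmodule (funcsO U)).map (LinearMap.mulLeft ℝ (piFn U))
    ⊔ (Subalgebra.toSubmodule (funcsO U)).map (LinearMap.mulLeft ℝ (bigR e B))

theorem mem_exactFns {f : Fun U} : f ∈ exactFns e B ↔ ∃ m ∈ funcsO U, ∃ n ∈ funcsO U,
    ∃ n' ∈ funcsO U, f = opD e B m + piFn U * n + bigR e B * n' := by
  simp only [exactFns, Submodule.mem_sup, Submodule.mem_map, Subalgebra.mem_toSubmodule,
    LinearMap.mulLeft_apply]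
  constructor
  · rintro ⟨_, ⟨_, ⟨m, hm, rfl⟩, _, ⟨n, hn, rfl⟩, rfl⟩, _, ⟨n', hn', rfl⟩, rfl⟩
    exact ⟨m, hm, n, hn, n', hn', rfl⟩
  · rintro ⟨m, hm, n, hn, n', hn', rfl⟩
    exact ⟨_, ⟨_, ⟨m, hm, rfl⟩, _, ⟨n, hn, rfl⟩, rfl⟩, _, ⟨n', hn', rfl⟩, rfl⟩

/-- Modulo `γ²` and `c`, the coboundaries of degree one are the `γ f` with `f` in `exactFns`, by the
formula for the differential of a normal form; what is left over is exact. -/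
theorem zeta_mem_coboundaries (hB : IsClosedTwoForm B) {f : Fun U} (hf : f ∈ funcsO U) :
    zeta e B f ∈ coboundaries (Q e B) (deg U) (Subalgebra.toSubmodule (funcs U)) ⊥ 1
      ↔ f ∈ exactFns e B := by
  have hγ : zeta e B f - ggamma * f ∈ higher (funcs U) := by
    rw [zeta_apply, add_sub_cancel_left]
    exact gc_mul_mem_higher (funcsO_le_funcs (opD_mem e B hf))
  constructor
  · intro h
    rw [coboundaries, inf_bot_eq, sup_bot_eq] at h
    obtain ⟨G, ⟨hGd, hG⟩, hQ⟩ := h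
    obtain ⟨m₀, h0, m₁, h1, n₀, h2, n₁, h3, h4, h5⟩ := exists_normalForm 0 hG (by simpa using hGd)
    obtain rfl := h4 rfl
    have h6 := Q_normalForm e B 0 h0 h1 h2 h3
    have h7 := add_mem (sub_mem (Q_mem_higher e B h5) hγ) h6
    rw [map_sub, hQ] at h7
    have h8 : ggamma * (f - (opD e B m₀ - piFn U * n₀ + (1 / 2 : ℝ) • (bigR e B * n₁)))
        ∈ higher (funcs U) := by
      convert h7 using 1
      simp [normalForm, mul_sub, ggamma]
    have h9 := (normalForm_unique (a₀ := 0) (a₁ := 0) (a₂ := 0) (a₃ := 0) (zero_mem _) (zero_mem _)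
      (subalgebra_sub_mem hf (add_mem (subalgebra_sub_mem (opD_mem e B h0) (mul_mem pi_mem h2))
        (Subalgebra.smul_mem _ (mul_mem (bigR_mem e B) h3) (1 / 2)))) (zero_mem _)
      (by simpa [normalForm, ggamma] using h8)).2.2.1
    refine (mem_exactFns e B).2 ⟨m₀, h0, -n₀, neg_mem h2, (1 / 2 : ℝ) • n₁,
      Subalgebra.smul_mem _ h3 _, ?_⟩
    rw [sub_eq_zero.1 h9, mul_neg, mul_smul_comm, sub_eq_add_neg]
  · intro h
    obtain ⟨m, hm, n, hn, n', hn', h⟩ := (mem_exactFns e B).1 h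
    have h6 := Q_normalForm e B 0 hm (zero_mem _) (neg_mem hn)
      (Subalgebra.smul_mem _ hn' (2 : ℝ))
    set G := normalForm 0 (0 - 1) (0 + 1) 0 m 0 (-n) ((2 : ℝ) • n') with hG
    have hGm : G ∈ funcs U := by
      have h1 : (mono (0 + 1) 1 : Fun U) ∈ funcs U := mono_mem (l := 1)
      have h2 : (mono 0 1 : Fun U) ∈ funcs U := mono_mem (l := 1)
      have h3 : (mono 0 0 : Fun U) ∈ funcs U := mono_mem (l := 0)
      exact add_mem (add_mem (add_mem (mul_mem h3 (funcsO_le_funcs hm))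
        (mul_mem h3 (mul_mem gb_mem (zero_mem _)))) (mul_mem h1 (funcsO_le_funcs (neg_mem hn))))
        (mul_mem h2 (mul_mem gb_mem (funcsO_le_funcs (Subalgebra.smul_mem _ hn' _))))
    have h7 : zeta e B f - Q e B G ∈ higher (funcs U) := by
      convert sub_mem hγ h6 using 1
      simp [normalForm, h, mul_add, ggamma]
    obtain ⟨G', hG', h8⟩ := exists_primitive_of_mem_higher e B gc_mem h7
      (by rw [map_sub, Q_zeta e B hB hf, Q_Q e B hB, sub_zero])
    have h9 : zeta e B f = Q e B (G + G') := by rw [map_add, h8, add_sub_cancel]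
    rw [h9]
    exact Submodule.mem_sup_left (exists_primitive_mem_deg e B isGraded_funcs (add_mem hGm hG')
      (h9 ▸ zeta_mem_deg e B hf))

theorem mem_funcsO_of_mem_deg_zero {F : Fun U} (hF : F ∈ funcsW U) (hd : F ∈ deg U 0) :
    F ∈ funcsO U := by
  refine (Submodule.span_le.2 ?_ : ghostSpanW U 0 ≤ Subalgebra.toSubmodule (funcsO U))
    (mem_ghostSpanW hF hd)
  rintro _ ⟨l, j, x, hx, h, rfl⟩
  obtain rfl : l = 0 := by lia
  obtain rfl : j = 0 := by lia
  simpa [mono_zero] using hx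

theorem gammaCoeff_zeta {f : Fun U} (hf : f ∈ funcsO U) : gammaCoeff U (zeta e B f) = f := by
  have h1 := gammaCoeff_mono_mul 1 0 hf
  have h2 := gammaCoeff_mono_mul 0 1 (opD_mem e B hf)
  rw [zeta_apply, map_add]
  convert congrArg₂ (· + ·) h1 h2 using 1
  · simp [ggamma, mono_zero]
  · simp

theorem zeta_mem_zeroLocus (hB : IsClosedTwoForm B) {n n' : Fun U} (hn : n ∈ funcsO U)
    (hn' : n' ∈ funcsO U) : zeta e B (piFn U * n + bigR e B * n') ∈ zeroLocus e B := by
  refine (mem_zeroLocus e B).2 ⟨zeta e B n, zeta_mem_W e B hn, gc * n + zeta e B n',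
    add_mem (mul_mem gc_mem_W (funcsO_le_funcsW hn)) (zeta_mem_W e B hn'), ?_⟩
  simp only [zeta_apply, map_add, (isOddDer_opD e B).mul, opD_pi, opD_bigR e B hB, inv_pi,
    inv_bigR, zero_mul, zero_add, mul_add, neg_mul, mul_neg, pi_mul_gc_mul,
    mul_mul_comm_of_even (inv_bigR e B), ggamma_mul_mul]
  abel

/-- Here the coboundaries are the `γ {π, m} + c {π, {π, m}}`, and the coefficient of `γ` in an element
of the ideal `(π, {π, π})` is `π n + {π, π} n'`. -/
theorem zeta_mem_coboundaries_reduced (hB : IsClosedTwoForm B) {f : Fun U} (hf : f ∈ funcsO U) :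
    zeta e B f ∈ coboundaries (Q e B) (deg U) (Subalgebra.toSubmodule (funcsW U)) (zeroLocus e B) 1
      ↔ f ∈ exactFns e B := by
  rw [mem_exactFns, coboundaries, Submodule.mem_sup]
  constructor
  · rintro ⟨_, ⟨m, ⟨hmd, hm⟩, rfl⟩, I, ⟨-, hI⟩, h⟩
    have hm' := mem_funcsO_of_mem_deg_zero hm (by simpa using hmd)
    obtain ⟨G, hG, G', hG', rfl⟩ := (mem_zeroLocus e B).1 hI
    refine ⟨m, hm', _, gammaCoeff_mem hG, _, gammaCoeff_mem hG', ?_⟩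
    have h' := congrArg (gammaCoeff U) h
    rw [map_add, map_add, Q_eq_zeta e B hB hm', gammaCoeff_zeta e B (opD_mem e B hm'),
      gammaCoeff_zeta e B hf, gammaCoeff_mul pi_mem, gammaCoeff_mul (bigR_mem e B)] at h'
    rw [← h', add_assoc]
  · rintro ⟨m, hm, n, hn, n', hn', rfl⟩
    have hs : piFn U * n + bigR e B * n' ∈ funcsO U :=
      add_mem (mul_mem pi_mem hn) (mul_mem (bigR_mem e B) hn')
    refine ⟨_, ⟨m, ⟨?_, funcsO_le_funcsW hm⟩, rfl⟩, zeta e B (piFn U * n + bigR e B * n'),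
      ⟨zeta_mem_deg e B hs, zeta_mem_zeroLocus e B hB hn hn'⟩, ?_⟩
    · simpa using funcsO_deg hm
    · rw [Q_eq_zeta e B hB hm, ← map_add, add_assoc]

/-- The map `f ↦ [γ f + c {π, f}]` to a cohomology group in degree one. -/
def zetaClass (N I : Submodule ℝ (Fun U))
    (h : ∀ f ∈ Subalgebra.toSubmodule (funcsO U), zeta e B f ∈ cocycles (Q e B) (deg U) N I 1) :
    Subalgebra.toSubmodule (funcsO U) →ₗ[ℝ] Coh (Q e B) (deg U) N I 1 :=
  Submodule.mkQ _ ∘ₗ (zeta e B).restrict h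

theorem ker_zetaClass {N I : Submodule ℝ (Fun U)}
    (h : ∀ f ∈ Subalgebra.toSubmodule (funcsO U), zeta e B f ∈ cocycles (Q e B) (deg U) N I 1)
    (h' : ∀ f ∈ funcsO U, zeta e B f ∈ coboundaries (Q e B) (deg U) N I 1 ↔ f ∈ exactFns e B) :
    LinearMap.ker (zetaClass e B N I h)
      = (exactFns e B).comap (Subalgebra.toSubmodule (funcsO U)).subtype := by
  ext ⟨f, hf⟩
  rw [LinearMap.mem_ker, zetaClass, LinearMap.comp_apply, Submodule.mkQ_apply,
    Submodule.Quotient.mk_eq_zero]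
  exact h' f hf

theorem cls_eq_of_sub_mem {N I : Submodule ℝ (Fun U)} {n : ℤ} {F G : Fun U}
    (hF : F ∈ cocycles (Q e B) (deg U) N I n) (hG : G ∈ cocycles (Q e B) (deg U) N I n)
    (h : F - G ∈ coboundaries (Q e B) (deg U) N I n) : cls hF = cls hG :=
  (Submodule.Quotient.eq _).2 h

theorem exists_cls_eq_zeta (hB : IsClosedTwoForm B) (z : H e B 1) :
    ∃ f, ∃ hf : f ∈ funcsO U, z = cls (zeta_mem_Z e B hB hf) := by
  obtain ⟨⟨F, ⟨hd, hF⟩, hQ⟩, rfl⟩ := Submodule.Quotient.mk_surjective _ z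
  obtain ⟨f, hf, h⟩ := exists_sub_zeta_mem_higher e B hF hd
  refine ⟨f, hf, cls_eq_of_sub_mem e B ⟨⟨hd, hF⟩, hQ⟩ _ ?_⟩
  refine mem_coboundaries_of_mem_higher e B h (sub_mem hd (zeta_mem_deg e B hf)) ?_
  have hQ' : Q e B F = 0 := hQ
  rw [map_sub, hQ', Q_zeta e B hB hf, sub_zero]

theorem exists_cls_reduced_eq_zeta (hB : IsClosedTwoForm B) (z : Hred e B 1) :
    ∃ f, ∃ hf : f ∈ funcsO U, z = cls (zeta_mem_Zred e B hB hf) := by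
  obtain ⟨⟨F, hF⟩, rfl⟩ := Submodule.Quotient.mk_surjective _ z
  obtain ⟨f, hf, h⟩ := exists_sub_zeta_mem_zeroLocus e B hF
  exact ⟨f, hf, cls_eq_of_sub_mem e B hF _ (Submodule.mem_sup_right
    ⟨sub_mem hF.1.1 (zeta_mem_deg e B hf), h⟩)⟩

theorem exists_linearEquiv_of_ker_eq {P V W : Type*} [AddCommGroup P] [Module ℝ P]
    [AddCommGroup V] [Module ℝ V] [AddCommGroup W] [Module ℝ W] {a : P →ₗ[ℝ] V} {b : P →ₗ[ℝ] W}
    (ha : Function.Surjective a) (hb : Function.Surjective b)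
    (h : LinearMap.ker a = LinearMap.ker b) : ∃ Φ : V ≃ₗ[ℝ] W, ∀ x, Φ (a x) = b x := by
  refine ⟨(a.quotKerEquivOfSurjective ha).symm ≪≫ₗ Submodule.quotEquivOfEq _ _ h
    ≪≫ₗ b.quotKerEquivOfSurjective hb, fun x => ?_⟩
  have h1 : (a.quotKerEquivOfSurjective ha).symm (a x) = Submodule.Quotient.mk x :=
    (LinearEquiv.symm_apply_eq _).2 rfl
  rw [LinearEquiv.trans_apply, LinearEquiv.trans_apply, h1, Submodule.quotEquivOfEq_mk]
  rfl

/-- In degree one both cohomology groups are the quotient of the functions of `x, p, θ` by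
`exactFns`. -/
theorem exists_equiv_reduced_one (hB : IsClosedTwoForm B) :
    ∃ Φ : H e B 1 ≃ₗ[ℝ] Hred e B 1, ∀ f, ∀ hf : f ∈ funcsO U,
      Φ (cls (zeta_mem_Z e B hB hf)) = cls (zeta_mem_Zred e B hB hf) := by
  let a := zetaClass e B (Subalgebra.toSubmodule (funcs U)) ⊥ fun f hf => zeta_mem_Z e B hB hf
  let b := zetaClass e B (Subalgebra.toSubmodule (funcsW U)) (zeroLocus e B)
    fun f hf => zeta_mem_Zred e B hB hf
  have ha : Function.Surjective a := fun z => by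
    obtain ⟨f, hf, rfl⟩ := exists_cls_eq_zeta e B hB z
    exact ⟨⟨f, hf⟩, rfl⟩
  have hb : Function.Surjective b := fun z => by
    obtain ⟨f, hf, rfl⟩ := exists_cls_reduced_eq_zeta e B hB z
    exact ⟨⟨f, hf⟩, rfl⟩
  have hk : LinearMap.ker a = LinearMap.ker b :=
    (ker_zetaClass e B _ fun f hf => zeta_mem_coboundaries e B hB hf).trans
      (ker_zetaClass e B _ fun f hf => zeta_mem_coboundaries_reduced e B hB hf).symm
  obtain ⟨Φ, hΦ⟩ := exists_linearEquiv_of_ker_eq ha hb hk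
  exact ⟨Φ, fun f hf => hΦ ⟨f, hf⟩⟩

end Positive

/-! ### The cohomology groups -/

section CohomologyGroups

variable (e : Frame U) (B : Matrix (Fin d) (Fin d) (SmoothFn U))

theorem X_base' (k : ℕ) (g : SmoothFn U) :
    X e B k (base g) = ggamma * divBeta k * base g * Theta U
      - (2 : ℝ) • (divBeta (k - 1) * gb * gc * base g * Theta U)
      + divBeta k * gc * base g * bracket e B (piFn U) (Theta U) := by
  rw [X_base, ← opD_eq]
  simp only [mul_assoc]

theorem Y_base' (hB : IsClosedTwoForm B) (k : ℕ) (g : SmoothFn U) :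
    Y e B k (base g) = (2 : ℝ) • (divBeta (k - 2) * gb * base g * Theta U)
      + divBeta (k - 1) * base g * bracket e B (piFn U) (Theta U)
      - ((2 : ℝ) • (divBeta (k - 1) * gb * gc) - ggamma * divBeta k)
        * bracket e B (bracket e B (piFn U) (base g)) (Theta U)
      + divBeta k * gc * bracket e B (piFn U)
        (bracket e B (bracket e B (piFn U) (base g)) (Theta U)) := by
  rw [Y_base e B hB]
  simp only [← opD_eq, mul_assoc, sub_mul, smul_mul_assoc]

theorem exists_cls_eq_X_add_Y (hB : IsClosedTwoForm B) {n : ℕ} (hn : 1 ≤ n) (z : H e B (-n)) :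
    ∃ (f g : SmoothFn U) (hX : X e B (n + 1) (base f) ∈ Z e B (-n))
      (hY : Y e B (n + 1) (base g) ∈ Z e B (-n)), z = cls hX + cls hY := by
  obtain ⟨⟨F, ⟨hd, hF⟩, hQ⟩, rfl⟩ := Submodule.Quotient.mk_surjective _ z
  obtain ⟨f, g, G, hG, h⟩ := exists_eq_X_add_Y e B hB hn hF hd hQ
  have hX : X e B (n + 1) (base f) ∈ Z e B (-n) :=
    ⟨⟨X_base_mem_deg e B _ f (by push_cast; ring), X_base_mem e B _ f⟩, Q_Q e B hB _⟩
  have hY : Y e B (n + 1) (base g) ∈ Z e B (-n) :=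
    ⟨⟨Y_base_mem_deg e B _ g (by push_cast; ring), Y_base_mem e B hB _ g⟩, Q_Q e B hB _⟩
  refine ⟨f, g, hX, hY, (Submodule.Quotient.eq _).2 ?_⟩
  have h1 : F - (X e B (n + 1) (base f) + Y e B (n + 1) (base g)) = Q e B G := by
    rw [h, add_sub_cancel_left]
  change F - (X e B (n + 1) (base f) + Y e B (n + 1) (base g))
    ∈ coboundaries (Q e B) (deg U) (Subalgebra.toSubmodule (funcs U)) ⊥ (-n)
  rw [h1]
  exact Submodule.mem_sup_left (exists_primitive_mem_deg e B isGraded_funcs hG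
    (h1 ▸ sub_mem hd (add_mem hX.1.1 hY.1.1)))

theorem ZW_le_Z (n : ℤ) : ZW e B n ≤ Z e B n := fun _ hF =>
  ⟨⟨hF.1.1, funcsW_le_funcs hF.1.2⟩, hF.2⟩

theorem ZW_le_Zred (n : ℤ) : ZW e B n ≤ Zred e B n := fun F hF => by
  refine ⟨hF.1, ?_⟩
  have h : Q e B F = 0 := hF.2
  change Q e B F ∈ zeroLocus e B
  rw [h]
  exact zero_mem _

theorem exists_equiv_reduced_ZW_one (hB : IsClosedTwoForm B) :
    ∃ Φ : H e B 1 ≃ₗ[ℝ] Hred e B 1, ∀ F, F ∈ ZW e B 1 →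
      ∃ (hF : F ∈ Z e B 1) (hF' : F ∈ Zred e B 1), Φ (cls hF) = cls hF' := by
  obtain ⟨Φ, hΦ⟩ := exists_equiv_reduced_one e B hB
  refine ⟨Φ, fun F hF => ?_⟩
  obtain ⟨f, hf, h⟩ := exists_eq_zeta e B hF
  subst h
  exact ⟨zeta_mem_Z e B hB hf, zeta_mem_Zred e B hB hf, hΦ f hf⟩

theorem exists_ZW_one (hB : IsClosedTwoForm B) (z : H e B 1) :
    ∃ F, F ∈ ZW e B 1 ∧ ∃ hF : F ∈ Z e B 1, z = cls hF := by
  obtain ⟨f, hf, h⟩ := exists_cls_eq_zeta e B hB z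
  exact ⟨zeta e B f, ⟨⟨zeta_mem_deg e B hf, zeta_mem_W e B hf⟩, Q_zeta e B hB hf⟩,
    zeta_mem_Z e B hB hf, h⟩

theorem exists_equiv_reduced (hB : IsClosedTwoForm B) {n : ℤ} (hn : 1 ≤ n) :
    (∀ z : H e B n, ∃ F, F ∈ ZW e B n ∧ ∃ hF : F ∈ Z e B n, z = cls hF) ∧
      ∃ Φ : H e B n ≃ₗ[ℝ] Hred e B n, ∀ F, F ∈ ZW e B n →
        ∃ (hF : F ∈ Z e B n) (hF' : F ∈ Zred e B n), Φ (cls hF) = cls hF' := by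
  rcases hn.eq_or_lt with h | hn
  · subst h
    exact ⟨exists_ZW_one e B hB, exists_equiv_reduced_ZW_one e B hB⟩
  · have h1 : Subsingleton (H e B n) := subsingleton_H e B hn
    have h2 : Subsingleton (Hred e B n) := subsingleton_Hred e B hn
    have Φ : H e B n ≃ₗ[ℝ] Hred e B n :=
      LinearEquiv.ofLinearMap 0 0 (Subsingleton.elim _ _) (Subsingleton.elim _ _)
    exact ⟨fun z => ⟨0, zero_mem _, zero_mem _, h1.elim _ _⟩, Φ, fun F hF =>
      ⟨ZW_le_Z e B n hF, ZW_le_Zred e B n hF, h2.elim _ _⟩⟩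

end CohomologyGroups

end SpinningParticle

end

open SpinningParticle in
theorem mainTheorem3 (d : ℕ) (U : TopologicalSpace.Opens (Fin d → ℝ)) (e : Frame U)
    (B : Matrix (Fin d) (Fin d) (SmoothFn U)) (hB : IsClosedTwoForm B) :
    -- the complexes
    IsComplex (Q e B) (deg U) (Subalgebra.toSubmodule (funcs U)) ⊥ ∧
    IsComplex (Q e B) (deg U) (Subalgebra.toSubmodule (funcsW U)) ⊥ ∧
    IsComplex (Q e B) (deg U) (Subalgebra.toSubmodule (funcsW U)) (zeroLocus e B) ∧
    -- the cocycles
    (∀ k : ℕ, ∀ f ∈ funcsUW U,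
      (X e B k f ∈ funcs U ∧ Q e B (X e B k f) = 0) ∧
      (Y e B k f ∈ funcs U ∧ Q e B (Y e B k f) = 0)) ∧
    (∀ (k : ℕ) (g : SmoothFn U),
      X e B k (base g) = ggamma * divBeta k * base g * Theta U
        - (2 : ℝ) • (divBeta (k - 1) * gb * gc * base g * Theta U)
        + divBeta k * gc * base g * bracket e B (piFn U) (Theta U)) ∧
    (∀ (k : ℕ) (g : SmoothFn U),
      Y e B k (base g) = (2 : ℝ) • (divBeta (k - 2) * gb * base g * Theta U)
        + divBeta (k - 1) * base g * bracket e B (piFn U) (Theta U)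
        - ((2 : ℝ) • (divBeta (k - 1) * gb * gc) - ggamma * divBeta k)
          * bracket e B (bracket e B (piFn U) (base g)) (Theta U)
        + divBeta k * gc * bracket e B (piFn U)
          (bracket e B (bracket e B (piFn U) (base g)) (Theta U))) ∧
    -- negative degrees
    (∀ n : ℕ, 1 ≤ n → ∀ z : H e B (-n), ∃ (f g : SmoothFn U)
      (hX : X e B (n + 1) (base f) ∈ Z e B (-n)) (hY : Y e B (n + 1) (base g) ∈ Z e B (-n)),
      z = cls hX + cls hY) ∧
    -- positive degrees
    (∀ n : ℤ, 1 ≤ n →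
      (∀ z : H e B n, ∃ F, F ∈ ZW e B n ∧ ∃ hF : F ∈ Z e B n, z = cls hF) ∧
      ∃ Φ : H e B n ≃ₗ[ℝ] Hred e B n, ∀ F, F ∈ ZW e B n →
        ∃ (hF : F ∈ Z e B n) (hF' : F ∈ Zred e B n), Φ (cls hF) = cls hF') ∧
    -- vanishing above degree one
    (∀ n : ℤ, 2 ≤ n → Subsingleton (H e B n)) := by
  refine ⟨isComplex_funcs e B hB, isComplex_funcsW e B hB, isComplex_reduced e B hB,
    fun k f hf => ?_, X_base' e B, Y_base' e B hB, fun n hn z => exists_cls_eq_X_add_Y e B hB hn z,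
    fun n hn => exists_equiv_reduced e B hB hn, fun n hn => subsingleton_H e B hn⟩
  have h := X_Y_mem e B hB hf
  exact ⟨⟨h.1 k, Q_Q e B hB _⟩, h.2 k, Q_Q e B hB _⟩
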